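/- Let $k$ be a field and $q\in k$, $q\neq 0$, with $[2]_q=q+q^{-1}\neq 0$. For $n\ge 0$ let $T_n=T_n(q)$ be the Temperley–Lieb algebra, i.e. the unital $k$-algebra with generators $U_1,\dots,U_{n-1}$ and relations $U_i^2=[2]_qU_i$, $U_iU_{i\pm1}U_i=U_i$, $U_iU_j=U_jU_i$ for $|i-j|\ne 1$. For $\gamma,\delta\in k$ with $\delta\ne 0$ let $b_n$ be the blob algebra: for $n\ge1$ it has generators $e,U_1,\dots,U_{n-1}$, the relations above, and $e^2=\delta e$, $U_1eU_1=\gamma U_1$, $U_ie=eU_i$ for $i\neq1$; and $b_0=k$. (For $q^2\neq 1$, $\gamma=q^{m-1}-q^{-m+1}$ and $\delta=q^m-q^{-m}$, the condition $\delta\neq0$ says $[m]_q\neq0$.) Let $A_n$ denote $T_n$ or $b_n$, and let $\Lambda_n$ be the weight set $\{n,n-2,\dots,0\text{ or }1\}$ for $T_n$ and $\{-n,-n+2,\dots,n-2,n\}$ for $b_n$. For $n\ge2$ put $\epsilon=\epsilon_n=[2]_q^{-1}U_{n-1}\in A_n$. It commutes with the image of the homomorphism $A_{n-2}\to A_n$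 sending generators to generators of the same name, so $A_n\epsilon$ is an $A_n$-$A_{n-2}$-bimodule. The globalisation functor is $$G:A_{n-2}\text{-mod}\to A_n\text{-mod},\qquad N\mapsto A_n\epsilon\otimes_{A_{n-2}}N ,$$ and $L^iG$ $(i\ge0)$ denotes its $i$-th left derived functor. The simple $A_n$-modules $L_n(\lambda)$ are labelled as follows. For $|\lambda|=n-2r$ put $c_r=U_{n-1}U_{n-3}\cdots U_{n-2r+1}$ ($r$ factors; $c_0=1$, and $c_r=0$ if $2r>n$). Then $L_n(\lambda)$ is the simple module $L$ with $c_rL\ne0$ and $c_{r+1}L=0$ and, in the blob case, such that $e$ acts on $c_rL$ as $\delta$ if $\lambda>0$ and as $0$ if $\lambda<0$. Order the weights by $\mu\triangleleft\lambda$ if $|\mu|>|\lambda|$. The standard module $\Delta_n(\lambda)$ is the largest quotient of the projective cover of $L_n(\lambda)$ all of whose composition factors are of the form $L_n(\mu)$ with $\mu\trianglelefteq\lambda$. Then for both algebras, for every $n\ge2$ and every $\lambda\in\Lambda_{n-2}$, the standard modules $\Delta_{n-2}(\lambda)$ and $\Delta_n(\lambda)$ exist and $$L^0G\,\Delta_{n-2}(\lambda)\cong\Delta_n(\lambda),\qquad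 L^iG\,\Delta_{n-2}(\lambda)=0\quad\text{for all } i>0 .$$ -/

import Mathlib

open CategoryTheory TensorProduct

universe u

noncomputable section

/-! ## Presentations of the Temperley–Lieb and blob algebras -/

/-- Defining relations of the Temperley–Lieb algebra on `n` strands.  The letter `i : Fin (n - 1)`
stands for the generator `U_{i+1}`. -/
inductive TLRel {k : Type u} [Field k] (n : ℕ) (q : k) :
    FreeAlgebra k (Fin (n - 1)) → FreeAlgebra k (Fin (n - 1)) → Prop
  | sq (i : Fin (n - 1)) :
      TLRel n q (FreeAlgebra.ι k i * FreeAlgebra.ι k i) ((q + q⁻¹) • FreeAlgebra.ι k i)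
  | braid (i j : Fin (n - 1)) (h : i.val + 1 = j.val ∨ j.val + 1 = i.val) :
      TLRel n q (FreeAlgebra.ι k i * FreeAlgebra.ι k j * FreeAlgebra.ι k i) (FreeAlgebra.ι k i)
  | comm (i j : Fin (n - 1)) (h : ¬ (i.val + 1 = j.val ∨ j.val + 1 = i.val)) :
      TLRel n q (FreeAlgebra.ι k i * FreeAlgebra.ι k j) (FreeAlgebra.ι k j * FreeAlgebra.ι k i)

/-- The Temperley–Lieb algebra `T_n(q)`; `T_0(q) = T_1(q) = k`. -/
abbrev TL {k : Type u} [Field k] (n : ℕ) (q : k) : Type u := RingQuot (TLRel n q)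

/-- Defining relations of the blob algebra on `n` strands.  The letter `0 : Fin n` stands for `e`
and the letter `i ≠ 0` stands for `U_i`.  For `n = 0` there are no letters, so `b_0 = k`. -/
inductive BlobRel {k : Type u} [Field k] (n : ℕ) (q γ δ : k) :
    FreeAlgebra k (Fin n) → FreeAlgebra k (Fin n) → Prop
  | sq (i : Fin n) (hi : i.val ≠ 0) :
      BlobRel n q γ δ (FreeAlgebra.ι k i * FreeAlgebra.ι k i) ((q + q⁻¹) • FreeAlgebra.ι k i)
  | braid (i j : Fin n) (hi : i.val ≠ 0) (hj : j.val ≠ 0)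
      (h : i.val + 1 = j.val ∨ j.val + 1 = i.val) :
      BlobRel n q γ δ (FreeAlgebra.ι k i * FreeAlgebra.ι k j * FreeAlgebra.ι k i)
        (FreeAlgebra.ι k i)
  | comm (i j : Fin n) (h : ¬ (i.val + 1 = j.val ∨ j.val + 1 = i.val)) :
      BlobRel n q γ δ (FreeAlgebra.ι k i * FreeAlgebra.ι k j)
        (FreeAlgebra.ι k j * FreeAlgebra.ι k i)
  | blob_sq (i : Fin n) (hi : i.val = 0) :
      BlobRel n q γ δ (FreeAlgebra.ι k i * FreeAlgebra.ι k i) (δ • FreeAlgebra.ι k i)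
  | blob (i j : Fin n) (hi : i.val = 1) (hj : j.val = 0) :
      BlobRel n q γ δ (FreeAlgebra.ι k i * FreeAlgebra.ι k j * FreeAlgebra.ι k i)
        (γ • FreeAlgebra.ι k i)

/-- The blob algebra `b_n` with loop parameter `q + q⁻¹` and `U_1 e U_1 = γ U_1`, `e e = δ e`. -/
abbrev Blob {k : Type u} [Field k] (n : ℕ) (q γ δ : k) : Type u := RingQuot (BlobRel n q γ δ)

namespace TL

/-- The generator `U_i` of `T_n(q)` for `1 ≤ i ≤ n - 1`; by convention `0` for all other `i`. -/
def U {k : Type u} [Field k] (n : ℕ) (q : k) (i : ℕ) : TL n q :=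
  if h : 1 ≤ i ∧ i < n then
    RingQuot.mkAlgHom k (TLRel n q) (FreeAlgebra.ι k ⟨i - 1, by omega⟩)
  else 0

/-- The product `U_{n-1} U_{n-3} ⋯ U_{n-2r+1}` of `r` commuting generators.  It is `1` for `r = 0`
and `0` for `2 r > n`. -/
def cup {k : Type u} [Field k] (n : ℕ) (q : k) (r : ℕ) : TL n q :=
  ((List.range r).map fun j => U n q (n - 1 - 2 * j)).prod

/-- The algebra map `T_n(q) → T_{n+2}(q)`, `U_i ↦ U_i`. -/
def incl {k : Type u} [Field k] (n : ℕ) (q : k) : TL n q →ₐ[k] TL (n + 2) q :=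
  RingQuot.liftAlgHom k ⟨FreeAlgebra.lift k fun i : Fin (n - 1) =>
      RingQuot.mkAlgHom k (TLRel (n + 2) q) (FreeAlgebra.ι k ⟨i.val, by omega⟩), by
    intro x y h
    cases h with
    | sq i =>
      simpa using RingQuot.mkAlgHom_rel k (TLRel.sq (n := n + 2) (q := q) ⟨i.val, by omega⟩)
    | braid i j h =>
      simpa using RingQuot.mkAlgHom_rel k
        (TLRel.braid (n := n + 2) (q := q) ⟨i.val, by omega⟩ ⟨j.val, by omega⟩ h)
    | comm i j h =>
      simpa using RingQuot.mkAlgHom_rel k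
        (TLRel.comm (n := n + 2) (q := q) ⟨i.val, by omega⟩ ⟨j.val, by omega⟩ h)⟩

/-- The idempotent `ε = U_{n+1} / [2]_q` of `T_{n+2}(q)`. -/
def eps {k : Type u} [Field k] (n : ℕ) (q : k) : TL (n + 2) q :=
  (q + q⁻¹)⁻¹ • U (n + 2) q (n + 1)

theorem eps_comm {k : Type u} [Field k] (n : ℕ) (q : k) (b : TL n q) :
    eps n q * (incl n q).toRingHom b = (incl n q).toRingHom b * eps n q := by
  change Commute (eps n q) (incl n q b)
  refine Commute.smul_left ?_ _
  obtain ⟨a, rfl⟩ := RingQuot.mkAlgHom_surjective k (TLRel n q) b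
  induction a using FreeAlgebra.induction with
  | grade0 r => simpa using (Algebra.commute_algebraMap_right r (U (n + 2) q (n + 1)))
  | grade1 i =>
    have h1 : 1 ≤ n + 1 ∧ n + 1 < n + 2 := by omega
    have h := RingQuot.mkAlgHom_rel k
      (TLRel.comm (n := n + 2) (q := q) ⟨n + 1 - 1, by omega⟩ ⟨i.val, by omega⟩
        (by simp only; omega))
    simp only [map_mul] at h
    simp only [U, dif_pos h1, incl, RingQuot.liftAlgHom_mkAlgHom_apply, FreeAlgebra.lift_ι_apply]
    exact h
  | mul a b ha hb => rw [map_mul, map_mul]; exact ha.mul_right hb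
  | add a b ha hb => rw [map_add, map_add]; exact ha.add_right hb

end TL

namespace Blob

/-- The generator `U_i` of `b_n` for `1 ≤ i ≤ n - 1`; by convention `0` for all other `i`. -/
def U {k : Type u} [Field k] (n : ℕ) (q γ δ : k) (i : ℕ) : Blob n q γ δ :=
  if h : 1 ≤ i ∧ i < n then
    RingQuot.mkAlgHom k (BlobRel n q γ δ) (FreeAlgebra.ι k ⟨i, h.2⟩)
  else 0

/-- The generator `e` of `b_n` for `1 ≤ n`; by convention `0` for `n = 0`. -/
def e {k : Type u} [Field k] (n : ℕ) (q γ δ : k) : Blob n q γ δ :=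
  if h : 0 < n then RingQuot.mkAlgHom k (BlobRel n q γ δ) (FreeAlgebra.ι k ⟨0, h⟩) else 0

/-- The product `U_{n-1} U_{n-3} ⋯ U_{n-2r+1}` of `r` commuting generators.  It is `1` for `r = 0`
and `0` for `2 r > n`. -/
def cup {k : Type u} [Field k] (n : ℕ) (q γ δ : k) (r : ℕ) : Blob n q γ δ :=
  ((List.range r).map fun j => U n q γ δ (n - 1 - 2 * j)).prod

/-- The algebra map `b_n → b_{n+2}`, `e ↦ e`, `U_i ↦ U_i`. -/
def incl {k : Type u} [Field k] (n : ℕ) (q γ δ : k) : Blob n q γ δ →ₐ[k] Blob (n + 2) q γ δ :=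
  RingQuot.liftAlgHom k ⟨FreeAlgebra.lift k fun i : Fin n =>
      RingQuot.mkAlgHom k (BlobRel (n + 2) q γ δ) (FreeAlgebra.ι k ⟨i.val, by omega⟩), by
    intro x y h
    cases h with
    | sq i hi =>
      simpa using RingQuot.mkAlgHom_rel k
        (BlobRel.sq (n := n + 2) (q := q) (γ := γ) (δ := δ) ⟨i.val, by omega⟩ hi)
    | braid i j hi hj h =>
      simpa using RingQuot.mkAlgHom_rel k
        (BlobRel.braid (n := n + 2) (q := q) (γ := γ) (δ := δ)
          ⟨i.val, by omega⟩ ⟨j.val, by omega⟩ hi hj h)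
    | comm i j h =>
      simpa using RingQuot.mkAlgHom_rel k
        (BlobRel.comm (n := n + 2) (q := q) (γ := γ) (δ := δ)
          ⟨i.val, by omega⟩ ⟨j.val, by omega⟩ h)
    | blob_sq i hi =>
      simpa using RingQuot.mkAlgHom_rel k
        (BlobRel.blob_sq (n := n + 2) (q := q) (γ := γ) (δ := δ) ⟨i.val, by omega⟩ hi)
    | blob i j hi hj =>
      simpa using RingQuot.mkAlgHom_rel k
        (BlobRel.blob (n := n + 2) (q := q) (γ := γ) (δ := δ)
          ⟨i.val, by omega⟩ ⟨j.val, by omega⟩ hi hj)⟩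

/-- The idempotent `ε = U_{n+1} / [2]_q` of `b_{n+2}`. -/
def eps {k : Type u} [Field k] (n : ℕ) (q γ δ : k) : Blob (n + 2) q γ δ :=
  (q + q⁻¹)⁻¹ • U (n + 2) q γ δ (n + 1)

theorem eps_comm {k : Type u} [Field k] (n : ℕ) (q γ δ : k) (b : Blob n q γ δ) :
    eps n q γ δ * (incl n q γ δ).toRingHom b = (incl n q γ δ).toRingHom b * eps n q γ δ := by
  change Commute (eps n q γ δ) (incl n q γ δ b)
  refine Commute.smul_left ?_ _
  obtain ⟨a, rfl⟩ := RingQuot.mkAlgHom_surjective k (BlobRel n q γ δ) b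
  induction a using FreeAlgebra.induction with
  | grade0 r => simpa using (Algebra.commute_algebraMap_right r (U (n + 2) q γ δ (n + 1)))
  | grade1 i =>
    have h1 : 1 ≤ n + 1 ∧ n + 1 < n + 2 := by omega
    have h := RingQuot.mkAlgHom_rel k
      (BlobRel.comm (n := n + 2) (q := q) (γ := γ) (δ := δ) ⟨n + 1, by omega⟩ ⟨i.val, by omega⟩
        (by simp only; omega))
    simp only [map_mul] at h
    simp only [U, dif_pos h1, incl, RingQuot.liftAlgHom_mkAlgHom_apply, FreeAlgebra.lift_ι_apply]
    exact h
  | mul a b ha hb => rw [map_mul, map_mul]; exact ha.mul_right hb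
  | add a b ha hb => rw [map_add, map_add]; exact ha.add_right hb

end Blob

/-! ## Tensoring with a bimodule over noncommutative rings, and globalisation -/

section Globalisation

/-- Let `X` be a left `A`-module with a commuting right `B`-action `ρ : Bᵐᵒᵖ →+* End_A X`, and `N` a
left `B`-module.  The `A`-submodule of `X ⊗_ℤ N` generated by all `x b ⊗ y - x ⊗ b y`. -/
def balancedRelations {A B : Type u} [Ring A] [Ring B] {X : Type u} [AddCommGroup X] [Module A X]
    (ρ : Bᵐᵒᵖ →+* Module.End A X) (N : Type u) [AddCommGroup N] [Module B N] :
    Submodule A (X ⊗[ℤ] N) :=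
  Submodule.span A
    {z | ∃ (x : X) (b : B) (y : N), z = ρ (MulOpposite.op b) x ⊗ₜ[ℤ] y - x ⊗ₜ[ℤ] (b • y)}

theorem balancedRelations_le_comap {A B : Type u} [Ring A] [Ring B] {X : Type u} [AddCommGroup X]
    [Module A X] (ρ : Bᵐᵒᵖ →+* Module.End A X) {M N : Type u} [AddCommGroup M] [Module B M]
    [AddCommGroup N] [Module B N] (f : M →ₗ[B] N) :
    balancedRelations ρ M ≤ (balancedRelations ρ N).comap
      (TensorProduct.AlgebraTensorModule.map (LinearMap.id : X →ₗ[A] X)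
        f.toAddMonoidHom.toIntLinearMap) := by
  refine Submodule.span_le.2 ?_
  rintro _ ⟨x, b, y, rfl⟩
  refine Submodule.subset_span ⟨x, b, f y, ?_⟩
  simp

/-- The map `X ⊗_B M → X ⊗_B N`, `x ⊗ y ↦ x ⊗ f y`. -/
def tensorMap {A B : Type u} [Ring A] [Ring B] {X : Type u} [AddCommGroup X]
    [Module A X] (ρ : Bᵐᵒᵖ →+* Module.End A X) {M N : Type u} [AddCommGroup M] [Module B M]
    [AddCommGroup N] [Module B N] (f : M →ₗ[B] N) :
    ((X ⊗[ℤ] M) ⧸ balancedRelations ρ M) →ₗ[A] ((X ⊗[ℤ] N) ⧸ balancedRelations ρ N) :=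
  Submodule.mapQ _ _ (TensorProduct.AlgebraTensorModule.map (LinearMap.id : X →ₗ[A] X)
    f.toAddMonoidHom.toIntLinearMap) (balancedRelations_le_comap ρ f)

theorem tensorMap_mk_tmul {A B : Type u} [Ring A] [Ring B] {X : Type u} [AddCommGroup X]
    [Module A X] (ρ : Bᵐᵒᵖ →+* Module.End A X) {M N : Type u} [AddCommGroup M] [Module B M]
    [AddCommGroup N] [Module B N] (f : M →ₗ[B] N) (x : X) (y : M) :
    tensorMap ρ f (Submodule.Quotient.mk (x ⊗ₜ[ℤ] y)) = Submodule.Quotient.mk (x ⊗ₜ[ℤ] f y) :=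
  rfl

theorem tensor_hom_ext {A B : Type u} [Ring A] [Ring B] {X : Type u} [AddCommGroup X]
    [Module A X] {ρ : Bᵐᵒᵖ →+* Module.End A X} {M : Type u} [AddCommGroup M] [Module B M]
    {Y : Type u} [AddCommGroup Y] [Module A Y]
    {f g : ((X ⊗[ℤ] M) ⧸ balancedRelations ρ M) →ₗ[A] Y}
    (h : ∀ (x : X) (y : M), f (Submodule.Quotient.mk (x ⊗ₜ[ℤ] y)) =
      g (Submodule.Quotient.mk (x ⊗ₜ[ℤ] y))) : f = g := by
  refine LinearMap.ext fun z => ?_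
  obtain ⟨z, rfl⟩ := Submodule.Quotient.mk_surjective _ z
  induction z using TensorProduct.induction_on with
  | zero => rw [Submodule.Quotient.mk_zero, map_zero, map_zero]
  | tmul x y => exact h x y
  | add a b ha hb => rw [Submodule.Quotient.mk_add, map_add, map_add, ha, hb]

/-- The functor `N ↦ X ⊗_B N` from left `B`-modules to left `A`-modules, for an
`A`-`B`-bimodule `X`. -/
def tensorFunctor {A B : Type u} [Ring A] [Ring B] {X : Type u} [AddCommGroup X] [Module A X]
    (ρ : Bᵐᵒᵖ →+* Module.End A X) : ModuleCat.{u} B ⥤ ModuleCat.{u} A where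
  obj N := ModuleCat.of A ((X ⊗[ℤ] N) ⧸ balancedRelations ρ N)
  map f := ModuleCat.ofHom (tensorMap ρ f.hom)
  map_id _ := ModuleCat.hom_ext (tensor_hom_ext fun _ _ => rfl)
  map_comp _ _ := ModuleCat.hom_ext (tensor_hom_ext fun _ _ => rfl)

instance tensorFunctor_additive {A B : Type u} [Ring A] [Ring B] {X : Type u} [AddCommGroup X]
    [Module A X] (ρ : Bᵐᵒᵖ →+* Module.End A X) : (tensorFunctor ρ).Additive where
  map_add {_ _ f g} := ModuleCat.hom_ext (tensor_hom_ext fun x y =>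
    congrArg Submodule.Quotient.mk (TensorProduct.tmul_add x (f.hom y) (g.hom y)))

/-- If `ε ∈ A` commutes with the image of `ι : B → A`, then `B` acts on the left ideal `A ε` from
the right by `x · b = x * ι b`. -/
def rightAction {A B : Type u} [Ring A] [Ring B] (ε : A) (ι : B →+* A)
    (hε : ∀ b, ε * ι b = ι b * ε) : Bᵐᵒᵖ →+* Module.End A (Ideal.span {ε}) where
  toFun b := (LinearMap.toSpanSingleton A A (ι b.unop)).restrict (by
    intro x hx
    obtain ⟨a, rfl⟩ := Ideal.mem_span_singleton'.1 hx
    exact Ideal.mem_span_singleton'.2 ⟨a * ι b.unop, by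
      simp [mul_assoc, hε]⟩)
  map_one' := by ext x; simp
  map_mul' b c := by ext x; simp [mul_assoc]
  map_zero' := by ext x; simp
  map_add' b c := by ext x; simp [mul_add]

/-- The globalisation functor `N ↦ A ε ⊗_B N`. -/
def globalisation {A B : Type u} [Ring A] [Ring B] (ε : A) (ι : B →+* A)
    (hε : ∀ b, ε * ι b = ι b * ε) : ModuleCat.{u} B ⥤ ModuleCat.{u} A :=
  tensorFunctor (rightAction ε ι hε)

instance globalisation_additive {A B : Type u} [Ring A] [Ring B] (ε : A) (ι : B →+* A)
    (hε : ∀ b, ε * ι b = ι b * ε) : (globalisation ε ι hε).Additive :=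
  tensorFunctor_additive _

end Globalisation

/-- The globalisation functor `G : T_n-mod → T_{n+2}-mod`, `N ↦ T_{n+2} ε ⊗_{T_n} N`. -/
def TL.G {k : Type u} [Field k] (n : ℕ) (q : k) :
    ModuleCat.{u} (TL n q) ⥤ ModuleCat.{u} (TL (n + 2) q) :=
  globalisation (TL.eps n q) (TL.incl n q).toRingHom (TL.eps_comm n q)

instance TL.G_additive {k : Type u} [Field k] (n : ℕ) (q : k) : (TL.G n q).Additive :=
  globalisation_additive _ _ _

/-- The globalisation functor `G : b_n-mod → b_{n+2}-mod`, `N ↦ b_{n+2} ε ⊗_{b_n} N`. -/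
def Blob.G {k : Type u} [Field k] (n : ℕ) (q γ δ : k) :
    ModuleCat.{u} (Blob n q γ δ) ⥤ ModuleCat.{u} (Blob (n + 2) q γ δ) :=
  globalisation (Blob.eps n q γ δ) (Blob.incl n q γ δ).toRingHom (Blob.eps_comm n q γ δ)

instance Blob.G_additive {k : Type u} [Field k] (n : ℕ) (q γ δ : k) : (Blob.G n q γ δ).Additive :=
  globalisation_additive _ _ _

/-! ## Standard modules -/

/-- `f : P → L` is a projective cover: `P` is projective, `f` is onto and its kernel is
superfluous. -/
def IsProjectiveCover {A : Type u} [Ring A] {P L : ModuleCat.{u} A} (f : P →ₗ[A] L) : Prop :=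
  Module.Projective A P ∧ Function.Surjective f ∧
    ∀ N : Submodule A P, N ⊔ LinearMap.ker f = ⊤ → N = ⊤

/-- All composition factors (simple subquotients) of `M` have the property `C`. -/
def AllFactors {A : Type u} [Ring A] (C : ModuleCat.{u} A → Prop) (M : ModuleCat.{u} A) : Prop :=
  ∀ N₁ N₂ : Submodule A M, N₁ ⋖ N₂ → C (ModuleCat.of A (N₂ ⧸ N₁.submoduleOf N₂))

/-- Let the simple `A`-modules be labelled by `Λ`, where `IsL l S` says that `S` is the simple module
labelled `l`, and let `le` be an order on `Λ`.  Then `IsStandard IsL le l D` says that `D` is the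
standard module `Δ(l)`: the largest quotient of the projective cover `P(l)` of `L(l)` all of whose
composition factors are of the form `L(m)` with `m ≤ l`. -/
def IsStandard {A : Type u} [Ring A] {Λ : Type} (IsL : Λ → ModuleCat.{u} A → Prop)
    (le : Λ → Λ → Prop) (l : Λ) (D : ModuleCat.{u} A) : Prop :=
  ∃ (L P : ModuleCat.{u} A) (f : P →ₗ[A] L) (g : P →ₗ[A] D),
    IsL l L ∧ IsProjectiveCover f ∧ Function.Surjective g ∧
    AllFactors (fun S => ∃ m, le m l ∧ IsL m S) D ∧
    ∀ N : Submodule A P, AllFactors (fun S => ∃ m, le m l ∧ IsL m S) (ModuleCat.of A (P ⧸ N)) →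
      LinearMap.ker g ≤ N

namespace TL

/-- The weight set `{n, n - 2, …, 0 or 1}`. -/
def weights (n : ℕ) : Set ℕ := {l | ∃ r, n = l + 2 * r}

/-- `S` is the simple `T_n`-module `L_n(l)`, `l = n - 2 r`: the simple module on which
`U_{n-1} U_{n-3} ⋯` with `r` factors does not act by zero but with `r + 1` factors does.
So `L_n(n)` is the simple module killed by all `U_i`, and `ε L_n(l) = L_{n-2}(l)` for `l < n`. -/
def IsL {k : Type u} [Field k] (n : ℕ) (q : k) (l : ℕ) (S : ModuleCat.{u} (TL n q)) : Prop :=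
  IsSimpleModule (TL n q) S ∧ ∃ r, n = l + 2 * r ∧
    (∃ s : S, cup n q r • s ≠ 0) ∧ ∀ s : S, cup n q (r + 1) • s = 0

/-- `D` is the standard module `Δ_n(l)` of `T_n`, for the reverse of the natural order on
weights. -/
def IsDelta {k : Type u} [Field k] (n : ℕ) (q : k) (l : ℕ) (D : ModuleCat.{u} (TL n q)) : Prop :=
  IsStandard (IsL n q) (fun m l => l ≤ m) l D

end TL

namespace Blob

/-- The weight set `{-n, -n + 2, …, n - 2, n}`. -/
def weights (n : ℕ) : Set ℤ := {l | ∃ r, n = l.natAbs + 2 * r}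

/-- `S` is the simple `b_n`-module `L_n(l)`, `|l| = n - 2 r`: the simple module on which
`c = U_{n-1} U_{n-3} ⋯` with `r` factors does not act by zero but with `r + 1` factors does, and such
that `e` acts on `c S` as `δ` if `l > 0` and as `0` if `l < 0`. -/
def IsL {k : Type u} [Field k] (n : ℕ) (q γ δ : k) (l : ℤ)
    (S : ModuleCat.{u} (Blob n q γ δ)) : Prop :=
  IsSimpleModule (Blob n q γ δ) S ∧ ∃ r, n = l.natAbs + 2 * r ∧
    (∃ s : S, cup n q γ δ r • s ≠ 0) ∧ (∀ s : S, cup n q γ δ (r + 1) • s = 0) ∧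
    (0 < l → ∀ s : S, (e n q γ δ * cup n q γ δ r) • s = (δ • cup n q γ δ r) • s) ∧
    (l < 0 → ∀ s : S, (e n q γ δ * cup n q γ δ r) • s = 0)

/-- `D` is the standard module `Δ_n(l)` of `b_n`, for the order in which weights of smaller absolute
value are higher and `l`, `-l` are incomparable. -/
def IsDelta {k : Type u} [Field k] (n : ℕ) (q γ δ : k) (l : ℤ)
    (D : ModuleCat.{u} (Blob n q γ δ)) : Prop :=
  IsStandard (IsL n q γ δ) (fun m l => m = l ∨ l.natAbs < m.natAbs) l D

end Blob

end

/-! Both families are treated at once: a `BlobSystem` consists of elements of an algebra satisfying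
the blob relations, and the Temperley–Lieb algebra is the case `e = 1`, `δ = 1`, `γ = d`. Write B
for the algebra on `n` strands and A for the one on `n + 2`. Let J_r be the two-sided ideal
generated by the product `c` of `r` commuting generators, and let f(l), with |l| = n - 2r, be the
idempotent obtained from `c` and the idempotent `s l`, which is e/δ, 1 - e/δ or 1. Modulo J_{r+1}
one has f(l) B f(l) = k f(l), and f(-l) B f(l) vanishes if l is nonzero.

The main tool is a cellular basis. A walk p of length n starting at 0, on ℤ for blob and on ℕ for
Temperley–Lieb, gives u(p) = f_1(p_1) ⋯ f_n(p_n) and the reversed product v(p). The elements u(p)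
v(q), for p and q with a common end, form a basis, and those with at least r cups span J_r. Spanning
(`J_le_cellSpan`) is an induction on strands and needs only the relations. For independence the
parameters are deformed over k[[X]]. Over its fraction field the generators act on functions on
walks through a nowhere vanishing harmonic weight, and all matrix units are realised
(`realized_matUnit`), so a dimension count applies. The k[[X]]-algebra generated by these operators
is then free on the cell elements, and setting X = 0 gives an algebra over k which receives a
homomorphism from the presented algebra (`exists_linearIndependent`, `Good.of_compat`).

With the basis, the standard module of weight l is the cell module B f(l) modulo J_{r+1}
(`Good.nonempty_equiv`): the condition on composition factors says exactly that two elements of the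
algebra act by zero (`Good.allFactors_iff`). Since ε f_n(l) = f_{n+2}(l), globalisation sends the
cell module of weight l for B to the one for A (`Glob.deltaEquiv`). As G is right exact, this
settles degree 0.

Vanishing in higher degrees is a descending induction on r for the modules B/J_r, starting from B
itself. A cell module with r cups is a direct summand of B/J_{r+1}, so it is acyclic once B/J_{r+1}
is. There is an exact sequence 0 → ⊕ Δ → B/J_{r+1} → B/J_r → 0 whose first term is a sum of such
cell modules, indexed by walks w and mapped by right multiplication by v(w). The quotient is acyclic
provided G keeps the first map injective. That is `Glob.layer_injective`: the elements f_{n+2}(l)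
v(w), where l is the end of w, remain left independent modulo the appropriate ideal of A. This holds
because each w can be prolonged by one step away from zero and one step back, giving distinct walks
of length n + 2 to which the independence of the cell basis of A applies. -/

noncomputable section

/-! ## Algebras with Temperley–Lieb generators and a blob generator -/

/-- Elements `e`, `U_1, …, U_{n-1}` of an algebra satisfying the relations of the blob algebra, with
loop parameter `d`.  The Temperley–Lieb algebra is an instance with `e = 1`, `δ = 1`, `γ = d`. -/
structure BlobSystem (R A : Type*) [CommRing R] [Ring A] [Algebra R A] where
  d : R
  d' : R
  γ : R
  δ : R
  δ' : R
  n : ℕ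
  e : A
  U : ℕ → A
  d_mul : d * d' = 1
  δ_mul : δ * δ' = 1
  U_zero : U 0 = 0
  U_of_le : ∀ i, n ≤ i → U i = 0
  U_sq : ∀ i, U i * U i = d • U i
  U_braid : ∀ i, 1 ≤ i → i + 1 < n → U i * U (i + 1) * U i = U i
  U_braid' : ∀ i, 1 ≤ i → U (i + 1) * U i * U (i + 1) = U (i + 1)
  U_comm : ∀ i j, i + 2 ≤ j → U i * U j = U j * U i
  e_sq : e * e = δ • e
  e_blob : U 1 * e * U 1 = γ • U 1
  e_comm : ∀ i, i ≠ 1 → e * U i = U i * e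

namespace BlobSystem

section

variable {R A : Type*} [CommRing R] [Ring A] [Algebra R A] (S : BlobSystem R A)

/-- The product `U_{m-1} U_{m-3} ⋯` of `r` factors. -/
def c : ℕ → ℕ → A
  | _, 0 => 1
  | m, r + 1 => S.U (m - 1) * c (m - 2) r

/-- The idempotent `e / δ`, `1 - e / δ` or `1` according to the sign of `h`. -/
def s (h : ℤ) : A := if 0 < h then S.δ' • S.e else if h < 0 then 1 - S.δ' • S.e else 1

/-- The idempotent of weight `h` on `m` strands. -/
def f (m : ℕ) (h : ℤ) : A :=
  S.d' ^ ((m - h.natAbs) / 2) • (S.c m ((m - h.natAbs) / 2) * S.s h)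

/-- The subalgebra on the first `m` strands. -/
def level (m : ℕ) : Subalgebra R A :=
  Algebra.adjoin R {x | (∃ i, i < m ∧ x = S.U i) ∨ (1 ≤ m ∧ x = S.e)}

/-- The ideal of the subalgebra on `m` strands generated by `c m r`. -/
def J (m r : ℕ) : Submodule R A :=
  (S.level m).toSubmodule * Submodule.span R {S.c m r} * (S.level m).toSubmodule

lemma d'_mul : S.d' * S.d = 1 := by rw [mul_comm, S.d_mul]

lemma δ'_mul : S.δ' * S.δ = 1 := by rw [mul_comm, S.δ_mul]

lemma level_mono {m m' : ℕ} (h : m ≤ m') : S.level m ≤ S.level m' := by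
  refine Algebra.adjoin_mono ?_
  rintro x (⟨i, hi, rfl⟩ | ⟨h1, rfl⟩)
  · exact Or.inl ⟨i, by omega, rfl⟩
  · exact Or.inr ⟨by omega, rfl⟩

lemma U_mem {i m : ℕ} (h : i < m) : S.U i ∈ S.level m :=
  Algebra.subset_adjoin (Or.inl ⟨i, h, rfl⟩)

lemma U_pred_mem (m : ℕ) : S.U (m - 1) ∈ S.level m := by
  rcases m with _ | m
  · simp [S.U_zero]
  · exact S.U_mem (by simp)

lemma e_mem {m : ℕ} (h : 1 ≤ m) : S.e ∈ S.level m :=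
  Algebra.subset_adjoin (Or.inr ⟨h, rfl⟩)

@[simp] lemma c_zero (m : ℕ) : S.c m 0 = 1 := by simp [c]

lemma c_succ (m r : ℕ) : S.c m (r + 1) = S.U (m - 1) * S.c (m - 2) r := by rw [c]

lemma c_mem (m r : ℕ) : S.c m r ∈ S.level m := by
  induction r generalizing m with
  | zero => simp
  | succ r ih =>
    rw [c_succ]
    exact mul_mem (S.U_pred_mem m) (S.level_mono (by omega) (ih _))

/-- Truncated subtraction eventually produces the factor `U 0 = 0`. -/
lemma c_eq_zero {m r : ℕ} (h : m < 2 * r) : S.c m r = 0 := by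
  induction r generalizing m with
  | zero => omega
  | succ r ih =>
    rw [c_succ]
    by_cases hm : m ≤ 1
    · rw [show m - 1 = 0 by omega, S.U_zero, zero_mul]
    · rw [ih (by omega), mul_zero]

lemma commute_c {x : A} {m : ℕ} (h : ∀ i < m, Commute x (S.U i)) (r : ℕ) :
    Commute x (S.c m r) := by
  induction r generalizing m with
  | zero => simp
  | succ r ih =>
    rw [c_succ]
    refine Commute.mul_right ?_ (ih fun i hi => h i (by omega))
    rcases m with _ | m
    · simp [S.U_zero]
    · exact h _ (by simp)

lemma commute_U {i j : ℕ} (h : i + 2 ≤ j ∨ j + 2 ≤ i) : Commute (S.U i) (S.U j) := by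
  rcases h with h | h
  · exact S.U_comm i j h
  · exact (S.U_comm j i h).symm

lemma commute_U_c {j m : ℕ} (h : m < j) (r : ℕ) : Commute (S.U j) (S.c m r) :=
  S.commute_c (fun i hi => S.commute_U (by omega)) r

lemma commute_U_pred_c (m r : ℕ) : Commute (S.U (m - 1)) (S.c (m - 2) r) := by
  by_cases hm : m ≤ 1
  · rw [show m - 1 = 0 by omega, S.U_zero]; exact Commute.zero_left _
  · exact S.commute_U_c (by omega) r

lemma c_sq (m r : ℕ) : S.c m r * S.c m r = S.d ^ r • S.c m r := by
  induction r generalizing m with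
  | zero => simp
  | succ r ih =>
    rw [c_succ]
    have h := S.commute_U_pred_c m r
    calc S.U (m - 1) * S.c (m - 2) r * (S.U (m - 1) * S.c (m - 2) r)
        = (S.U (m - 1) * S.U (m - 1)) * (S.c (m - 2) r * S.c (m - 2) r) := by
          rw [mul_assoc, ← mul_assoc (S.c (m - 2) r), ← h.eq]; simp only [mul_assoc]
      _ = _ := by rw [S.U_sq, ih, smul_mul_smul_comm, pow_succ']

/-- Each factor U_j of the outer products meets U_{j+1} in the middle one, and U_j U_{j+1} U_j =
U_j; peeling off the factor of largest index gives the induction. The bound on `m` ensures that the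
largest index in the middle is still a genuine generator. This identity moves cups between
consecutive numbers of strands. -/
lemma c_zigzag {m : ℕ} (hm : m + 1 ≤ S.n) (t : ℕ) :
    S.c m t * S.c (m + 1) t * S.c m t = S.c m t := by
  induction t generalizing m with
  | zero => simp
  | succ t ih =>
    by_cases h2 : m < 2
    · rw [S.c_eq_zero (m := m) (by omega)]; simp
    obtain ⟨m, rfl⟩ : ∃ k, m = k + 2 := ⟨m - 2, by omega⟩
    have ih := ih (m := m) (by omega)
    have e1 : S.c (m + 2) (t + 1) = S.U (m + 1) * S.c m t := by rw [c_succ]; rfl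
    have e2 : S.c (m + 2 + 1) (t + 1) = S.U (m + 2) * S.c (m + 1) t := by rw [c_succ]; rfl
    have h1 : Commute (S.U (m + 1)) (S.c m t) := S.commute_U_c (by omega) t
    have h3 : Commute (S.U (m + 2)) (S.c m t) := S.commute_U_c (by omega) t
    have h4 : Commute (S.U (m + 2)) (S.c (m + 1) t) := S.commute_U_c (by omega) t
    have h5 := S.U_braid (m + 1) (by omega) (by omega)
    rw [e1, e2]
    calc S.U (m + 1) * S.c m t * (S.U (m + 2) * S.c (m + 1) t) * (S.U (m + 1) * S.c m t)
        = S.U (m + 1) * (S.c m t * S.U (m + 2)) * S.c (m + 1) t * (S.U (m + 1) * S.c m t) := by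
          simp only [mul_assoc]
      _ = S.U (m + 1) * S.U (m + 2) * (S.c m t * S.c (m + 1) t * S.c m t) * S.U (m + 1) := by
          rw [← h3.eq, h1.eq]; simp only [mul_assoc]
      _ = S.U (m + 1) * S.U (m + 2) * S.U (m + 1) * S.c m t := by
          rw [ih, mul_assoc, ← h1.eq, ← mul_assoc]
      _ = _ := by rw [show m + 2 = m + 1 + 1 from rfl, h5]

lemma commute_e_c {m r : ℕ} (h : 2 * r < m) : Commute S.e (S.c m r) := by
  induction r generalizing m with
  | zero => simp
  | succ r ih =>
    rw [c_succ]
    exact Commute.mul_right (S.e_comm _ (by omega)) (ih (by omega))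

lemma c_succ' (m r : ℕ) : S.c m (r + 1) = S.c m r * S.U (m - 1 - 2 * r) := by
  induction r generalizing m with
  | zero => simp [c_succ]
  | succ r ih =>
    rw [c_succ, ih, c_succ S m r, mul_assoc]
    congr 3
    omega

lemma commute_level {x : A} {m : ℕ} (h : ∀ i < m, Commute x (S.U i))
    (he : 1 ≤ m → Commute x S.e) {y : A} (hy : y ∈ S.level m) : Commute x y := by
  induction hy using Algebra.adjoin_induction with
  | mem y hy =>
    rcases hy with ⟨i, hi, rfl⟩ | ⟨h1, rfl⟩
    exacts [h i hi, he h1]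
  | algebraMap r => exact (Algebra.commute_algebraMap_right r x)
  | add _ _ _ _ h1 h2 => exact h1.add_right h2
  | mul _ _ _ _ h1 h2 => exact h1.mul_right h2

lemma commute_U_level {j m : ℕ} (h : m < j) {y : A} (hy : y ∈ S.level m) : Commute (S.U j) y :=
  S.commute_level (fun i hi => S.commute_U (by omega))
    (fun h1 => (S.e_comm j (by omega)).symm) hy

/-- The smallest index in `c m r` is m - 2r + 1, at distance at least two from the generators on the
first m - 2r strands; if `e` is among those, that index is at least 2. -/
lemma commute_c_level (m r : ℕ) {y : A} (hy : y ∈ S.level (m - 2 * r)) :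
    Commute (S.c m r) y := by
  induction r generalizing m with
  | zero => simp
  | succ r ih =>
    rw [c_succ]
    refine Commute.mul_left ?_ (ih _ (by convert hy using 2; omega))
    by_cases hm : m ≤ 1
    · rw [show m - 1 = 0 by omega, S.U_zero]; exact Commute.zero_left _
    · exact S.commute_U_level (by omega) hy

lemma level_zero {x : A} (hx : x ∈ S.level 0) : ∃ a : R, x = algebraMap R A a := by
  induction hx using Algebra.adjoin_induction with
  | mem y hy => rcases hy with ⟨i, hi, rfl⟩ | ⟨h1, rfl⟩ <;> omega
  | algebraMap r => exact ⟨r, rfl⟩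
  | add _ _ _ _ h1 h2 =>
    obtain ⟨a, rfl⟩ := h1
    obtain ⟨b, rfl⟩ := h2
    exact ⟨a + b, by simp⟩
  | mul _ _ _ _ h1 h2 =>
    obtain ⟨a, rfl⟩ := h1
    obtain ⟨b, rfl⟩ := h2
    exact ⟨a * b, by simp⟩

lemma level_one {x : A} (hx : x ∈ S.level 1) : ∃ a b : R, x = a • (1 : A) + b • S.e := by
  induction hx using Algebra.adjoin_induction with
  | mem y hy =>
    rcases hy with ⟨i, hi, rfl⟩ | ⟨h1, rfl⟩
    · exact ⟨0, 0, by rw [show i = 0 by omega, S.U_zero]; simp⟩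
    · exact ⟨0, 1, by simp⟩
  | algebraMap r => exact ⟨r, 0, by simp [Algebra.algebraMap_eq_smul_one]⟩
  | add _ _ _ _ h1 h2 =>
    obtain ⟨a, b, rfl⟩ := h1
    obtain ⟨a', b', rfl⟩ := h2
    exact ⟨a + a', b + b', by module⟩
  | mul _ _ _ _ h1 h2 =>
    obtain ⟨a, b, rfl⟩ := h1
    obtain ⟨a', b', rfl⟩ := h2
    refine ⟨a * a', a * b' + b * a' + b * b' * S.δ, ?_⟩
    simp only [add_mul, mul_add, smul_mul_smul_comm, one_mul, mul_one, S.e_sq, smul_smul]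
    module

/-- Jones' normal form: every element on m + 1 strands can be written with at most one U_m per term.
With L the algebra on m strands, the hypothesis makes L + L U_m L closed under multiplication, and
it contains the generators. The hypothesis is kept separate because `U_mul_level_mul_U` proves it by
an induction that uses this lemma. -/
lemma level_succ_le_of {m : ℕ} (hm : 1 ≤ m)
    (hQ : ∀ x ∈ S.level m, ∃ y ∈ S.level m, S.U m * x * S.U m = y * S.U m) :
    (S.level (m + 1)).toSubmodule ≤ (S.level m).toSubmodule ⊔
      (S.level m).toSubmodule * Submodule.span R {S.U m} * (S.level m).toSubmodule := by
  set L := (S.level m).toSubmodule with hL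
  set u := Submodule.span R {S.U m}
  have hLL : L * L ≤ L := Submodule.mul_le.2 fun a ha b hb => mul_mem (S := Subalgebra R A) ha hb
  have h1 : (1 : A) ∈ L := one_mem (S.level m)
  have hu : u * L * u ≤ L * u := by
    refine Submodule.mul_le.2 fun a ha b hb => ?_
    obtain ⟨β, rfl⟩ := Submodule.mem_span_singleton.1 hb
    induction ha using Submodule.mul_induction_on' with
    | mem_mul_mem a ha x hx =>
      obtain ⟨α, rfl⟩ := Submodule.mem_span_singleton.1 ha
      obtain ⟨y, hy, hxy⟩ := hQ x hx
      have : α • S.U m * x * β • S.U m = ((α * β) • y) * S.U m := by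
        rw [smul_mul_assoc, smul_mul_assoc, mul_smul_comm, hxy, smul_smul, smul_mul_assoc]
      rw [this]
      exact Submodule.mul_mem_mul (L.smul_mem _ hy) (Submodule.mem_span_singleton_self _)
    | add x _ y _ hx hy => rw [add_mul]; exact add_mem hx hy
  have hT : (L ⊔ L * u * L) * (L ⊔ L * u * L) ≤ L ⊔ L * u * L := by
    rw [Submodule.sup_mul, Submodule.mul_sup, Submodule.mul_sup]
    refine sup_le (sup_le (hLL.trans le_sup_left) ?_) (sup_le ?_ ?_)
    · rw [← mul_assoc, ← mul_assoc]
      exact (mul_le_mul_left (mul_le_mul_left hLL _) _).trans le_sup_right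
    · rw [mul_assoc]
      exact (mul_le_mul_right hLL _).trans le_sup_right
    · calc L * u * L * (L * u * L) = L * (u * (L * L) * u) * L := by simp only [mul_assoc]
        _ ≤ L * (u * L * u) * L := by gcongr
        _ ≤ L * (L * u) * L := by gcongr
        _ = L * L * u * L := by simp only [mul_assoc]
        _ ≤ L * u * L := by gcongr
        _ ≤ _ := le_sup_right
  intro x hx
  change x ∈ S.level (m + 1) at hx
  induction hx using Algebra.adjoin_induction with
  | mem y hy =>
    rcases hy with ⟨i, hi, rfl⟩ | ⟨_, rfl⟩
    · rcases Nat.lt_succ_iff_lt_or_eq.1 hi with hi | rfl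
      · exact Submodule.mem_sup_left (S.U_mem hi)
      · refine Submodule.mem_sup_right ?_
        have := Submodule.mul_mem_mul (Submodule.mul_mem_mul h1
          (Submodule.mem_span_singleton_self (R := R) (S.U i))) h1
        simpa using this
    · exact Submodule.mem_sup_left (S.e_mem hm)
  | algebraMap r => exact Submodule.mem_sup_left (algebraMap_mem (S.level m) r)
  | add _ _ _ _ h1 h2 => exact add_mem h1 h2
  | mul _ _ _ _ h1 h2 => exact hT (Submodule.mul_mem_mul h1 h2)

/-- The analogue of Jones' conditional expectation. In the normal form on m + 1 strands, U_{m+1}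
commutes with the terms free of U_m, which yields a factor d; in the remaining terms U_{m+1} U_m
U_{m+1} = U_{m+1}. On one strand only 1 and `e` occur, giving d and γ. -/
lemma U_mul_level_mul_U {m : ℕ} (hm : 1 ≤ m) {x : A} (hx : x ∈ S.level m) :
    ∃ y ∈ S.level (m - 1), S.U m * x * S.U m = y * S.U m := by
  induction m, hm using Nat.le_induction generalizing x with
  | base =>
    obtain ⟨a, b, rfl⟩ := S.level_one hx
    refine ⟨(a * S.d + b * S.γ) • 1, Subalgebra.smul_mem _ (one_mem _) _, ?_⟩
    rw [mul_add, add_mul, mul_smul_comm, mul_smul_comm, smul_mul_assoc, smul_mul_assoc, S.e_blob,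
      mul_one, S.U_sq, smul_mul_assoc, one_mul]
    module
  | succ m hm ih =>
    have hP := S.level_succ_le_of hm fun x hx => by
      obtain ⟨y, hy, h⟩ := ih hx
      exact ⟨y, S.level_mono (by omega) hy, h⟩
    rw [Nat.add_sub_cancel]
    have h0 : ∀ y ∈ S.level m, Commute (S.U (m + 1)) y := fun y hy =>
      S.commute_U_level (by omega) hy
    obtain ⟨y, hy, z, hz, rfl⟩ := Submodule.mem_sup.1 (hP hx)
    have h2 : ∃ w ∈ S.level m, S.U (m + 1) * z * S.U (m + 1) = w * S.U (m + 1) := by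
      clear hx
      induction hz using Submodule.mul_induction_on' with
      | mem_mul_mem a ha b hb =>
        obtain ⟨α, hα, β, rfl⟩ : ∃ α ∈ S.level m, ∃ t : R, a = t • (α * S.U m) := by
          clear hb
          induction ha using Submodule.mul_induction_on' with
          | mem_mul_mem a ha u hu =>
            obtain ⟨t, rfl⟩ := Submodule.mem_span_singleton.1 hu
            exact ⟨a, ha, t, by rw [mul_smul_comm]⟩
          | add x _ y _ hx hy =>
            obtain ⟨a, ha, t, rfl⟩ := hx
            obtain ⟨b, hb, t', rfl⟩ := hy
            refine ⟨t • a + t' • b, add_mem (Subalgebra.smul_mem _ ha _)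
              (Subalgebra.smul_mem _ hb _), 1, ?_⟩
            rw [add_mul, smul_mul_assoc, smul_mul_assoc, one_smul]
        refine ⟨β • (α * b), Subalgebra.smul_mem _ (mul_mem hα hb) _, ?_⟩
        have hb' := h0 b hb
        have ha' := h0 α hα
        calc S.U (m + 1) * (β • (α * S.U m) * b) * S.U (m + 1)
            = β • (S.U (m + 1) * α * S.U m * (b * S.U (m + 1))) := by
              simp only [smul_mul_assoc, mul_smul_comm, mul_assoc]
          _ = β • (α * (S.U (m + 1) * S.U m * S.U (m + 1)) * b) := by
              rw [← hb'.eq, ha'.eq]; simp only [mul_assoc]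
          _ = _ := by
              rw [S.U_braid' m hm, mul_assoc, hb'.eq]
              simp only [smul_mul_assoc, mul_assoc]
      | add x _ y _ hx hy =>
        obtain ⟨a, ha, h1⟩ := hx
        obtain ⟨b, hb, h2⟩ := hy
        exact ⟨a + b, add_mem ha hb, by rw [mul_add, add_mul, h1, h2, add_mul]⟩
    obtain ⟨w, hw, h2⟩ := h2
    refine ⟨S.d • y + w, add_mem (Subalgebra.smul_mem _ hy _) hw, ?_⟩
    rw [mul_add, add_mul, h2, add_mul, (h0 y hy).eq, mul_assoc, S.U_sq, mul_smul_comm,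
      smul_mul_assoc]

lemma level_succ_le {m : ℕ} (hm : 1 ≤ m) :
    (S.level (m + 1)).toSubmodule ≤ (S.level m).toSubmodule ⊔
      (S.level m).toSubmodule * Submodule.span R {S.U m} * (S.level m).toSubmodule :=
  S.level_succ_le_of hm fun x hx => by
    obtain ⟨y, hy, h⟩ := S.U_mul_level_mul_U hm hx
    exact ⟨y, S.level_mono (by omega) hy, h⟩

end

end BlobSystem

/-! ### The ideals `J` and the weight idempotents `f` -/

namespace BlobSystem

section

variable {R A : Type*} [CommRing R] [Ring A] [Algebra R A] (S : BlobSystem R A)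

lemma mul_span_mul_induction {M N : Submodule R A} {u : A} {p : A → Prop}
    (h : ∀ a ∈ M, ∀ b ∈ N, p (a * u * b)) (hadd : ∀ x y, p x → p y → p (x + y))
    {z : A} (hz : z ∈ M * Submodule.span R {u} * N) : p z := by
  induction hz using Submodule.mul_induction_on' with
  | mem_mul_mem x hx b hb =>
    obtain ⟨a, ha, rfl⟩ : ∃ a ∈ M, x = a * u := by
      clear hb
      induction hx using Submodule.mul_induction_on' with
      | mem_mul_mem a ha v hv =>
        obtain ⟨t, rfl⟩ := Submodule.mem_span_singleton.1 hv
        exact ⟨t • a, M.smul_mem _ ha, by rw [mul_smul_comm, smul_mul_assoc]⟩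
      | add x _ y _ hx hy =>
        obtain ⟨a, ha, rfl⟩ := hx
        obtain ⟨b, hb, rfl⟩ := hy
        exact ⟨a + b, add_mem ha hb, (add_mul _ _ _).symm⟩
    exact h a ha b hb
  | add x _ y _ hx hy => exact hadd x y hx hy

lemma level_succ_mul_U {m : ℕ} (hm : 1 ≤ m) {x : A} (hx : x ∈ S.level (m + 1)) :
    ∃ y ∈ S.level m, x * S.U m = y * S.U m := by
  obtain ⟨a, ha, z, hz, rfl⟩ := Submodule.mem_sup.1 (S.level_succ_le hm hx)
  obtain ⟨y, hy, hzy⟩ : ∃ y ∈ S.level m, z * S.U m = y * S.U m := by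
    clear hx
    refine mul_span_mul_induction (p := fun z => ∃ y ∈ S.level m, z * S.U m = y * S.U m)
      ?_ ?_ hz
    · intro a ha b hb
      obtain ⟨y, hy, h⟩ := S.U_mul_level_mul_U hm hb
      refine ⟨a * y, mul_mem ha (S.level_mono (by omega) hy), ?_⟩
      rw [mul_assoc, mul_assoc, ← mul_assoc (S.U m), h, mul_assoc]
    · rintro x y ⟨a, ha, h1⟩ ⟨b, hb, h2⟩
      exact ⟨a + b, add_mem ha hb, by rw [add_mul, h1, h2, add_mul]⟩
  exact ⟨a + y, add_mem ha hy, by rw [add_mul, hzy, add_mul]⟩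

lemma U_mul_level_succ_mul_U {m : ℕ} (hm : 1 ≤ m) {x : A} (hx : x ∈ S.level (m + 1)) :
    ∃ y ∈ S.level (m - 1), S.U m * x * S.U m = y * S.U m := by
  obtain ⟨y, hy, h⟩ := S.level_succ_mul_U hm hx
  obtain ⟨z, hz, h'⟩ := S.U_mul_level_mul_U hm hy
  exact ⟨z, hz, by rw [mul_assoc, h, ← mul_assoc, h']⟩

/-- The conditional expectation is applied once for each factor of `c`, each time losing two
strands. -/
lemma c_mul_level_mul_c {m r : ℕ} (h : 2 * r ≤ m) {x : A} (hx : x ∈ S.level m) :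
    ∃ y ∈ S.level (m - 2 * r), S.c m r * x * S.c m r = y * S.c m r := by
  induction r generalizing m x with
  | zero => exact ⟨x, hx, by simp⟩
  | succ r ih =>
    obtain ⟨m, rfl⟩ : ∃ k, m = k + 2 := ⟨m - 2, by omega⟩
    obtain ⟨y, hy, hxy⟩ := S.U_mul_level_succ_mul_U (m := m + 1) (by omega) hx
    obtain ⟨z, hz, hyz⟩ := ih (m := m) (by omega) hy
    have hc : Commute (S.U (m + 1)) (S.c m r) := S.commute_U_c (by omega) r
    have e1 : S.c (m + 2) (r + 1) = S.U (m + 1) * S.c m r := by rw [c_succ]; rfl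
    refine ⟨z, by convert hz using 2; omega, ?_⟩
    calc S.c (m + 2) (r + 1) * x * S.c (m + 2) (r + 1)
        = S.c m r * (S.U (m + 1) * x * S.U (m + 1)) * S.c m r := by
          rw [e1]
          nth_rw 1 [hc.eq]
          simp only [mul_assoc]
      _ = S.c m r * y * S.c m r * S.U (m + 1) := by rw [hxy]; simp only [mul_assoc, hc.eq]
      _ = _ := by rw [hyz, e1, hc.eq, mul_assoc]

lemma c_mem_J (m r : ℕ) : S.c m r ∈ S.J m r := by
  have h1 : (1 : A) ∈ (S.level m).toSubmodule := one_mem (S.level m)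
  have := Submodule.mul_mem_mul (Submodule.mul_mem_mul h1
    (Submodule.mem_span_singleton_self (R := R) (S.c m r))) h1
  simpa [J] using this

lemma mul_mem_J_left {m r : ℕ} {x y : A} (hx : x ∈ S.level m) (hy : y ∈ S.J m r) :
    x * y ∈ S.J m r := by
  have hLL : (S.level m).toSubmodule * (S.level m).toSubmodule ≤ (S.level m).toSubmodule :=
    Submodule.mul_le.2 fun a ha b hb => mul_mem (S := Subalgebra R A) ha hb
  have := Submodule.mul_mem_mul (M := (S.level m).toSubmodule) hx hy
  rw [J, ← mul_assoc, ← mul_assoc] at this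
  exact mul_le_mul_left (mul_le_mul_left hLL _) _ this

lemma mul_mem_J_right {m r : ℕ} {x y : A} (hx : x ∈ S.level m) (hy : y ∈ S.J m r) :
    y * x ∈ S.J m r := by
  have hLL : (S.level m).toSubmodule * (S.level m).toSubmodule ≤ (S.level m).toSubmodule :=
    Submodule.mul_le.2 fun a ha b hb => mul_mem (S := Subalgebra R A) ha hb
  have := Submodule.mul_mem_mul (N := (S.level m).toSubmodule) hy hx
  rw [J, mul_assoc] at this
  exact mul_le_mul_right hLL _ this

lemma J_le {m r m' r' : ℕ} (hm : m ≤ m') (hc : S.c m r ∈ S.J m' r') : S.J m r ≤ S.J m' r' :=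
  fun _ hz => mul_span_mul_induction (p := fun z => z ∈ S.J m' r')
    (fun _ ha _ hb => S.mul_mem_J_right (S.level_mono hm hb)
      (S.mul_mem_J_left (S.level_mono hm ha) hc)) (fun _ _ => add_mem) hz

lemma U_sub_mem (m k : ℕ) : S.U (m - 1 - k) ∈ S.level m := by
  rcases m with _ | m
  · simp [S.U_zero]
  · exact S.U_mem (by omega)

lemma J_succ_le (m r : ℕ) : S.J m (r + 1) ≤ S.J m r := by
  refine S.J_le le_rfl ?_
  rw [c_succ']
  exact S.mul_mem_J_right (S.U_sub_mem _ _) (S.c_mem_J m r)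

lemma J_anti (m : ℕ) {r r' : ℕ} (h : r ≤ r') : S.J m r' ≤ S.J m r :=
  antitone_nat_of_succ_le (S.J_succ_le m) h

/-- By the zigzag identity `c m r` contains `c (m + 1) r` as a factor. -/
lemma J_le_J_succ {m : ℕ} (hm : m + 1 ≤ S.n) (r : ℕ) : S.J m r ≤ S.J (m + 1) r := by
  refine S.J_le (by omega) ?_
  rw [← S.c_zigzag hm r]
  have h := S.level_mono (Nat.le_succ m) (S.c_mem m r)
  exact S.mul_mem_J_right h (S.mul_mem_J_left h (S.c_mem_J _ _))

lemma J_zero_right (m : ℕ) : S.J m 0 = (S.level m).toSubmodule := by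
  refine le_antisymm ?_ fun x hx => ?_
  · refine fun z hz => mul_span_mul_induction (p := fun z => z ∈ S.level m) (fun a ha b hb => ?_)
      (fun _ _ => add_mem) hz
    exact mul_mem (mul_mem ha (S.c_mem m 0)) hb
  · have := S.mul_mem_J_left hx (S.c_mem_J m 0)
    simpa using this

lemma J_eq_bot {m r : ℕ} (h : m < 2 * r) : S.J m r = ⊥ := by
  rw [J, S.c_eq_zero h, Submodule.span_zero_singleton]
  simp

lemma J_le_level (m r : ℕ) : S.J m r ≤ (S.level m).toSubmodule :=
  (S.J_anti m (Nat.zero_le r)).trans (S.J_zero_right m).le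

/-- Modulo the ideal generated by a single cup only 1 and `e` survive. On zero strands `e` is not
available, whence the clause about `b`; it is needed for weight 0, where `f` need not absorb `e`. -/
lemma exists_of_mem_level {m : ℕ} (hm : m ≤ S.n) {x : A} (hx : x ∈ S.level m) :
    ∃ (a b : R), (m = 0 → b = 0) ∧ ∃ j ∈ S.J m 1, x = a • 1 + b • S.e + j := by
  induction m generalizing x with
  | zero =>
    obtain ⟨a, rfl⟩ := S.level_zero hx
    exact ⟨a, 0, by simp, 0, zero_mem _, by simp [Algebra.algebraMap_eq_smul_one]⟩
  | succ m ih =>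
    rcases Nat.eq_zero_or_pos m with rfl | hm0
    · obtain ⟨a, b, rfl⟩ := S.level_one hx
      exact ⟨a, b, by simp, 0, zero_mem _, by simp⟩
    · obtain ⟨y, hy, z, hz, rfl⟩ := Submodule.mem_sup.1 (S.level_succ_le hm0 hx)
      obtain ⟨a, b, -, j, hj, rfl⟩ := ih (by omega) hy
      refine ⟨a, b, by simp, j + z, add_mem (S.J_le_J_succ hm 1 hj) ?_, by abel⟩
      refine mul_span_mul_induction (p := fun z => z ∈ S.J (m + 1) 1) (fun a ha b hb => ?_)
        (fun _ _ => add_mem) hz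
      refine S.mul_mem_J_right (S.level_mono (by omega) hb)
        (S.mul_mem_J_left (S.level_mono (by omega) ha) ?_)
      have := S.c_mem_J (m + 1) 1
      simpa [c_succ] using this

lemma E_sq : (S.δ' • S.e) * (S.δ' • S.e) = S.δ' • S.e := by
  rw [smul_mul_smul_comm, S.e_sq, smul_smul, mul_assoc, S.δ'_mul, mul_one]

lemma s_sq (h : ℤ) : S.s h * S.s h = S.s h := by
  rw [s]
  split_ifs
  · exact S.E_sq
  · rw [mul_sub, mul_one, sub_mul, one_mul, S.E_sq]; abel
  · simp

lemma s_mul_of_neg {h h' : ℤ} (hh : h * h' < 0) : S.s h * S.s h' = 0 := by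
  rw [s, s]
  rcases mul_neg_iff.1 hh with ⟨h1, h2⟩ | ⟨h1, h2⟩
  · rw [if_pos h1, if_neg (by omega), if_pos h2, mul_sub, mul_one, S.E_sq, sub_self]
  · rw [if_neg (by omega), if_pos h1, if_pos h2, sub_mul, one_mul, S.E_sq, sub_self]

lemma s_add_s_neg {h : ℤ} (hh : h ≠ 0) : S.s h + S.s (-h) = 1 := by
  rw [s, s]
  rcases lt_or_gt_of_ne hh with h1 | h1
  · rw [if_neg (by omega), if_pos h1, if_pos (by omega)]; abel
  · rw [if_pos h1, if_neg (by omega), if_pos (by omega)]; abel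

@[simp] lemma s_zero : S.s 0 = 1 := by simp [s]

lemma e_mul_s_of_pos {h : ℤ} (hh : 0 < h) : S.e * S.s h = S.δ • S.s h := by
  rw [s, if_pos hh, mul_smul_comm, S.e_sq, smul_comm]

lemma e_mul_s_of_neg {h : ℤ} (hh : h < 0) : S.e * S.s h = 0 := by
  rw [s, if_neg (by omega), if_pos hh, mul_sub, mul_smul_comm, S.e_sq, smul_smul, S.δ'_mul]
  simp

lemma e_mul_s {h : ℤ} (hh : h ≠ 0) : ∃ κ : R, S.e * S.s h = κ • S.s h := by
  rcases lt_or_gt_of_ne hh with h1 | h1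
  · exact ⟨0, by rw [S.e_mul_s_of_neg h1, zero_smul]⟩
  · exact ⟨S.δ, S.e_mul_s_of_pos h1⟩

lemma commute_s {x : A} (hx : Commute x S.e) (h : ℤ) : Commute x (S.s h) := by
  rw [s]
  split_ifs
  · exact hx.smul_right _
  · exact (Commute.one_right _).sub_right (hx.smul_right _)
  · exact Commute.one_right _

lemma commute_s_c {h : ℤ} {m r : ℕ} (hr : h.natAbs + 2 * r ≤ m) : Commute (S.s h) (S.c m r) := by
  by_cases h0 : h = 0
  · rw [h0, s_zero]; exact Commute.one_left _
  · exact (S.commute_s (S.commute_e_c (by omega)).symm h).symm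

lemma s_mem {h : ℤ} {m : ℕ} (hm : h.natAbs ≤ m) : S.s h ∈ S.level m := by
  rw [s]
  split_ifs
  · exact Subalgebra.smul_mem _ (S.e_mem (by omega)) _
  · exact sub_mem (one_mem _) (Subalgebra.smul_mem _ (S.e_mem (by omega)) _)
  · exact one_mem _

lemma f_eq {m r : ℕ} {h : ℤ} (hr : h.natAbs + 2 * r = m) :
    S.f m h = S.d' ^ r • (S.c m r * S.s h) := by
  rw [f, show (m - h.natAbs) / 2 = r by omega]

lemma f_eq' {m r : ℕ} {h : ℤ} (hr : h.natAbs + 2 * r = m) :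
    S.f m h = S.d' ^ r • (S.s h * S.c m r) := by
  rw [S.f_eq hr, (S.commute_s_c hr.le).eq]

lemma d'_pow_smul (r : ℕ) (x : A) : S.d' ^ r • S.d ^ r • x = x := by
  rw [smul_smul, ← mul_pow, S.d'_mul, one_pow, one_smul]

lemma d_pow_smul (r : ℕ) (x : A) : S.d ^ r • S.d' ^ r • x = x := by
  rw [smul_smul, ← mul_pow, S.d_mul, one_pow, one_smul]

lemma c_mul_f {m r : ℕ} {h : ℤ} (hr : h.natAbs + 2 * r = m) :
    S.c m r * S.f m h = S.d ^ r • S.f m h := by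
  rw [S.f_eq hr, mul_smul_comm, ← mul_assoc, S.c_sq, smul_mul_assoc, smul_comm]

lemma s_mul_f {m r : ℕ} {h : ℤ} (hr : h.natAbs + 2 * r = m) : S.s h * S.f m h = S.f m h := by
  rw [S.f_eq' hr, mul_smul_comm, ← mul_assoc, S.s_sq]

lemma f_mul_s {m r : ℕ} {h : ℤ} (hr : h.natAbs + 2 * r = m) : S.f m h * S.s h = S.f m h := by
  rw [S.f_eq hr, smul_mul_assoc, mul_assoc, S.s_sq]

lemma f_sq {m r : ℕ} {h : ℤ} (hr : h.natAbs + 2 * r = m) :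
    S.f m h * S.f m h = S.f m h := by
  nth_rw 1 [S.f_eq' hr]
  rw [smul_mul_assoc, mul_assoc, S.c_mul_f hr, mul_smul_comm, S.s_mul_f hr, S.d'_pow_smul]

lemma f_mul_f_of_neg {m r m' r' : ℕ} {h h' : ℤ} (hr : h.natAbs + 2 * r = m)
    (hr' : h'.natAbs + 2 * r' = m') (hh : h * h' < 0) : S.f m h * S.f m' h' = 0 := by
  rw [← S.f_mul_s hr, ← S.s_mul_f hr', mul_assoc, ← mul_assoc (S.s h), S.s_mul_of_neg hh,
    zero_mul, mul_zero]

lemma f_add_f_neg {m r : ℕ} {h : ℤ} (hr : h.natAbs + 2 * r = m) (h0 : h ≠ 0) :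
    S.f m h + S.f m (-h) = S.d' ^ r • S.c m r := by
  rw [S.f_eq hr, S.f_eq (r := r) (h := -h) (by simpa using hr), ← smul_add, ← mul_add,
    S.s_add_s_neg h0, mul_one]

lemma f_zero_right {m r : ℕ} (hr : 2 * r = m) : S.f m 0 = S.d' ^ r • S.c m r := by
  rw [S.f_eq (r := r) (by simpa using hr), s_zero, mul_one]

lemma f_mem_J {m r : ℕ} {h : ℤ} (hr : h.natAbs + 2 * r = m) : S.f m h ∈ S.J m r := by
  rw [S.f_eq hr]
  exact Submodule.smul_mem _ _ (S.mul_mem_J_right (S.s_mem (by omega)) (S.c_mem_J m r))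

lemma f_mem {m r : ℕ} {h : ℤ} (hr : h.natAbs + 2 * r = m) : S.f m h ∈ S.level m :=
  S.J_le_level _ _ (S.f_mem_J hr)

/-- This makes the layers J_r / J_{r+1} cellular. Squeezing x between two copies of `c` leaves an
element y on m - 2r strands, and modulo one more cup y is a combination of 1 and `e`, which act on
`f` by scalars. In weight 0 no strands are left, so the term in `e` is absent. -/
lemma c_mul_level_mul_f {m r : ℕ} (hm : m ≤ S.n) {h : ℤ} (hr : h.natAbs + 2 * r = m) {x : A}
    (hx : x ∈ S.level m) :
    ∃ κ : R, ∃ j ∈ S.J m (r + 1), S.c m r * x * S.f m h = κ • S.f m h + j := by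
  obtain ⟨y, hy, hxy⟩ := S.c_mul_level_mul_c (r := r) (by omega) hx
  obtain ⟨a, b, hb, j, hj, rfl⟩ := S.exists_of_mem_level (m := m - 2 * r) (by omega) hy
  have hjc : j * S.c m r ∈ S.J m (r + 1) := by
    refine mul_span_mul_induction (p := fun j => j * S.c m r ∈ S.J m (r + 1))
      (fun a ha b hb => ?_) (fun x y hx hy => by rw [add_mul]; exact add_mem hx hy) hj
    have e1 : a * S.c (m - 2 * r) 1 * b * S.c m r = a * S.c m (r + 1) * b := by
      have h1 : S.c (m - 2 * r) 1 = S.U (m - 1 - 2 * r) := by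
        rw [c_succ, c_zero, mul_one]; congr 1; omega
      have h2 := S.commute_c_level m r hb
      have h3 := S.commute_c_level m r (S.c_mem (m - 2 * r) 1)
      rw [mul_assoc, ← h2.eq, ← mul_assoc, mul_assoc a, ← h3.eq, h1, c_succ']
    rw [e1]
    exact S.mul_mem_J_right (S.level_mono (by omega) hb)
      (S.mul_mem_J_left (S.level_mono (by omega) ha) (S.c_mem_J _ _))
  obtain ⟨κ, hκ⟩ : ∃ κ : R, b • S.e * S.f m h = κ • S.f m h := by
    by_cases h0 : h = 0
    · exact ⟨0, by rw [hb (by omega)]; simp⟩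
    · obtain ⟨κ, hκ⟩ := S.e_mul_s h0
      refine ⟨b * κ, ?_⟩
      rw [← S.s_mul_f hr, ← mul_assoc, smul_mul_assoc, hκ, smul_smul, smul_mul_assoc]
  have key : S.c m r * x * S.f m h = (a • 1 + b • S.e + j) * S.f m h := by
    have h1 : S.f m h = S.d' ^ r • (S.c m r * S.f m h) := by
      rw [S.c_mul_f hr, S.d'_pow_smul]
    rw [h1, mul_smul_comm, mul_smul_comm, ← mul_assoc, hxy, ← mul_assoc]
  refine ⟨a + κ, j * S.f m h, ?_, ?_⟩
  · rw [S.f_eq hr, mul_smul_comm, ← mul_assoc]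
    exact Submodule.smul_mem _ _ (S.mul_mem_J_right (S.s_mem (by omega)) hjc)
  · rw [key, add_mul, add_mul, hκ, smul_mul_assoc, one_mul, add_smul]

lemma f_mul_level_mul_f {m r : ℕ} (hm : m ≤ S.n) {h : ℤ} (hr : h.natAbs + 2 * r = m) {x : A}
    (hx : x ∈ S.level m) :
    ∃ κ : R, ∃ j ∈ S.J m (r + 1), S.f m h * x * S.f m h = κ • S.f m h + j := by
  obtain ⟨κ, j, hj, h1⟩ := S.c_mul_level_mul_f hm hr hx
  refine ⟨S.d' ^ r * κ, S.d' ^ r • (S.s h * j), Submodule.smul_mem _ _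
    (S.mul_mem_J_left (S.s_mem (by omega)) hj), ?_⟩
  nth_rw 1 [S.f_eq' hr]
  rw [smul_mul_assoc, smul_mul_assoc, mul_assoc, mul_assoc, ← mul_assoc (S.c m r), h1, mul_add,
    mul_smul_comm, S.s_mul_f hr, smul_add, smul_smul]

/-- The scalar part dies because the idempotents `s h` and `s (-h)` are orthogonal. Hence the two
weights of equal absolute value do not interact within a layer. -/
lemma f_neg_mul_level_mul_f {m r : ℕ} (hm : m ≤ S.n) {h : ℤ} (hr : h.natAbs + 2 * r = m)
    (h0 : h ≠ 0) {x : A} (hx : x ∈ S.level m) : S.f m (-h) * x * S.f m h ∈ S.J m (r + 1) := by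
  obtain ⟨κ, j, hj, h1⟩ := S.c_mul_level_mul_f hm hr hx
  rw [S.f_eq' (h := -h) (r := r) (by simpa using hr), smul_mul_assoc, smul_mul_assoc, mul_assoc,
    mul_assoc, ← mul_assoc (S.c m r), h1, mul_add, mul_smul_comm, ← S.s_mul_f hr, ← mul_assoc,
    S.s_mul_of_neg (by nlinarith [sq_nonneg h, sq_pos_of_ne_zero h0]), zero_mul, smul_zero,
    zero_add]
  exact Submodule.smul_mem _ _ (S.mul_mem_J_left (S.s_mem (by simpa using by omega)) hj)

/-- The zigzag at the left of `f`: it exhibits a factor `c (m - 1) r`, so an idempotent with r + 1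
cups on m strands is reached through J_r on m - 1 strands. -/
lemma c_mul_c_mul_f {m r : ℕ} (hm : m ≤ S.n) {h : ℤ} (hr : h.natAbs + 2 * (r + 1) = m) :
    S.c (m - 2) r * S.c (m - 1) r * S.f m h = S.f m h := by
  have hz := S.c_zigzag (m := m - 2) (by omega) r
  rw [show m - 2 + 1 = m - 1 by omega] at hz
  rw [S.f_eq hr, c_succ, (S.commute_U_pred_c m r).eq, mul_smul_comm]
  simp only [← mul_assoc]
  rw [hz]

/-- The zigzag at the right of `f`: a factor with r cups on m + 1 strands can be inserted for free.
-/
lemma f_mul_c_mul_c {m r : ℕ} (hm : m + 1 ≤ S.n) {h : ℤ} (hr : h.natAbs + 2 * r = m) :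
    S.f m h * (S.c (m + 1) r * S.c m r) = S.f m h := by
  have hz := S.c_zigzag hm r
  rw [S.f_eq' hr, smul_mul_assoc, mul_assoc, ← mul_assoc (S.c m r), hz]

end

end BlobSystem

/-! ### Walks indexing the cell basis -/

/-- Walks of length `m` from `0` along integers satisfying `D`, extended by zero. -/
def IsWalk (D : ℤ → Prop) (m : ℕ) (p : ℕ → ℤ) : Prop :=
  p 0 = 0 ∧ (∀ i < m, p (i + 1) = p i + 1 ∨ p (i + 1) = p i - 1) ∧ (∀ i ≤ m, D (p i)) ∧
    ∀ i, m < i → p i = 0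

lemma IsWalk.exists_natAbs {D : ℤ → Prop} {m : ℕ} {p : ℕ → ℤ} (hp : IsWalk D m p) {i : ℕ}
    (hi : i ≤ m) : ∃ r, (p i).natAbs + 2 * r = i := by
  induction i with
  | zero => exact ⟨0, by simp [hp.1]⟩
  | succ i ih =>
    obtain ⟨r, hr⟩ := ih (by omega)
    rcases hp.2.1 i (by omega) with h | h
    · rcases le_or_gt 0 (p i) with h0 | h0
      · exact ⟨r, by omega⟩
      · exact ⟨r + 1, by omega⟩
    · rcases le_or_gt (p i) 0 with h0 | h0
      · exact ⟨r, by omega⟩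
      · exact ⟨r + 1, by omega⟩

lemma IsWalk.update {D : ℤ → Prop} {m : ℕ} {p : ℕ → ℤ} (hp : IsWalk D m p) {h : ℤ} (hD : D h)
    (hh : h = p m + 1 ∨ h = p m - 1) : IsWalk D (m + 1) (Function.update p (m + 1) h) := by
  refine ⟨?_, fun i hi => ?_, fun i hi => ?_, fun i hi => ?_⟩
  · rw [Function.update_of_ne (by omega)]; exact hp.1
  · rw [Function.update_of_ne (a := i) (by omega)]
    rcases Nat.lt_succ_iff_lt_or_eq.1 hi with h1 | rfl
    · rw [Function.update_of_ne (by omega)]; exact hp.2.1 i h1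
    · rw [Function.update_self]; exact hh
  · rcases Nat.le_succ_iff.1 hi with h1 | rfl
    · rw [Function.update_of_ne (by omega)]; exact hp.2.2.1 i h1
    · rwa [Function.update_self]
  · rw [Function.update_of_ne (by omega)]; exact hp.2.2.2 i (by omega)

/-! ### Cell elements and the spanning theorem -/

namespace BlobSystem

section

variable {R A : Type*} [CommRing R] [Ring A] [Algebra R A] (S : BlobSystem R A)

/-- The element `f 1 (p 1) * f 2 (p 2) * ⋯ * f m (p m)` attached to a walk. -/
def u (p : ℕ → ℤ) : ℕ → A
  | 0 => 1
  | m + 1 => u p m * S.f (m + 1) (p (m + 1))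

/-- The element `f m (p m) * ⋯ * f 1 (p 1)` attached to a walk. -/
def v (p : ℕ → ℤ) : ℕ → A
  | 0 => 1
  | m + 1 => S.f (m + 1) (p (m + 1)) * v p m

lemma u_congr {p q : ℕ → ℤ} {m : ℕ} (h : ∀ i ≤ m, p i = q i) : S.u p m = S.u q m := by
  induction m with
  | zero => rfl
  | succ m ih => rw [u, u, ih fun i hi => h i (by omega), h _ le_rfl]

lemma v_congr {p q : ℕ → ℤ} {m : ℕ} (h : ∀ i ≤ m, p i = q i) : S.v p m = S.v q m := by
  induction m with
  | zero => rfl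
  | succ m ih => rw [v, v, ih fun i hi => h i (by omega), h _ le_rfl]

lemma u_update (p : ℕ → ℤ) (m : ℕ) (h : ℤ) :
    S.u (Function.update p (m + 1) h) (m + 1) = S.u p m * S.f (m + 1) h := by
  rw [u, Function.update_self, S.u_congr fun i hi => Function.update_of_ne (by omega) _ _]

lemma v_update (p : ℕ → ℤ) (m : ℕ) (h : ℤ) :
    S.v (Function.update p (m + 1) h) (m + 1) = S.f (m + 1) h * S.v p m := by
  rw [v, Function.update_self, S.v_congr fun i hi => Function.update_of_ne (by omega) _ _]

/-- The same generators in the opposite algebra. -/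
def op : BlobSystem R Aᵐᵒᵖ where
  d := S.d
  d' := S.d'
  γ := S.γ
  δ := S.δ
  δ' := S.δ'
  n := S.n
  e := MulOpposite.op S.e
  U i := MulOpposite.op (S.U i)
  d_mul := S.d_mul
  δ_mul := S.δ_mul
  U_zero := by rw [S.U_zero]; rfl
  U_of_le i hi := by rw [S.U_of_le i hi]; rfl
  U_sq i := by rw [← MulOpposite.op_mul, S.U_sq]; rfl
  U_braid i h1 h2 := by
    rw [← MulOpposite.op_mul, ← MulOpposite.op_mul, ← mul_assoc, S.U_braid i h1 h2]
  U_braid' i h1 := by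
    rw [← MulOpposite.op_mul, ← MulOpposite.op_mul, ← mul_assoc, S.U_braid' i h1]
  U_comm i j h := by rw [← MulOpposite.op_mul, ← MulOpposite.op_mul, S.U_comm i j h]
  e_sq := by rw [← MulOpposite.op_mul, S.e_sq]; rfl
  e_blob := by
    rw [← MulOpposite.op_mul, ← MulOpposite.op_mul, ← mul_assoc, S.e_blob]; rfl
  e_comm i h := by rw [← MulOpposite.op_mul, ← MulOpposite.op_mul, S.e_comm i h]

/-- The factors of `c` commute, so reversal fixes it. Likewise `f` is fixed while `u` and `v` are
exchanged, and every statement on left multiples has a mirror image. -/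
lemma op_c (m r : ℕ) : S.op.c m r = MulOpposite.op (S.c m r) := by
  induction r generalizing m with
  | zero => simp
  | succ r ih =>
    rw [c_succ, ih, c_succ, (S.commute_U_pred_c m r).eq]; rfl

lemma op_s (h : ℤ) : S.op.s h = MulOpposite.op (S.s h) := by
  rw [s, s]
  split_ifs <;> rfl

lemma op_f (m : ℕ) (h : ℤ) : S.op.f m h = MulOpposite.op (S.f m h) := by
  have hc : Commute (S.s h) (S.c m ((m - h.natAbs) / 2)) := by
    by_cases hm : h.natAbs ≤ m
    · exact S.commute_s_c (by omega)
    · rw [show (m - h.natAbs) / 2 = 0 by omega, c_zero]; exact Commute.one_right _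
  rw [f, f, op_c, op_s, ← hc.eq]
  rfl

lemma op_u (p : ℕ → ℤ) (m : ℕ) : S.op.u p m = MulOpposite.op (S.v p m) := by
  induction m with
  | zero => rfl
  | succ m ih => rw [u, v, ih, op_f]; rfl

lemma op_mem_level {m : ℕ} {x : A} (hx : x ∈ S.level m) : MulOpposite.op x ∈ S.op.level m := by
  induction hx using Algebra.adjoin_induction with
  | mem y hy =>
    rcases hy with ⟨i, hi, rfl⟩ | ⟨h1, rfl⟩
    exacts [S.op.U_mem hi, S.op.e_mem h1]
  | algebraMap r => exact algebraMap_mem (S.op.level m) r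
  | add _ _ _ _ h1 h2 => exact add_mem h1 h2
  | mul _ _ _ _ h1 h2 => exact mul_mem h2 h1

lemma unop_mem_level {m : ℕ} {x : Aᵐᵒᵖ} (hx : x ∈ S.op.level m) : x.unop ∈ S.level m := by
  induction hx using Algebra.adjoin_induction with
  | mem y hy =>
    rcases hy with ⟨i, hi, rfl⟩ | ⟨h1, rfl⟩
    exacts [S.U_mem hi, S.e_mem h1]
  | algebraMap r => exact algebraMap_mem (S.level m) r
  | add _ _ _ _ h1 h2 => exact add_mem h1 h2
  | mul _ _ _ _ h1 h2 => exact mul_mem h2 h1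

lemma unop_mem_J {m r : ℕ} {x : Aᵐᵒᵖ} (hx : x ∈ S.op.J m r) : x.unop ∈ S.J m r := by
  refine mul_span_mul_induction (p := fun x => MulOpposite.unop x ∈ S.J m r)
    (fun a ha b hb => ?_) (fun _ _ h1 h2 => add_mem h1 h2) hx
  rw [op_c]
  exact S.mul_mem_J_left (S.unop_mem_level hb)
    (S.mul_mem_J_right (S.unop_mem_level ha) (S.c_mem_J m r))

/-- The span of the elements `u p m * v q m` for walks `p`, `q` with the same end and at least `r`
cups. -/
def cellSpan (D : ℤ → Prop) (m r : ℕ) : Submodule R A :=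
  Submodule.span R {x | ∃ p q, IsWalk D m p ∧ IsWalk D m q ∧ p m = q m ∧
    (p m).natAbs + 2 * r ≤ m ∧ x = S.u p m * S.v q m}

/-- The span of the elements `u p (m + 1)` for walks `p` with end `h`, modulo `J (m + 1) (r + 1)`. -/
def leftSpan (D : ℤ → Prop) (m r : ℕ) (h : ℤ) : Submodule R A :=
  Submodule.span R {x | ∃ p, IsWalk D (m + 1) p ∧ p (m + 1) = h ∧ x = S.u p (m + 1)} ⊔
    S.J (m + 1) (r + 1)

variable {D : ℤ → Prop}

lemma u_mul_f {m : ℕ} {p : ℕ → ℤ} (hp : IsWalk D m p) : S.u p m * S.f m (p m) = S.u p m := by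
  rcases m with _ | m
  · rw [hp.1, S.f_zero_right (r := 0) rfl]; simp
  · obtain ⟨r, hr⟩ := hp.exists_natAbs le_rfl
    rw [u, mul_assoc, S.f_sq hr]

lemma f_mul_v {m : ℕ} {p : ℕ → ℤ} (hp : IsWalk D m p) : S.f m (p m) * S.v p m = S.v p m := by
  rcases m with _ | m
  · rw [hp.1, S.f_zero_right (r := 0) rfl]; simp
  · obtain ⟨r, hr⟩ := hp.exists_natAbs le_rfl
    rw [v, ← mul_assoc, S.f_sq hr]

lemma u_mem {m k : ℕ} {p : ℕ → ℤ} (hp : IsWalk D m p) (hk : k ≤ m) : S.u p k ∈ S.level k := by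
  induction k with
  | zero => exact one_mem _
  | succ k ih =>
    obtain ⟨r, hr⟩ := hp.exists_natAbs hk
    exact mul_mem (S.level_mono (Nat.le_succ k) (ih (by omega))) (S.f_mem hr)

lemma v_mem {m k : ℕ} {p : ℕ → ℤ} (hp : IsWalk D m p) (hk : k ≤ m) : S.v p k ∈ S.level k := by
  induction k with
  | zero => exact one_mem _
  | succ k ih =>
    obtain ⟨r, hr⟩ := hp.exists_natAbs hk
    exact mul_mem (S.f_mem hr) (S.level_mono (Nat.le_succ k) (ih (by omega)))

lemma u_mem_J {m r : ℕ} {p : ℕ → ℤ} (hp : IsWalk D m p) (hr : (p m).natAbs + 2 * r ≤ m) :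
    S.u p m ∈ S.J m r := by
  obtain ⟨t, ht⟩ := hp.exists_natAbs le_rfl
  rw [← S.u_mul_f hp]
  exact S.mul_mem_J_left (S.u_mem hp le_rfl) (S.J_anti m (by omega) (S.f_mem_J ht))

/-- If `h` is an admissible neighbour of the end of `p`, the product belongs to the prolonged walk.
Otherwise it is zero: either `h` lies outside the domain, or, since the absolute values differ by
one by parity and the bounds, `h` and `p m` have opposite signs and their idempotents are
orthogonal. -/
lemma u_mul_f_mem_leftSpan {m r : ℕ} {h : ℤ} (hr : h.natAbs + 2 * r = m + 1)
    (hD : ¬ D h → S.f (m + 1) h = 0) {p : ℕ → ℤ} (hp : IsWalk D m p)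
    (hpm : (p m).natAbs ≤ h.natAbs + 1) (hpm' : h.natAbs ≤ (p m).natAbs + 1) :
    S.u p m * S.f (m + 1) h ∈ S.leftSpan D m r h := by
  by_cases h1 : D h
  · by_cases h2 : h = p m + 1 ∨ h = p m - 1
    · refine Submodule.mem_sup_left (Submodule.subset_span
        ⟨Function.update p (m + 1) h, hp.update h1 h2, Function.update_self .., ?_⟩)
      rw [u_update]
    · obtain ⟨t, ht⟩ := hp.exists_natAbs le_rfl
      rw [← S.u_mul_f hp, mul_assoc, S.f_mul_f_of_neg ht hr, mul_zero]
      · exact zero_mem _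
      · rw [mul_neg_iff]; omega
  · rw [hD h1, mul_zero]; exact zero_mem _

/-- The case of a step away from zero. A cell element u v with more than r cups stays in the smaller
ideal. With exactly r cups, the zigzag inserted after u places a `c` with r cups to the left of v,
and everything between it and `f` collapses to a scalar modulo that ideal. -/
lemma J_mul_f_mem_leftSpan {m r : ℕ} (hm : m + 1 ≤ S.n) {h : ℤ} (hr : h.natAbs + 2 * r = m + 1)
    (hD : ¬ D h → S.f (m + 1) h = 0) (ih : S.J m r ≤ S.cellSpan D m r) {x : A}
    (hx : x ∈ S.J m r) : x * S.f (m + 1) h ∈ S.leftSpan D m r h := by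
  replace hx := ih hx
  induction hx using Submodule.span_induction with
  | zero => rw [zero_mul]; exact zero_mem _
  | add x y _ _ h1 h2 => rw [add_mul]; exact add_mem h1 h2
  | smul a x _ h1 => rw [smul_mul_assoc]; exact Submodule.smul_mem _ _ h1
  | mem x hx' =>
    obtain ⟨p, q, hp, hq, hpq, hpr, rfl⟩ := hx'
    have hfm := S.f_mem hr
    have hlm := S.level_mono (Nat.le_succ m)
    have hu := hlm (S.u_mem hp le_rfl)
    have hv := hlm (S.v_mem hq le_rfl)
    by_cases hlt : (p m).natAbs + 2 * (r + 1) ≤ m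
    · refine Submodule.mem_sup_right ?_
      rw [mul_assoc]
      exact S.mul_mem_J_right (mul_mem hv hfm) (S.J_le_J_succ hm _ (S.u_mem_J hp hlt))
    · obtain ⟨t, ht⟩ := hp.exists_natAbs le_rfl
      obtain rfl : t = r := by omega
      obtain ⟨κ, j, hj, hκ⟩ := S.c_mul_level_mul_f hm hr
        (mul_mem (hlm (S.c_mem m t)) hv)
      have e1 : S.u p m * S.v q m * S.f (m + 1) h = κ • (S.u p m * S.f (m + 1) h) + S.u p m * j := by
        calc S.u p m * S.v q m * S.f (m + 1) h
            = S.u p m * (S.f m (p m) * (S.c (m + 1) t * S.c m t)) * S.v q m * S.f (m + 1) h := by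
              rw [S.f_mul_c_mul_c hm ht, S.u_mul_f hp]
          _ = S.u p m * (S.c (m + 1) t * (S.c m t * S.v q m) * S.f (m + 1) h) := by
              rw [← mul_assoc (S.u p m), S.u_mul_f hp]; simp only [mul_assoc]
          _ = _ := by rw [hκ, mul_add, mul_smul_comm]
      rw [e1]
      exact add_mem (Submodule.smul_mem _ _ (S.u_mul_f_mem_leftSpan hr hD hp (by omega) (by omega)))
        (Submodule.mem_sup_right (S.mul_mem_J_left hu hj))

/-- Without cups the algebra is k + k e modulo J_1, and `e` acts on `f` by a scalar. With r + 1
cups, `f` starts with U_m, so x may be taken on m strands, and the zigzag replaces it by an element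
of J_r there. Its cell expansion either has more cups, which is the previous lemma, or exactly r;
then the walk makes a step towards zero. -/
lemma level_mul_f_mem_leftSpan {m r : ℕ} (hm : m + 1 ≤ S.n) {h : ℤ}
    (hr : h.natAbs + 2 * r = m + 1) (hD : ¬ D h → S.f (m + 1) h = 0)
    (ih : ∀ r, S.J m r ≤ S.cellSpan D m r) {x : A}
    (hx : x ∈ S.level (m + 1)) : x * S.f (m + 1) h ∈ S.leftSpan D m r h := by
  have hfm := S.f_mem hr
  rcases r with _ | r
  · have hJ : ∀ y ∈ S.J (m + 1) 1, y * S.f (m + 1) h ∈ S.leftSpan D m 0 h := fun y hy =>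
      Submodule.mem_sup_right (S.mul_mem_J_right hfm hy)
    have hL : ∀ y ∈ S.level m, y * S.f (m + 1) h ∈ S.leftSpan D m 0 h := fun y hy =>
      S.J_mul_f_mem_leftSpan hm hr hD (ih 0) ((S.J_zero_right m).ge hy)
    obtain ⟨a, b, -, j, hj, rfl⟩ := S.exists_of_mem_level hm hx
    rw [add_mul, add_mul, smul_mul_assoc, smul_mul_assoc]
    refine add_mem (add_mem (Submodule.smul_mem _ _ (hL 1 (one_mem _)))
      (Submodule.smul_mem _ _ ?_)) (hJ j hj)
    obtain ⟨κ, hκ⟩ := S.e_mul_s (h := h) (by omega)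
    rw [← S.s_mul_f hr, ← mul_assoc, hκ, smul_mul_assoc, S.s_mul_f hr]
    simpa using Submodule.smul_mem _ κ (hL 1 (one_mem _))
  · have hm1 : 1 ≤ m := by omega
    obtain ⟨y, hy, hxy⟩ : ∃ y ∈ S.level m, x * S.f (m + 1) h = y * S.f (m + 1) h := by
      obtain ⟨y, hy, hxy⟩ := S.level_succ_mul_U hm1 hx
      refine ⟨y, hy, ?_⟩
      rw [S.f_eq hr, c_succ, Nat.add_sub_cancel, mul_smul_comm, mul_smul_comm]
      simp only [← mul_assoc]
      rw [hxy]
    have hcc := S.c_mul_c_mul_f hm hr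
    rw [Nat.add_sub_cancel] at hcc
    have hlow := S.level_mono (show m + 1 - 2 ≤ m by omega) (S.c_mem (m + 1 - 2) r)
    have hyJ : y * S.c (m + 1 - 2) r * S.c m r ∈ S.J m r :=
      S.mul_mem_J_left (mul_mem hy hlow) (S.c_mem_J m r)
    have hyf : y * S.f (m + 1) h = y * S.c (m + 1 - 2) r * S.c m r * S.f (m + 1) h := by
      conv_lhs => rw [← hcc]
      simp only [mul_assoc]
    rw [hxy, hyf]
    generalize y * S.c (m + 1 - 2) r * S.c m r = z at hyJ
    have hz := ih r hyJ
    clear hyJ hyf hxy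
    induction hz using Submodule.span_induction with
    | zero => rw [zero_mul]; exact zero_mem _
    | add x y _ _ h1 h2 => rw [add_mul]; exact add_mem h1 h2
    | smul a x _ h1 => rw [smul_mul_assoc]; exact Submodule.smul_mem _ _ h1
    | mem z hz' =>
      obtain ⟨p, q, hp, hq, hpq, hpr, rfl⟩ := hz'
      have hu := S.u_mem hp le_rfl
      have hv := S.v_mem hq le_rfl
      have key : ∀ y ∈ S.J m (r + 1), y * S.f (m + 1) h ∈ S.leftSpan D m (r + 1) h := fun y hy =>
        S.J_mul_f_mem_leftSpan hm hr hD (ih _) hy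
      by_cases hlt : (p m).natAbs + 2 * (r + 1) ≤ m
      · exact key _ (S.mul_mem_J_right hv (S.u_mem_J hp hlt))
      · obtain ⟨t, ht⟩ := hp.exists_natAbs le_rfl
        obtain rfl : t = r := by omega
        -- The mirror image is needed: the scalar is extracted from f · x · c, with `f` on the left,
        -- so that it can be absorbed into `u p m`.
        have hop := S.op.c_mul_level_mul_f (r := t) (h := p m) (by change m ≤ S.n; omega) ht
          (S.op_mem_level (mul_mem hv hlow))
        obtain ⟨κ, j, hj, hκ⟩ := hop
        rw [op_c, op_f] at hκ
        replace hκ := congrArg MulOpposite.unop hκ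
        simp only [MulOpposite.unop_mul, MulOpposite.unop_op, MulOpposite.unop_add,
          MulOpposite.unop_smul] at hκ
        replace hj := S.unop_mem_J hj
        have e1 : S.u p m * S.v q m * S.f (m + 1) h
            = κ • (S.u p m * S.f (m + 1) h) + S.u p m * j.unop * S.f (m + 1) h := by
          calc S.u p m * S.v q m * S.f (m + 1) h
              = S.u p m * S.f m (p m) * S.v q m * (S.c (m + 1 - 2) t * S.c m t * S.f (m + 1) h) := by
                rw [S.u_mul_f hp, hcc]
            _ = S.u p m * (S.f m (p m) * (S.v q m * S.c (m + 1 - 2) t * S.c m t))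
                  * S.f (m + 1) h := by simp only [mul_assoc]
            _ = S.u p m * (κ • S.f m (p m) + j.unop) * S.f (m + 1) h := by rw [hκ]
            _ = _ := by rw [mul_add, add_mul, mul_smul_comm, S.u_mul_f hp, smul_mul_assoc]
        rw [e1]
        exact add_mem (Submodule.smul_mem _ _
          (S.u_mul_f_mem_leftSpan hr hD hp (by omega) (by omega)))
          (key _ (S.mul_mem_J_left hu hj))

end

/-- The elements `u p m * v q m` span. -/
theorem J_le_cellSpan {R : Type*} [CommRing R] {D : ℤ → Prop} (hD0 : D 0) (m : ℕ) :
    ∀ {A : Type u} [Ring A] [Algebra R A] (S : BlobSystem R A),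
      m ≤ S.n → (∀ m h, 1 ≤ m → ¬ D h → S.f m h = 0) → ∀ r, S.J m r ≤ S.cellSpan D m r := by
  induction m with
  | zero =>
    intro A _ _ S hm hD r
    rcases r with _ | r
    · rw [S.J_zero_right]
      intro x hx
      obtain ⟨a, rfl⟩ := S.level_zero hx
      rw [Algebra.algebraMap_eq_smul_one]
      have hw : IsWalk D 0 fun _ => 0 := ⟨rfl, by simp, by simpa using hD0, by simp⟩
      exact Submodule.smul_mem _ _ (Submodule.subset_span
        ⟨fun _ => 0, fun _ => 0, hw, hw, rfl, by simp, by simp [u, v]⟩)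
    · rw [S.J_eq_bot (by omega)]; exact bot_le
  | succ m ih =>
    intro A _ _ S hm hD r
    have hopD : ∀ m h, 1 ≤ m → ¬ D h → S.op.f m h = 0 := fun m h h1 h2 => by
      rw [op_f, hD m h h1 h2]; rfl
    have ih1 := ih S (by omega) hD
    have ih2 := ih S.op (by change m ≤ S.n; omega) hopD
    by_cases hr0 : m + 1 < 2 * r
    · rw [S.J_eq_bot hr0]; exact bot_le
    -- Descending induction on r, measured by the number of strands not covered by cups; the smaller
    -- ideal J_{r+1} is therefore already spanned.
    obtain ⟨k, hk⟩ : ∃ k, m + 1 - 2 * r ≤ k := ⟨_, le_rfl⟩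
    induction k using Nat.strong_induction_on generalizing r with
    | _ k ihk =>
    have hJ : S.J (m + 1) (r + 1) ≤ S.cellSpan D (m + 1) r := by
      by_cases h2 : m + 1 < 2 * (r + 1)
      · rw [S.J_eq_bot h2]; exact bot_le
      · refine (ihk (m + 1 - 2 * (r + 1)) (by omega) (r + 1) h2 le_rfl).trans ?_
        refine Submodule.span_mono ?_
        rintro x ⟨p, q, hp, hq, hpq, hpr, rfl⟩
        exact ⟨p, q, hp, hq, hpq, by omega, rfl⟩
    -- Writing x f y = (x f)(f y), the left factor expands in elements u and, by the mirror image,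
    -- the right factor in elements v, both modulo J_{r+1}.
    have hf : ∀ h : ℤ, h.natAbs + 2 * r = m + 1 → ∀ x ∈ S.level (m + 1), ∀ y ∈ S.level (m + 1),
        x * S.f (m + 1) h * y ∈ S.cellSpan D (m + 1) r := by
      intro h hr x hx y hy
      have hxf := S.level_mul_f_mem_leftSpan hm hr (hD _ _ (by omega)) ih1 hx
      have hyf := S.op.level_mul_f_mem_leftSpan hm hr (hopD _ _ (by omega)) ih2
        (S.op_mem_level hy)
      rw [op_f, ← MulOpposite.op_mul] at hyf
      have hyf' : S.f (m + 1) h * y ∈ Submodule.span R {x | ∃ p, IsWalk D (m + 1) p ∧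
          p (m + 1) = h ∧ x = S.v p (m + 1)} ⊔ S.J (m + 1) (r + 1) := by
        obtain ⟨a, ha, b, hb, hab⟩ := Submodule.mem_sup.1 hyf
        have : S.f (m + 1) h * y = a.unop + b.unop := by
          rw [← MulOpposite.unop_add, hab, MulOpposite.unop_op]
        rw [this]
        refine add_mem (Submodule.mem_sup_left ?_) (Submodule.mem_sup_right (S.unop_mem_J hb))
        clear hab this
        induction ha using Submodule.span_induction with
        | zero => exact zero_mem _
        | add _ _ _ _ h1 h2 => exact add_mem h1 h2
        | smul a _ _ h1 => exact Submodule.smul_mem _ a h1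
        | mem x hx =>
          obtain ⟨p, hp, hpm, rfl⟩ := hx
          exact Submodule.subset_span ⟨p, hp, hpm, by rw [op_u]; rfl⟩
      have hfm := S.f_mem hr
      have e1 : x * S.f (m + 1) h * y = (x * S.f (m + 1) h) * (S.f (m + 1) h * y) := by
        rw [mul_assoc, mul_assoc, ← mul_assoc (S.f (m + 1) h), S.f_sq hr]
      rw [e1]
      obtain ⟨a, ha, j, hj, h1⟩ := Submodule.mem_sup.1 hxf
      obtain ⟨b, hb, j', hj', h2⟩ := Submodule.mem_sup.1 hyf'
      rw [← h1, add_mul]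
      refine add_mem ?_ (hJ (S.mul_mem_J_right (mul_mem hfm hy) hj))
      have haL : a ∈ S.level (m + 1) := by
        have := S.J_le_level _ _ hj
        have h3 : a = x * S.f (m + 1) h - j := by rw [← h1]; abel
        rw [h3]
        exact sub_mem (mul_mem hx hfm) this
      rw [← h2, mul_add]
      refine add_mem ?_ (hJ (S.mul_mem_J_left haL hj'))
      have := Submodule.mul_mem_mul ha hb
      rw [Submodule.span_mul_span] at this
      refine Submodule.span_mono ?_ this
      rintro _ ⟨_, ⟨p, hp, hpm, rfl⟩, _, ⟨q, hq, hqm, rfl⟩, rfl⟩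
      exact ⟨p, q, hp, hq, hpm.trans hqm.symm, by rw [hpm, hr], rfl⟩
    intro z hz
    refine mul_span_mul_induction (p := fun z => z ∈ S.cellSpan D (m + 1) r)
      (fun a ha b hb => ?_) (fun _ _ => add_mem) hz
    -- The generator of J_r is, up to the unit d^r, the sum of the idempotents of the two weights
    -- ±h, or the single idempotent of weight 0.
    set h : ℤ := ((m + 1 - 2 * r : ℕ) : ℤ)
    have hr : h.natAbs + 2 * r = m + 1 := by omega
    by_cases h0 : h = 0
    · have := hf h hr a ha b hb
      rw [h0, S.f_zero_right (r := r) (by omega)] at this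
      rw [← S.d_pow_smul r (a * _ * b)]
      refine Submodule.smul_mem _ _ ?_
      simpa only [smul_mul_assoc, mul_smul_comm] using this
    · have := add_mem (hf h hr a ha b hb) (hf (-h) (by omega) a ha b hb)
      rw [← add_mul, ← mul_add, S.f_add_f_neg hr h0] at this
      rw [← S.d_pow_smul r (a * _ * b)]
      refine Submodule.smul_mem _ _ ?_
      simpa only [smul_mul_assoc, mul_smul_comm] using this

end BlobSystem

/-! ### Finiteness of the set of walks -/

lemma IsWalk.restrict {D : ℤ → Prop} {m : ℕ} {p : ℕ → ℤ} (hp : IsWalk D (m + 1) p) :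
    IsWalk D m (Function.update p (m + 1) 0) := by
  refine ⟨?_, fun i hi => ?_, fun i hi => ?_, fun i hi => ?_⟩
  · rw [Function.update_of_ne (by omega)]; exact hp.1
  · rw [Function.update_of_ne (by omega), Function.update_of_ne (by omega)]
    exact hp.2.1 i (by omega)
  · rw [Function.update_of_ne (by omega)]; exact hp.2.2.1 i (by omega)
  · by_cases h : i = m + 1
    · rw [h, Function.update_self]
    · rw [Function.update_of_ne h]; exact hp.2.2.2 i (by omega)

/-- Prescribing the value 0 after time `m` makes equality of walks a finite condition, so walks can
be ordinary functions on ℕ. -/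
lemma IsWalk.ext {D : ℤ → Prop} {m : ℕ} {p q : ℕ → ℤ} (hp : IsWalk D m p) (hq : IsWalk D m q)
    (h : ∀ i ≤ m, p i = q i) : p = q := by
  funext i
  by_cases hi : i ≤ m
  · exact h i hi
  · rw [hp.2.2.2 i (by omega), hq.2.2.2 i (by omega)]

lemma finite_isWalk (D : ℤ → Prop) (m : ℕ) : {p | IsWalk D m p}.Finite := by
  induction m with
  | zero =>
    refine (Set.finite_singleton (fun _ => 0)).subset fun p hp => ?_
    funext i
    rcases Nat.eq_zero_or_pos i with rfl | hi
    · exact hp.1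
    · exact hp.2.2.2 i hi
  | succ m ih =>
    refine (ih.biUnion (t := fun q => {Function.update q (m + 1) (q m + 1),
      Function.update q (m + 1) (q m - 1)}) fun q _ => Set.toFinite _).subset fun p hp => ?_
    refine Set.mem_biUnion hp.restrict ?_
    simp only [Function.update_idem, Set.mem_insert_iff, Set.mem_singleton_iff]
    rw [Function.update_of_ne (by omega)]
    rcases hp.2.1 m (by omega) with h | h
    · left; rw [← h, Function.update_eq_self]
    · right; rw [← h, Function.update_eq_self]

/-- Pairs of walks with the same end. -/
abbrev Cell (D : ℤ → Prop) (m : ℕ) : Type :=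
  {x : (ℕ → ℤ) × (ℕ → ℤ) // IsWalk D m x.1 ∧ IsWalk D m x.2 ∧ x.1 m = x.2 m}

instance (D : ℤ → Prop) (m : ℕ) : Finite (Cell D m) :=
  Set.Finite.to_subtype (((finite_isWalk D m).prod (finite_isWalk D m)).subset
    fun _ h => ⟨h.1, h.2.1⟩)

/-! ### Transport of cell elements along homomorphisms -/

namespace BlobSystem

section

variable {R A : Type*} [CommRing R] [Ring A] [Algebra R A] (S : BlobSystem R A)
variable {R' A' : Type*} [CommRing R'] [Ring A'] [Algebra R' A']

/-- The element attached to a pair of walks with the same end. -/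
def cell (D : ℤ → Prop) (x : Cell D S.n) : A := S.u x.1.1 S.n * S.v x.1.2 S.n

lemma cellSpan_zero (D : ℤ → Prop) :
    S.cellSpan D S.n 0 = Submodule.span R (Set.range (S.cell D)) := by
  rw [cellSpan]
  congr 1
  ext x
  constructor
  · rintro ⟨p, q, hp, hq, hpq, -, rfl⟩
    exact ⟨⟨(p, q), hp, hq, hpq⟩, rfl⟩
  · rintro ⟨⟨⟨p, q⟩, hp, hq, hpq⟩, rfl⟩
    obtain ⟨r, hr⟩ : ∃ r, (p S.n).natAbs + 2 * r = S.n := hp.exists_natAbs le_rfl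
    exact ⟨p, q, hp, hq, hpq, by omega, rfl⟩

/-- Transport along a semilinear ring homomorphism. -/
def map (σ : R →+* R') (ψ : A →+* A') (hψ : ∀ r a, ψ (r • a) = σ r • ψ a) :
    BlobSystem R' A' where
  d := σ S.d
  d' := σ S.d'
  γ := σ S.γ
  δ := σ S.δ
  δ' := σ S.δ'
  n := S.n
  e := ψ S.e
  U i := ψ (S.U i)
  d_mul := by rw [← map_mul, S.d_mul, map_one]
  δ_mul := by rw [← map_mul, S.δ_mul, map_one]
  U_zero := by rw [S.U_zero, map_zero]
  U_of_le i hi := by rw [S.U_of_le i hi, map_zero]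
  U_sq i := by rw [← map_mul, S.U_sq, hψ]
  U_braid i h1 h2 := by rw [← map_mul, ← map_mul, S.U_braid i h1 h2]
  U_braid' i h1 := by rw [← map_mul, ← map_mul, S.U_braid' i h1]
  U_comm i j h := by rw [← map_mul, ← map_mul, S.U_comm i j h]
  e_sq := by rw [← map_mul, S.e_sq, hψ]
  e_blob := by rw [← map_mul, ← map_mul, S.e_blob, hψ]
  e_comm i h := by rw [← map_mul, ← map_mul, S.e_comm i h]

/-- A semilinear ring homomorphism respecting the generators. -/
structure Compat (S : BlobSystem R A) (S' : BlobSystem R' A') (σ : R →+* R') (ψ : A →+* A') :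
    Prop where
  smul : ∀ r a, ψ (r • a) = σ r • ψ a
  d' : σ S.d' = S'.d'
  δ' : σ S.δ' = S'.δ'
  U : ∀ i < S.n, ψ (S.U i) = S'.U i
  e : 1 ≤ S.n → ψ S.e = S'.e

variable {S} {S' : BlobSystem R' A'} {σ : R →+* R'} {ψ : A →+* A'}

lemma Compat.map_c (h : Compat S S' σ ψ) {m : ℕ} (hm : m ≤ S.n) (r : ℕ) :
    ψ (S.c m r) = S'.c m r := by
  induction r generalizing m with
  | zero => simp
  | succ r ih =>
    rw [c_succ, c_succ, map_mul, ih (by omega)]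
    congr 1
    rcases Nat.eq_zero_or_pos m with rfl | hm0
    · rw [Nat.zero_sub, S.U_zero, S'.U_zero, map_zero]
    · exact h.U _ (by omega)

lemma Compat.map_s (h : Compat S S' σ ψ) {l : ℤ} (hl : l = 0 ∨ 1 ≤ S.n) :
    ψ (S.s l) = S'.s l := by
  rcases hl with rfl | hl
  · simp
  · rw [s, s]
    split_ifs <;> simp [h.smul, h.δ', h.e hl]

lemma Compat.map_f (h : Compat S S' σ ψ) {m : ℕ} (hm : m ≤ S.n) {l : ℤ} (hl : l = 0 ∨ 1 ≤ S.n) :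
    ψ (S.f m l) = S'.f m l := by
  rw [f, f, h.smul, map_mul, h.map_c hm, h.map_s hl, map_pow, h.d']

lemma Compat.map_u (h : Compat S S' σ ψ) (p : ℕ → ℤ) {m : ℕ} (hm : m ≤ S.n) :
    ψ (S.u p m) = S'.u p m := by
  induction m with
  | zero => simp [u]
  | succ m ih => rw [u, u, map_mul, ih (by omega), h.map_f hm (Or.inr (by omega))]

lemma Compat.map_v (h : Compat S S' σ ψ) (p : ℕ → ℤ) {m : ℕ} (hm : m ≤ S.n) :
    ψ (S.v p m) = S'.v p m := by
  induction m with
  | zero => simp [v]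
  | succ m ih => rw [v, v, map_mul, ih (by omega), h.map_f hm (Or.inr (by omega))]

variable (S) in
lemma compat_map (σ : R →+* R') (ψ : A →+* A') (hψ : ∀ r a, ψ (r • a) = σ r • ψ a) :
    Compat S (S.map σ ψ hψ) σ ψ := ⟨hψ, rfl, rfl, fun _ _ => rfl, fun _ => rfl⟩

end

/-! ## The path representation -/

section Path

variable (b : Prop) (n : ℕ)

/-- The heights allowed for walks: all of `ℤ` if `b` holds and `ℕ` otherwise. -/
def Dom (h : ℤ) : Prop := b ∨ 0 ≤ h

lemma dom_zero : Dom b 0 := Or.inr le_rfl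

variable {K : Type u} [Field K] (g : ℤ → K)

/-- The condition for `U_i` to act on a walk. -/
def Flat (i : ℕ) (p : ℕ → ℤ) : Prop :=
  IsWalk (Dom b) n p ∧ 1 ≤ i ∧ i < n ∧ p (i - 1) = p (i + 1)

/-- Average over the two walks differing from `p` at `i`. -/
def avg (i : ℕ) (φ : (ℕ → ℤ) → K) (p : ℕ → ℤ) : K :=
  (g (p (i - 1) + 1) * φ (Function.update p i (p (i - 1) + 1)) +
    g (p (i - 1) - 1) * φ (Function.update p i (p (i - 1) - 1))) / g (p (i - 1))

open Classical in
/-- The action of `U_i` on functions on walks. -/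
def pathU (i : ℕ) : Module.End K ((ℕ → ℤ) → K) where
  toFun φ p := if Flat b n i p then avg g i φ p else 0
  map_add' φ ψ := by
    funext p
    simp only [Pi.add_apply, avg]
    split_ifs
    · ring
    · simp
  map_smul' a φ := by
    funext p
    simp only [Pi.smul_apply, avg, RingHom.id_apply, smul_eq_mul]
    split_ifs
    · ring
    · simp

open Classical in
/-- The action of `e` on functions on walks. -/
def pathE (δ : K) : Module.End K ((ℕ → ℤ) → K) where
  toFun φ p := if b ∧ (n = 0 ∨ p 1 ≠ 1) then 0 else δ * φ p
  map_add' φ ψ := by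
    funext p
    simp only [Pi.add_apply]
    split_ifs
    · simp
    · ring
  map_smul' a φ := by
    funext p
    simp only [Pi.smul_apply, RingHom.id_apply, smul_eq_mul]
    split_ifs
    · simp
    · ring

variable {b n g}

lemma pathU_of_flat {i : ℕ} {p : ℕ → ℤ} (h : Flat b n i p) (φ : (ℕ → ℤ) → K) :
    pathU b n g i φ p = avg g i φ p := if_pos h

lemma pathU_of_not_flat {i : ℕ} {p : ℕ → ℤ} (h : ¬ Flat b n i p) (φ : (ℕ → ℤ) → K) :
    pathU b n g i φ p = 0 := if_neg h

lemma Flat.isWalk_update {i : ℕ} {p : ℕ → ℤ} (h : Flat b n i p) {t : ℤ} (ht : Dom b t)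
    (ht' : t = p (i - 1) + 1 ∨ t = p (i - 1) - 1) : IsWalk (Dom b) n (Function.update p i t) := by
  obtain ⟨hp, h1, h2, h3⟩ := h
  refine ⟨?_, fun j hj => ?_, fun j hj => ?_, fun j hj => ?_⟩
  · rw [Function.update_of_ne (by omega)]; exact hp.1
  · by_cases hj1 : j = i
    · subst hj1
      rw [Function.update_self, Function.update_of_ne (by omega)]; omega
    · rw [Function.update_of_ne hj1]
      by_cases hj2 : j + 1 = i
      · subst hj2
        rw [Function.update_self]; simpa using ht'
      · rw [Function.update_of_ne hj2]; exact hp.2.1 j hj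
  · by_cases hj1 : j = i
    · rw [hj1, Function.update_self]; exact ht
    · rw [Function.update_of_ne hj1]; exact hp.2.2.1 j hj
  · rw [Function.update_of_ne (by omega)]; exact hp.2.2.2 j hj

lemma Flat.update {i : ℕ} {p : ℕ → ℤ} (h : Flat b n i p) {t : ℤ} (ht : Dom b t)
    (ht' : t = p (i - 1) + 1 ∨ t = p (i - 1) - 1) : Flat b n i (Function.update p i t) := by
  have h1 := h.2.1
  refine ⟨h.isWalk_update ht ht', h.2.1, h.2.2.1, ?_⟩
  rw [Function.update_of_ne (by omega), Function.update_of_ne (by omega)]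
  exact h.2.2.2

lemma avg_update {i : ℕ} (hi : 1 ≤ i) (p : ℕ → ℤ) (t : ℤ) (φ : (ℕ → ℤ) → K) :
    avg g i φ (Function.update p i t) = avg g i φ p := by
  rw [avg, avg, Function.update_of_ne (by omega), Function.update_idem, Function.update_idem]

/-- The hypotheses on the weight function `g`. -/
structure Harmonic (b : Prop) (g : ℤ → K) (d : K) : Prop where
  zero : g 0 = 1
  ne_zero : ∀ h, Dom b h → g h ≠ 0
  add_eq : ∀ h, Dom b h → g (h + 1) + g (h - 1) = d * g h
  boundary : ¬ b → g (-1) = 0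

variable {d : K} (hg : Harmonic b g d)
include hg

lemma Harmonic.eq_zero {h t : ℤ} (hh : Dom b h) (ht : t = h + 1 ∨ t = h - 1) (hD : ¬ Dom b t) :
    g t = 0 := by
  rw [Dom, not_or] at hD
  rcases hh with hb | hh
  · exact absurd hb hD.1
  · rw [show t = -1 by omega]; exact hg.boundary hD.1

/-- The function obtained by applying `U i` does not depend on the height at `i`. The factor `g t`
covers the boundary: if `t` leaves the domain, the updated function is no longer a walk, but then `g
t = 0`. -/
lemma g_mul_pathU_update {i : ℕ} {p : ℕ → ℤ} (h : Flat b n i p) {t : ℤ}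
    (ht' : t = p (i - 1) + 1 ∨ t = p (i - 1) - 1) (φ : (ℕ → ℤ) → K) :
    g t * pathU b n g i φ (Function.update p i t) = g t * pathU b n g i φ p := by
  by_cases ht : Dom b t
  · rw [pathU_of_flat (h.update ht ht'), pathU_of_flat h, avg_update h.2.1]
  · have h3 := h.2.2.1
    rw [hg.eq_zero (h.1.2.2.1 (i - 1) (by omega)) ht' ht, zero_mul, zero_mul]

/-- The image of `U i` is constant in the height at `i`, so the eigenvalue is (g(x+1) + g(x-1)) /
g(x), which is d by harmonicity. -/
lemma pathU_sq (i : ℕ) : pathU b n g i * pathU b n g i = d • pathU b n g i := by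
  refine LinearMap.ext fun φ => funext fun p => ?_
  rw [Module.End.mul_apply, LinearMap.smul_apply, Pi.smul_apply, smul_eq_mul]
  by_cases h : Flat b n i p
  · have h3 := h.2.2.1
    have hD := h.1.2.2.1 (i - 1) (by omega)
    rw [pathU_of_flat h, avg, g_mul_pathU_update hg h (Or.inl rfl),
      g_mul_pathU_update hg h (Or.inr rfl), ← add_mul, hg.add_eq _ hD]
    field_simp [hg.ne_zero _ hD]
  · rw [pathU_of_not_flat h, pathU_of_not_flat h, mul_zero]

/-- Only one term survives: flatness at i + 1 forces the height t at i to be p(i+2), and the last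
flatness condition forces the height at i + 1 to be x = p(i-1). The two weights g(t)/g(x) and
g(x)/g(t) cancel. -/
lemma pathU_braid {i : ℕ} (hi : i + 1 < n) :
    pathU b n g i * pathU b n g (i + 1) * pathU b n g i = pathU b n g i := by
  refine LinearMap.ext fun φ => funext fun p => ?_
  rw [Module.End.mul_apply, Module.End.mul_apply]
  by_cases h : Flat b n i p
  swap
  · rw [pathU_of_not_flat h, pathU_of_not_flat h]
  obtain ⟨hp, h1, h2, h3⟩ := id h
  set ψ := pathU b n g i φ with hψ
  set x := p (i - 1) with hx
  have hDx := hp.2.2.1 (i - 1) (by omega)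
  have hgx : g x ≠ 0 := hg.ne_zero _ hDx
  have key : ∀ t, t = x + 1 ∨ t = x - 1 →
      g t * pathU b n g (i + 1) ψ (Function.update p i t) =
        if t = p (i + 2) then g x * ψ p else 0 := by
    intro t ht
    split_ifs with htw
    · have hDt : Dom b t := htw ▸ hp.2.2.1 (i + 2) (by omega)
      have hgt := hg.ne_zero _ hDt
      have hf : Flat b n (i + 1) (Function.update p i t) := by
        refine ⟨h.isWalk_update hDt ht, by omega, hi, ?_⟩
        rw [Nat.add_sub_cancel, Function.update_self, Function.update_of_ne (by omega)]
        exact htw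
      rw [pathU_of_flat hf, avg, Nat.add_sub_cancel, Function.update_self]
      have hval : ∀ y, y = t + 1 ∨ y = t - 1 →
          ψ (Function.update (Function.update p i t) (i + 1) y) = if y = x then ψ p else 0 := by
        intro y hy
        split_ifs with hyx
        · rw [hyx, h3, Function.update_eq_self_iff.2]
          · have := g_mul_pathU_update hg h ht φ
            exact mul_left_cancel₀ hgt this
          · rw [Function.update_of_ne (by omega)]
        · rw [hψ, pathU_of_not_flat]
          rintro ⟨-, -, -, h6⟩
          rw [Function.update_of_ne (by omega), Function.update_of_ne (by omega),
            Function.update_self] at h6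
          exact hyx h6.symm
      rw [hval _ (Or.inl rfl), hval _ (Or.inr rfl)]
      rcases ht with ht | ht
      · rw [if_neg (by omega), if_pos (by omega), show t - 1 = x by omega]
        field_simp
        ring
      · rw [if_pos (by omega), if_neg (by omega), show t + 1 = x by omega]
        field_simp
        ring
    · rw [pathU_of_not_flat, mul_zero]
      rintro ⟨-, -, -, h6⟩
      rw [Nat.add_sub_cancel, Function.update_self, Function.update_of_ne (by omega)] at h6
      exact htw h6
  rw [pathU_of_flat h, avg, ← hx, key _ (Or.inl rfl), key _ (Or.inr rfl)]
  rcases hp.2.1 (i + 1) (by omega) with hw | hw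
  · rw [if_pos (by rw [show i + 2 = i + 1 + 1 from rfl, hw, ← h3]),
      if_neg (by rw [show i + 2 = i + 1 + 1 from rfl, hw, ← h3]; omega)]
    field_simp
    ring
  · rw [if_neg (by rw [show i + 2 = i + 1 + 1 from rfl, hw, ← h3]; omega),
      if_pos (by rw [show i + 2 = i + 1 + 1 from rfl, hw, ← h3])]
    field_simp
    ring

lemma pathU_braid' {i : ℕ} (hi : 1 ≤ i) :
    pathU b n g (i + 1) * pathU b n g i * pathU b n g (i + 1) = pathU b n g (i + 1) := by
  refine LinearMap.ext fun φ => funext fun p => ?_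
  rw [Module.End.mul_apply, Module.End.mul_apply]
  by_cases h : Flat b n (i + 1) p
  swap
  · rw [pathU_of_not_flat h, pathU_of_not_flat h]
  obtain ⟨hp, h1, h2, h3⟩ := id h
  rw [Nat.add_sub_cancel] at h3
  set ψ := pathU b n g (i + 1) φ with hψ
  set x := p i with hx
  have hDx := hp.2.2.1 i (by omega)
  have hgx : g x ≠ 0 := hg.ne_zero _ hDx
  have key : ∀ t, t = x + 1 ∨ t = x - 1 →
      g t * pathU b n g i ψ (Function.update p (i + 1) t) =
        if t = p (i - 1) then g x * ψ p else 0 := by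
    intro t ht
    split_ifs with htw
    · have hDt : Dom b t := htw ▸ hp.2.2.1 (i - 1) (by omega)
      have hgt := hg.ne_zero _ hDt
      have hf : Flat b n i (Function.update p (i + 1) t) := by
        refine ⟨h.isWalk_update hDt ht, by omega, by omega, ?_⟩
        rw [Function.update_self, Function.update_of_ne (by omega)]
        exact htw.symm
      rw [pathU_of_flat hf, avg, Function.update_of_ne (a := i - 1) (by omega), ← htw]
      have hval : ∀ y, y = t + 1 ∨ y = t - 1 →
          ψ (Function.update (Function.update p (i + 1) t) i y) = if y = x then ψ p else 0 := by
        intro y hy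
        split_ifs with hyx
        · rw [hyx, hx, Function.update_eq_self_iff.2]
          · have := g_mul_pathU_update hg h (t := t) (by simpa using ht) φ
            exact mul_left_cancel₀ hgt this
          · rw [Function.update_of_ne (by omega)]
        · rw [hψ, pathU_of_not_flat]
          rintro ⟨-, -, -, h6⟩
          rw [Nat.add_sub_cancel, Function.update_self, Function.update_of_ne (by omega),
            Function.update_of_ne (by omega)] at h6
          exact hyx (h6.trans h3.symm)
      rw [hval _ (Or.inl rfl), hval _ (Or.inr rfl)]
      rcases ht with ht | ht
      · rw [if_neg (by omega), if_pos (by omega), show t - 1 = x by omega]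
        field_simp
        ring
      · rw [if_pos (by omega), if_neg (by omega), show t + 1 = x by omega]
        field_simp
        ring
    · rw [pathU_of_not_flat, mul_zero]
      rintro ⟨-, -, -, h6⟩
      rw [Function.update_self, Function.update_of_ne (by omega)] at h6
      exact htw h6.symm
  rw [pathU_of_flat h, avg, Nat.add_sub_cancel, ← hx, key _ (Or.inl rfl), key _ (Or.inr rfl)]
  have hw := hp.2.1 (i - 1) (by omega)
  rw [Nat.sub_add_cancel hi, ← hx] at hw
  rcases hw with hw | hw
  · rw [if_neg (by omega), if_pos (by omega)]
    field_simp
    ring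
  · rw [if_pos (by omega), if_neg (by omega)]
    field_simp
    ring

/-- At distance at least two, neither operator affects the flatness condition of the other; the
composite is the iterated average when both hold and zero otherwise, a description symmetric up to
the order of averaging. -/
lemma pathU_mul_pathU {i j : ℕ} (hij : i + 2 ≤ j ∨ j + 2 ≤ i) (φ : (ℕ → ℤ) → K) (p : ℕ → ℤ) :
    (Flat b n i p ∧ Flat b n j p → pathU b n g i (pathU b n g j φ) p = avg g i (avg g j φ) p) ∧
    (¬ (Flat b n i p ∧ Flat b n j p) → pathU b n g i (pathU b n g j φ) p = 0) := by
  by_cases h : Flat b n i p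
  swap
  · exact ⟨fun h' => absurd h'.1 h, fun _ => pathU_of_not_flat h _⟩
  have h3 := h.2.2.1
  have h4 := h.2.1
  have key : ∀ t, t = p (i - 1) + 1 ∨ t = p (i - 1) - 1 →
      (Flat b n j p → g t * pathU b n g j φ (Function.update p i t) =
        g t * avg g j φ (Function.update p i t)) ∧
      (¬ Flat b n j p → g t * pathU b n g j φ (Function.update p i t) = 0) := by
    intro t ht
    by_cases hD : Dom b t
    · have hiff : Flat b n j (Function.update p i t) ↔ Flat b n j p := by
        constructor
        · rintro ⟨-, h5, h6, h7⟩
          rw [Function.update_of_ne (by omega), Function.update_of_ne (by omega)] at h7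
          exact ⟨h.1, h5, h6, h7⟩
        · rintro ⟨-, h5, h6, h7⟩
          refine ⟨h.isWalk_update hD ht, h5, h6, ?_⟩
          rw [Function.update_of_ne (by omega), Function.update_of_ne (by omega)]
          exact h7
      refine ⟨fun hj => by rw [pathU_of_flat (hiff.2 hj)], fun hj => ?_⟩
      rw [pathU_of_not_flat (mt hiff.1 hj), mul_zero]
    · rw [hg.eq_zero (h.1.2.2.1 (i - 1) (by omega)) ht hD]
      simp
  rw [pathU_of_flat h, avg]
  refine ⟨fun hj => ?_, fun hj => ?_⟩
  · rw [(key _ (Or.inl rfl)).1 hj.2, (key _ (Or.inr rfl)).1 hj.2]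
    conv_rhs => rw [avg]
  · have hj : ¬ Flat b n j p := fun h' => hj ⟨h, h'⟩
    rw [(key _ (Or.inl rfl)).2 hj, (key _ (Or.inr rfl)).2 hj]
    simp

omit hg in
lemma avg_comm {i j : ℕ} (hi : 1 ≤ i) (hij : i + 2 ≤ j) (φ : (ℕ → ℤ) → K) (p : ℕ → ℤ) :
    avg g i (avg g j φ) p = avg g j (avg g i φ) p := by
  simp only [avg]
  rw [Function.update_of_ne (show j - 1 ≠ i by omega), Function.update_of_ne (show j - 1 ≠ i by omega),
    Function.update_of_ne (show i - 1 ≠ j by omega), Function.update_of_ne (show i - 1 ≠ j by omega)]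
  rw [Function.update_comm (show i ≠ j by omega), Function.update_comm (show i ≠ j by omega),
    Function.update_comm (show i ≠ j by omega), Function.update_comm (show i ≠ j by omega)]
  ring

lemma pathU_comm {i j : ℕ} (hij : i + 2 ≤ j) :
    pathU b n g i * pathU b n g j = pathU b n g j * pathU b n g i := by
  refine LinearMap.ext fun φ => funext fun p => ?_
  rw [Module.End.mul_apply, Module.End.mul_apply]
  have h1 := pathU_mul_pathU (n := n) hg (Or.inl hij) φ p
  have h2 := pathU_mul_pathU (n := n) hg (Or.inr hij) φ p
  by_cases h : Flat b n i p ∧ Flat b n j p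
  · rw [h1.1 h, h2.1 h.symm, avg_comm h.1.2.1 hij]
  · rw [h1.2 h, h2.2 (fun h' => h h'.symm)]

omit hg in
lemma pathE_sq (δ : K) : pathE b n δ * pathE b n δ = δ • pathE b n δ := by
  refine LinearMap.ext fun φ => funext fun p => ?_
  simp only [Module.End.mul_apply, LinearMap.smul_apply, Pi.smul_apply, smul_eq_mul, pathE,
    LinearMap.coe_mk, AddHom.coe_mk]
  split_ifs <;> simp

omit hg in
lemma pathE_comm (δ : K) {i : ℕ} (hi : i ≠ 1) :
    pathE b n δ * pathU b n g i = pathU b n g i * pathE b n δ := by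
  refine LinearMap.ext fun φ => funext fun p => ?_
  rw [Module.End.mul_apply, Module.End.mul_apply]
  by_cases h : Flat b n i p
  · rw [pathU_of_flat h, avg]
    simp only [pathE, LinearMap.coe_mk, AddHom.coe_mk]
    rw [pathU_of_flat h, Function.update_of_ne hi.symm, Function.update_of_ne hi.symm, avg]
    split_ifs
    · simp
    · ring
  · rw [pathU_of_not_flat h]
    simp [pathE, pathU_of_not_flat h]

/-- In the blob case `e` keeps only the walks with first step up, which carry weight g(1)/g(0) =
g(1). In the other case `e` is the scalar δ and g(-1) = 0, with the same outcome. -/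
lemma pathE_blob (δ : K) :
    pathU b n g 1 * pathE b n δ * pathU b n g 1 = (δ * g 1) • pathU b n g 1 := by
  refine LinearMap.ext fun φ => funext fun p => ?_
  rw [Module.End.mul_apply, Module.End.mul_apply, LinearMap.smul_apply, Pi.smul_apply, smul_eq_mul]
  by_cases h : Flat b n 1 p
  swap
  · rw [pathU_of_not_flat h, pathU_of_not_flat h, mul_zero]
  set ψ := pathU b n g 1 φ with hψ
  have h0 : p (1 - 1) = 0 := h.1.1
  have hn : n ≠ 0 := by have := h.2.2.1; omega
  have hp := g_mul_pathU_update hg h (t := 1) (by rw [h0]; simp) φ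
  have hm := g_mul_pathU_update hg h (t := -1) (by rw [h0]; simp) φ
  rw [pathU_of_flat h, avg, h0, hg.zero, div_one]
  simp only [pathE, LinearMap.coe_mk, AddHom.coe_mk, zero_add, zero_sub, Function.update_self]
  by_cases hb : b
  · rw [if_neg (by simp [hn]), if_pos (by simp [hb])]
    linear_combination δ * hp
  · rw [if_neg (by simp [hb]), if_neg (by simp [hb]), hg.boundary hb]
    linear_combination δ * hp

end Path

end BlobSystem

/-! ### Matrix units in the path representation -/

lemma exists_isWalk (b : Prop) {m : ℕ} {h : ℤ} {r : ℕ} (hr : h.natAbs + 2 * r = m)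
    (hD : BlobSystem.Dom b h) : ∃ p, IsWalk (BlobSystem.Dom b) m p ∧ p m = h := by
  induction m generalizing h r with
  | zero =>
    exact ⟨fun _ => 0, ⟨rfl, by simp, fun _ _ => BlobSystem.dom_zero b, by simp⟩,
      by change (0 : ℤ) = h; omega⟩
  | succ m ih =>
    obtain ⟨h', r', hr', hD', hh⟩ : ∃ (h' : ℤ) (r' : ℕ), h'.natAbs + 2 * r' = m ∧
        BlobSystem.Dom b h' ∧ (h = h' + 1 ∨ h = h' - 1) := by
      rcases lt_trichotomy h 0 with h0 | h0 | h0
      · exact ⟨h + 1, r, by omega, Or.inl (hD.resolve_right (by omega)), by omega⟩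
      · exact ⟨h + 1, r - 1, by omega, Or.inr (by omega), by omega⟩
      · exact ⟨h - 1, r, by omega, Or.inr (by omega), by omega⟩
    obtain ⟨p, hp, rfl⟩ := ih hr' hD'
    exact ⟨_, hp.update hD hh, Function.update_self ..⟩

/-- A walk that is as far from zero as its length permits never turns back. -/
lemma IsWalk.eq_of_natAbs_eq {D : ℤ → Prop} {m : ℕ} {p q : ℕ → ℤ} (hp : IsWalk D m p)
    (hq : IsWalk D m q) {k : ℕ} (hk : k ≤ m) (h : p k = q k) (hpk : (p k).natAbs = k) :
    ∀ i ≤ k, p i = q i := by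
  induction k with
  | zero =>
    intro i hi
    obtain rfl : i = 0 := by omega
    exact h
  | succ k ih =>
    obtain ⟨r, hr⟩ := hp.exists_natAbs (show k ≤ m by omega)
    obtain ⟨t, ht⟩ := hq.exists_natAbs (show k ≤ m by omega)
    have h1 := hp.2.1 k (by omega)
    have h2 := hq.2.1 k (by omega)
    intro i hi
    rcases Nat.le_succ_iff.1 hi with hi | rfl
    · exact ih (by omega) (by omega) (by omega) i hi
    · exact h

namespace BlobSystem

section Path

variable (b : Prop) (n : ℕ) {K : Type u} [Field K] (g : ℤ → K)

/-- The path representation as a system of generators over a ring `R` mapping to `K`. -/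
def pathSystem (R : Type*) [CommRing R] [Algebra R K] (d d' γ δ δ' : R) (hd : d * d' = 1)
    (hδ : δ * δ' = 1) (hg : Harmonic b g (algebraMap R K d))
    (hγ : algebraMap R K γ = algebraMap R K δ * g 1) :
    BlobSystem R (Module.End K ((ℕ → ℤ) → K)) where
  d := d
  d' := d'
  γ := γ
  δ := δ
  δ' := δ'
  n := n
  e := pathE b n (algebraMap R K δ)
  U i := pathU b n g i
  d_mul := hd
  δ_mul := hδ
  U_zero := LinearMap.ext fun φ => funext fun p =>
    pathU_of_not_flat (fun h => by have := h.2.1; omega) φ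
  U_of_le i hi := LinearMap.ext fun φ => funext fun p =>
    pathU_of_not_flat (fun h => by have := h.2.2.1; omega) φ
  U_sq i := by rw [pathU_sq hg, algebraMap_smul]
  U_braid i _ h2 := pathU_braid hg h2
  U_braid' i h1 := pathU_braid' hg h1
  U_comm i j h := pathU_comm hg h
  e_sq := by rw [pathE_sq, algebraMap_smul]
  e_blob := by rw [pathE_blob hg, ← hγ, algebraMap_smul]
  e_comm i h := pathE_comm _ h

open Classical in
/-- The projection to functions supported on walks. -/
def walkProj : Module.End K ((ℕ → ℤ) → K) where
  toFun φ l := if IsWalk (Dom b) n l then φ l else 0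
  map_add' φ ψ := by
    funext l
    simp only [Pi.add_apply]
    split_ifs <;> simp
  map_smul' a φ := by
    funext l
    simp only [Pi.smul_apply, RingHom.id_apply]
    split_ifs <;> simp

/-- Replace the first `m` steps of a walk. -/
def splice (m : ℕ) (q l : ℕ → ℤ) : ℕ → ℤ := fun i => if i ≤ m then q i else l i

open Classical in
/-- The matrix units on the first `m` steps. -/
def matUnit (m : ℕ) (p q : ℕ → ℤ) : Module.End K ((ℕ → ℤ) → K) where
  toFun φ l := if IsWalk (Dom b) n l ∧ ∀ i ≤ m, l i = p i then φ (splice m q l) else 0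
  map_add' φ ψ := by
    funext l
    simp only [Pi.add_apply]
    split_ifs <;> simp
  map_smul' a φ := by
    funext l
    simp only [Pi.smul_apply, RingHom.id_apply]
    split_ifs <;> simp

variable {b n g}

lemma matUnit_of {m : ℕ} {p q l : ℕ → ℤ} (h : IsWalk (Dom b) n l) (h' : ∀ i ≤ m, l i = p i)
    (φ : (ℕ → ℤ) → K) : matUnit b n m p q φ l = φ (splice m q l) := if_pos ⟨h, h'⟩

lemma matUnit_of_not {m : ℕ} {p q l : ℕ → ℤ}
    (h : ¬ (IsWalk (Dom b) n l ∧ ∀ i ≤ m, l i = p i)) (φ : (ℕ → ℤ) → K) :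
    matUnit b n m p q φ l = 0 := if_neg h

lemma walkProj_of {l : ℕ → ℤ} (h : IsWalk (Dom b) n l) (φ : (ℕ → ℤ) → K) :
    walkProj b n φ l = φ l := if_pos h

lemma walkProj_of_not {l : ℕ → ℤ} (h : ¬ IsWalk (Dom b) n l) (φ : (ℕ → ℤ) → K) :
    walkProj b n φ l = 0 := if_neg h

lemma walkProj_mul_eq {X : Module.End K ((ℕ → ℤ) → K)}
    (hX : ∀ φ l, ¬ IsWalk (Dom b) n l → X φ l = 0) : walkProj b n * X = X := by
  refine LinearMap.ext fun φ => funext fun l => ?_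
  rw [Module.End.mul_apply]
  by_cases h : IsWalk (Dom b) n l
  · rw [walkProj_of h]
  · rw [walkProj_of_not h, hX _ _ h]

lemma splice_isWalk {m : ℕ} (hm : m ≤ n) {q l : ℕ → ℤ} (hq : IsWalk (Dom b) m q)
    (hl : IsWalk (Dom b) n l) (h : q m = l m) : IsWalk (Dom b) n (splice m q l) := by
  refine ⟨?_, fun i hi => ?_, fun i hi => ?_, fun i hi => ?_⟩
  · rw [splice, if_pos (Nat.zero_le _)]; exact hq.1
  · rw [splice, splice]
    by_cases h1 : i + 1 ≤ m
    · rw [if_pos h1, if_pos (by omega)]; exact hq.2.1 i h1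
    · by_cases h2 : i = m
      · rw [if_neg h1, if_pos h2.le, h2, h]; exact hl.2.1 m (by omega)
      · rw [if_neg h1, if_neg (by omega)]; exact hl.2.1 i hi
  · rw [splice]
    split_ifs with h1
    · exact hq.2.2.1 i h1
    · exact hl.2.2.1 i hi
  · rw [splice, if_neg (by omega)]; exact hl.2.2.2 i hi

/-- Operators that agree on walks with an element of the algebra on `m` strands. -/
def Realized (S : BlobSystem K (Module.End K ((ℕ → ℤ) → K))) (b : Prop) (m : ℕ)
    (X : Module.End K ((ℕ → ℤ) → K)) : Prop :=
  walkProj b S.n * X = X ∧ ∃ x ∈ S.level m, X = x * walkProj b S.n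

section

variable {S : BlobSystem K (Module.End K ((ℕ → ℤ) → K))} {m : ℕ}
  {X Y : Module.End K ((ℕ → ℤ) → K)}

lemma Realized.mono (h : Realized S b m X) : Realized S b (m + 1) X := by
  obtain ⟨h1, x, hx, h2⟩ := h
  exact ⟨h1, x, S.level_mono (Nat.le_succ m) hx, h2⟩

lemma Realized.mul (hX : Realized S b m X) (hY : Realized S b m Y) : Realized S b m (X * Y) := by
  obtain ⟨h1, x, hx, h2⟩ := hX
  obtain ⟨h3, y, hy, h4⟩ := hY
  refine ⟨by rw [← mul_assoc, h1], x * y, mul_mem hx hy, ?_⟩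
  rw [h2, mul_assoc, h3, h4, mul_assoc]

lemma Realized.smul (a : K) (hX : Realized S b m X) : Realized S b m (a • X) := by
  obtain ⟨h1, x, hx, h2⟩ := hX
  exact ⟨by rw [mul_smul_comm, h1], a • x, Subalgebra.smul_mem _ hx _, by
    rw [h2, smul_mul_assoc]⟩

lemma Realized.sub (hX : Realized S b m X) (hY : Realized S b m Y) : Realized S b m (X - Y) := by
  obtain ⟨h1, x, hx, h2⟩ := hX
  obtain ⟨h3, y, hy, h4⟩ := hY
  exact ⟨by rw [mul_sub, h1, h3], x - y, sub_mem hx hy, by rw [h2, h4, sub_mul]⟩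

end

variable {d d' γ δ δ' : K} (hd : d * d' = 1)
    (hδ : δ * δ' = 1) (hg : Harmonic b g (algebraMap K K d))
    (hγ : algebraMap K K γ = algebraMap K K δ * g 1)

lemma matUnit_zero {p q : ℕ → ℤ} (hp : p 0 = 0) (hq : q 0 = 0) :
    matUnit (K := K) b n 0 p q = walkProj b n := by
  refine LinearMap.ext fun φ => funext fun l => ?_
  by_cases h : IsWalk (Dom b) n l
  · rw [walkProj_of h, matUnit_of h fun i hi => ?_]
    · congr 1
      funext i
      rw [splice]
      split_ifs with hi
      · obtain rfl : i = 0 := by omega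
        rw [hq, h.1]
      · rfl
    · obtain rfl : i = 0 := by omega
      rw [hp, h.1]
  · rw [walkProj_of_not h, matUnit_of_not fun h' => h h'.1]

/-- A matrix unit with ends away from the extremal weights is a product of smaller ones and `U_m`. -/
lemma matUnit_mul_pathU_mul_matUnit {m : ℕ} (hm1 : 1 ≤ m) (hm : m + 1 ≤ n) {p q y : ℕ → ℤ}
    (hp : IsWalk (Dom b) (m + 1) p) (hq : IsWalk (Dom b) (m + 1) q) (hpq : p (m + 1) = q (m + 1))
    (hy : IsWalk (Dom b) (m - 1) y) (hyh : y (m - 1) = p (m + 1)) :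
    matUnit b n m (Function.update p (m + 1) 0) (Function.update y m (p m)) *
      (pathU b n g m * matUnit b n m (Function.update y m (q m)) (Function.update q (m + 1) 0)) =
    (g (q m) / g (p (m + 1))) • matUnit (K := K) b n (m + 1) p q := by
  have hpm := hp.2.1 m (by omega)
  have hqm := hq.2.1 m (by omega)
  have hya : IsWalk (Dom b) m (Function.update y m (p m)) := by
    have := hy.update (h := p m) (hp.2.2.1 m (by omega)) (by omega)
    rwa [Nat.sub_add_cancel hm1] at this
  refine LinearMap.ext fun φ => funext fun l => ?_
  rw [Module.End.mul_apply, LinearMap.smul_apply, Pi.smul_apply, smul_eq_mul]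
  have hup : ∀ i ≤ m, Function.update p (m + 1) 0 i = p i := fun i hi =>
    Function.update_of_ne (by omega) _ _
  by_cases hl : IsWalk (Dom b) n l ∧ ∀ i ≤ m, l i = p i
  swap
  · rw [matUnit_of_not (fun h => hl ⟨h.1, fun i hi => (h.2 i hi).trans (hup i hi)⟩),
      matUnit_of_not (fun h => hl ⟨h.1, fun i hi => h.2 i (by omega)⟩), mul_zero]
  rw [matUnit_of hl.1 fun i hi => (hl.2 i hi).trans (hup i hi).symm]
  set l' := splice m (Function.update y m (p m)) l with hl'
  have hl'w : IsWalk (Dom b) n l' := splice_isWalk (by omega) hya hl.1 (by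
    rw [Function.update_self, hl.2 m le_rfl])
  have hl'1 : l' (m - 1) = p (m + 1) := by
    rw [hl', splice, if_pos (by omega), Function.update_of_ne (by omega), hyh]
  have hl'2 : l' (m + 1) = l (m + 1) := by rw [hl', splice, if_neg (by omega)]
  rw [Module.End.mul_apply]
  by_cases hl1 : l (m + 1) = p (m + 1)
  swap
  · rw [pathU_of_not_flat, matUnit_of_not, mul_zero]
    · exact fun h => hl1 (h.2 _ le_rfl)
    · intro h
      have h3 := h.2.2.2
      rw [hl'1, hl'2] at h3
      exact hl1 h3.symm
  have hflat : Flat b n m l' := ⟨hl'w, hm1, by omega, by rw [hl'1, hl'2, hl1]⟩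
  rw [pathU_of_flat hflat, avg, hl'1]
  have hagree : ∀ t, (∀ i ≤ m, Function.update l' m t i = Function.update y m (q m) i) ↔
      t = q m := by
    intro t
    constructor
    · intro h
      simpa using h m le_rfl
    · rintro rfl i hi
      by_cases him : i = m
      · rw [him, Function.update_self, Function.update_self]
      · rw [Function.update_of_ne him, Function.update_of_ne him, hl', splice, if_pos hi,
          Function.update_of_ne him]
  have hval1 : ∀ t, t ≠ q m → matUnit b n m (Function.update y m (q m))
      (Function.update q (m + 1) 0) φ (Function.update l' m t) = 0 := fun t ht =>
    matUnit_of_not (fun h => ht ((hagree t).1 h.2)) _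
  have hval2 : matUnit b n m (Function.update y m (q m))
      (Function.update q (m + 1) 0) φ (Function.update l' m (q m)) = φ (splice (m + 1) q l) := by
    rw [matUnit_of (hflat.isWalk_update (hq.2.2.1 m (by omega)) (by omega)) ((hagree _).2 rfl)]
    congr 1
    funext i
    simp only [splice, hl']
    rcases lt_trichotomy i (m + 1) with hi | rfl | hi
    · rw [if_pos (by omega), if_pos (by omega), Function.update_of_ne (by omega)]
    · rw [if_neg (by omega), if_pos (by omega), Function.update_of_ne (by omega), splice,
        if_neg (by omega), hl1, hpq]
    · rw [if_neg (by omega), if_neg (by omega), Function.update_of_ne (by omega), splice,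
        if_neg (by omega)]
  have hR : matUnit b n (m + 1) p q φ l = φ (splice (m + 1) q l) := matUnit_of hl.1 (by
    intro i hi
    rcases Nat.le_succ_iff.1 hi with hi | rfl
    · exact hl.2 i hi
    · exact hl1) φ
  rw [hR]
  rcases hqm with h | h
  · rw [hval1 _ (by omega), show p (m + 1) - 1 = q m by omega, hval2]
    ring
  · rw [hval1 (p (m + 1) - 1) (by omega), show p (m + 1) + 1 = q m by omega, hval2]
    ring

/-- Induction on m. If the common end is not extremal, the two walks are joined through a shorter
walk ending at the same height, and the matrix unit is a nonzero multiple of a product of two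
smaller ones with U_m in between. If it is extremal, p = q, and the matrix unit is the one for the
first m steps minus that of the other continuation, which is either not extremal, or excluded by the
domain, or, for m = 0, handled by e/δ. -/
lemma realized_matUnit {m : ℕ} (hm : m ≤ n) {p q : ℕ → ℤ} (hp : IsWalk (Dom b) m p)
    (hq : IsWalk (Dom b) m q) (hpq : p m = q m) :
    Realized (pathSystem b n g K d d' γ δ δ' hd hδ hg hγ) b m (matUnit b n m p q) := by
  set S := pathSystem b n g K d d' γ δ δ' hd hδ hg hγ with hS
  have hδ0 : δ ≠ 0 := left_ne_zero_of_mul_eq_one hδ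
  induction m generalizing p q with
  | zero =>
    rw [matUnit_zero hp.1 hq.1]
    refine ⟨walkProj_mul_eq fun φ l h => walkProj_of_not h φ, 1, one_mem _, (one_mul _).symm⟩
  | succ m ih =>
    have hlow : ∀ {p q : ℕ → ℤ}, IsWalk (Dom b) (m + 1) p → IsWalk (Dom b) (m + 1) q →
        p (m + 1) = q (m + 1) → (p (m + 1)).natAbs < m + 1 →
        Realized S b (m + 1) (matUnit b n (m + 1) p q) := by
      intro p q hp hq hpq hlt
      obtain ⟨r, hr⟩ := hp.exists_natAbs le_rfl
      obtain ⟨y, hy, hyh⟩ := exists_isWalk b (m := m - 1) (h := p (m + 1)) (r := r - 1) (by omega)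
        (hp.2.2.1 _ le_rfl)
      have hpm := hp.2.1 m (by omega)
      have hqm := hq.2.1 m (by omega)
      have hya := hy.update (h := p m) (hp.2.2.1 m (by omega)) (by omega)
      have hyb := hy.update (h := q m) (hq.2.2.1 m (by omega)) (by omega)
      rw [Nat.sub_add_cancel (by omega)] at hya hyb
      have key := matUnit_mul_pathU_mul_matUnit (g := g) (by omega) hm hp hq hpq hy hyh
      have hgq : g (q m) ≠ 0 := hg.ne_zero _ (hq.2.2.1 m (by omega))
      have hgp : g (p (m + 1)) ≠ 0 := hg.ne_zero _ (hp.2.2.1 _ le_rfl)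
      have key2 : matUnit b n (m + 1) p q = (g (q m) / g (p (m + 1)))⁻¹ •
          (matUnit b n m (Function.update p (m + 1) 0) (Function.update y m (p m)) *
          (pathU b n g m *
            matUnit b n m (Function.update y m (q m)) (Function.update q (m + 1) 0))) := by
        rw [key, smul_smul, inv_mul_cancel₀ (div_ne_zero hgq hgp), one_smul]
      rw [key2]
      refine Realized.smul _ (Realized.mul (ih (by omega) hp.restrict hya ?_).mono ?_)
      · rw [Function.update_self, Function.update_of_ne (by omega)]
      · obtain ⟨h1, x, hx, h2⟩ := (ih (by omega) hyb hq.restrict (by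
          rw [Function.update_self, Function.update_of_ne (by omega)])).mono
        refine ⟨walkProj_mul_eq fun φ l h => pathU_of_not_flat (fun h' => h h'.1) _,
          pathU b n g m * x, mul_mem (S.U_mem (Nat.lt_succ_self m)) hx, ?_⟩
        rw [h2, mul_assoc]
    by_cases hlt : (p (m + 1)).natAbs < m + 1
    · exact hlow hp hq hpq hlt
    obtain ⟨r, hr⟩ := hp.exists_natAbs le_rfl
    have hext : (p (m + 1)).natAbs = m + 1 := by omega
    obtain rfl : p = q := hp.ext hq (hp.eq_of_natAbs_eq hq le_rfl hpq hext)
    have hpm := hp.2.1 m (by omega)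
    obtain ⟨r', hr'⟩ := hp.exists_natAbs (Nat.le_succ m)
    have hE := (ih (by omega) hp.restrict hp.restrict rfl).mono
    -- The other neighbour of `p m`, that is, the end of the competing continuation.
    set h' : ℤ := 2 * p m - p (m + 1) with hh'
    have hup : ∀ i ≤ m, Function.update p (m + 1) 0 i = p i := fun i hi =>
      Function.update_of_ne (by omega) _ _
    have hspl : ∀ {l : ℕ → ℤ}, IsWalk (Dom b) n l → (∀ i ≤ m, l i = p i) →
        splice m (Function.update p (m + 1) 0) l = l := by
      intro l _ h2
      funext i
      rw [splice]
      split_ifs with hi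
      · rw [hup i hi, h2 i hi]
      · rfl
    by_cases hD : Dom b h'
    · have hp'' : IsWalk (Dom b) (m + 1) (Function.update p (m + 1) h') := by
        have := hp.restrict.update (h := h') hD (by
          rw [Function.update_of_ne (by omega)]; omega)
        rwa [Function.update_idem] at this
      have hsplit : matUnit b n (m + 1) p p = matUnit b n m (Function.update p (m + 1) 0)
          (Function.update p (m + 1) 0) - matUnit (K := K) b n (m + 1)
            (Function.update p (m + 1) h') (Function.update p (m + 1) h') := by
        refine LinearMap.ext fun φ => funext fun l => ?_
        rw [LinearMap.sub_apply, Pi.sub_apply]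
        have hself : ∀ {z : ℕ → ℤ}, (∀ i ≤ m + 1, l i = z i) → splice (m + 1) z l = l := by
          intro z hz
          funext i
          rw [splice]
          split_ifs with hi
          · rw [hz i hi]
          · rfl
        by_cases hl : IsWalk (Dom b) n l ∧ ∀ i ≤ m, l i = p i
        · rw [matUnit_of hl.1 fun i hi => (hl.2 i hi).trans (hup i hi).symm, hspl hl.1 hl.2]
          have hlm := hl.1.2.1 m (by omega)
          rw [hl.2 m le_rfl] at hlm
          by_cases hl1 : l (m + 1) = p (m + 1)
          · have hag : ∀ i ≤ m + 1, l i = p i := by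
              intro i hi
              rcases Nat.le_succ_iff.1 hi with hi | rfl
              exacts [hl.2 i hi, hl1]
            rw [matUnit_of hl.1 hag, hself hag, matUnit_of_not, sub_zero]
            intro h
            have := h.2 (m + 1) le_rfl
            rw [Function.update_self] at this
            omega
          · have hag : ∀ i ≤ m + 1, l i = Function.update p (m + 1) h' i := by
              intro i hi
              rcases Nat.le_succ_iff.1 hi with hi | rfl
              · rw [Function.update_of_ne (by omega)]; exact hl.2 i hi
              · rw [Function.update_self]; change l (m + 1) = h'; omega
            rw [matUnit_of_not fun h => hl1 (h.2 _ le_rfl), matUnit_of hl.1 hag, hself hag,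
              sub_self]
        · rw [matUnit_of_not fun h => hl ⟨h.1, fun i hi => h.2 i (by omega)⟩,
            matUnit_of_not fun h => hl ⟨h.1, fun i hi => (h.2 i hi).trans (hup i hi)⟩,
            matUnit_of_not fun h => hl ⟨h.1, fun i hi => (h.2 i (by omega)).trans
              (Function.update_of_ne (by omega) _ _)⟩, sub_zero]
      by_cases hm0 : 1 ≤ m
      · rw [hsplit]
        refine hE.sub (hlow hp'' hp'' rfl ?_)
        rw [Function.update_self]; omega
      · obtain rfl : m = 0 := by omega
        have hb : b := by
          rcases hD with hb | h0
          · exact hb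
          · rcases hp.2.2.1 (0 + 1) le_rfl with hb | h1
            · exact hb
            · have h2 := hp.1
              change 0 ≤ p (0 + 1) at h1
              change 0 ≤ h' at h0
              omega
        -- On the first step both heights ±1 are allowed, and e/δ is the projection to walks through
        -- 1.
        have hplus : ∀ {z : ℕ → ℤ}, IsWalk (Dom b) 1 z → z 1 = 1 →
            Realized S b 1 (matUnit b n 1 z z) := by
          intro z hz hz1
          refine ⟨walkProj_mul_eq fun φ l h => matUnit_of_not (fun h' => h h'.1) _,
            δ' • S.e, Subalgebra.smul_mem _ (S.e_mem le_rfl) _, ?_⟩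
          refine LinearMap.ext fun φ => funext fun l => ?_
          rw [smul_mul_assoc, LinearMap.smul_apply, Pi.smul_apply, Module.End.mul_apply, hS]
          change _ = δ' • pathE b n δ (walkProj b n φ) l
          simp only [pathE, LinearMap.coe_mk, AddHom.coe_mk, smul_eq_mul]
          by_cases hl : IsWalk (Dom b) n l
          · rw [walkProj_of hl]
            by_cases hl1 : l 1 = 1
            · have hag : ∀ i ≤ 1, l i = z i := by
                intro i hi
                rcases Nat.le_one_iff_eq_zero_or_eq_one.1 hi with rfl | rfl
                · rw [hl.1, hz.1]
                · rw [hl1, hz1]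
              have : splice 1 z l = l := by
                funext i
                rw [splice]
                split_ifs with hi
                · rw [hag i hi]
                · rfl
              rw [matUnit_of hl hag, this, if_neg (by rintro ⟨-, h | h⟩ <;> omega), ← mul_assoc,
                mul_comm δ', hδ, one_mul]
            · rw [if_pos ⟨hb, Or.inr hl1⟩, mul_zero,
                matUnit_of_not fun h => hl1 (by rw [h.2 1 le_rfl, hz1])]
          · rw [walkProj_of_not hl, matUnit_of_not fun h => hl h.1]
            simp
        have hp0 := hp.1
        rcases hpm with h1 | h1
        · exact hplus hp (by simpa [hp0] using h1)
        · rw [hsplit]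
          refine hE.sub (hplus hp'' ?_)
          rw [Function.update_self]; omega
    · have hsame : matUnit b n (m + 1) p p = matUnit (K := K) b n m (Function.update p (m + 1) 0)
          (Function.update p (m + 1) 0) := by
        refine LinearMap.ext fun φ => funext fun l => ?_
        by_cases hl : IsWalk (Dom b) n l ∧ ∀ i ≤ m, l i = p i
        · have hlm := hl.1.2.1 m (by omega)
          rw [hl.2 m le_rfl] at hlm
          have hl1 : l (m + 1) = p (m + 1) := by
            by_contra h
            exact hD (by
              have := hl.1.2.2.1 (m + 1) hm
              rwa [show l (m + 1) = h' by omega] at this)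
          have hag : ∀ i ≤ m + 1, l i = p i := by
            intro i hi
            rcases Nat.le_succ_iff.1 hi with hi | rfl
            exacts [hl.2 i hi, hl1]
          rw [matUnit_of hl.1 fun i hi => (hl.2 i hi).trans (hup i hi).symm, hspl hl.1 hl.2,
            matUnit_of hl.1 hag]
          congr 1
          funext i
          rw [splice]
          split_ifs with hi
          · rw [hag i hi]
          · rfl
        · rw [matUnit_of_not fun h => hl ⟨h.1, fun i hi => h.2 i (by omega)⟩,
            matUnit_of_not fun h => hl ⟨h.1, fun i hi => (h.2 i hi).trans (hup i hi)⟩]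
      rw [hsame]
      exact hE

end Path

end BlobSystem

/-! ### Independence for generic parameters and specialisation -/

namespace BlobSystem

section

variable {R A : Type*} [CommRing R] [Ring A] [Algebra R A] (S : BlobSystem R A)

lemma U_mem_level (i : ℕ) : S.U i ∈ S.level S.n := by
  by_cases hi : i < S.n
  · exact S.U_mem hi
  · rw [S.U_of_le i (by omega)]; exact zero_mem _

/-- The generators inside the subalgebra they generate. -/
def restrict (he : S.e ∈ S.level S.n) : BlobSystem R (S.level S.n) where
  d := S.d
  d' := S.d'
  γ := S.γ
  δ := S.δ
  δ' := S.δ'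
  n := S.n
  e := ⟨S.e, he⟩
  U i := ⟨S.U i, S.U_mem_level i⟩
  d_mul := S.d_mul
  δ_mul := S.δ_mul
  U_zero := Subtype.ext S.U_zero
  U_of_le i hi := Subtype.ext (S.U_of_le i hi)
  U_sq i := Subtype.ext (S.U_sq i)
  U_braid i h1 h2 := Subtype.ext (S.U_braid i h1 h2)
  U_braid' i h1 := Subtype.ext (S.U_braid' i h1)
  U_comm i j h := Subtype.ext (S.U_comm i j h)
  e_sq := Subtype.ext S.e_sq
  e_blob := Subtype.ext S.e_blob
  e_comm i h := Subtype.ext (S.e_comm i h)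

lemma compat_restrict (he : S.e ∈ S.level S.n) :
    Compat (S.restrict he) S (RingHom.id R) (S.level S.n).val.toRingHom :=
  ⟨fun _ _ => rfl, rfl, rfl, fun _ _ => rfl, fun _ => rfl⟩

lemma restrict_level (he : S.e ∈ S.level S.n) : (S.restrict he).level S.n = ⊤ := by
  have key : ∀ x ∈ S.level S.n, ∃ y ∈ (S.restrict he).level S.n, (y : A) = x := by
    intro x hx
    induction hx using Algebra.adjoin_induction with
    | mem y hy =>
      rcases hy with ⟨i, hi, rfl⟩ | ⟨h1, rfl⟩
      exacts [⟨_, (S.restrict he).U_mem hi, rfl⟩, ⟨_, (S.restrict he).e_mem h1, rfl⟩]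
    | algebraMap r => exact ⟨algebraMap R _ r, algebraMap_mem _ r, rfl⟩
    | add _ _ _ _ h1 h2 =>
      obtain ⟨a, ha, rfl⟩ := h1
      obtain ⟨b, hb, rfl⟩ := h2
      exact ⟨a + b, add_mem ha hb, rfl⟩
    | mul _ _ _ _ h1 h2 =>
      obtain ⟨a, ha, rfl⟩ := h1
      obtain ⟨b, hb, rfl⟩ := h2
      exact ⟨a * b, mul_mem ha hb, rfl⟩
  refine eq_top_iff.2 fun x _ => ?_
  obtain ⟨y, hy, hyx⟩ := key x x.2
  rwa [← Subtype.ext hyx]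

variable {S} {R' A' : Type*} [CommRing R'] [Ring A'] [Algebra R' A']
  {S' : BlobSystem R' A'} {σ : R →+* R'} {ψ : A →+* A'}

lemma Compat.map_u_mul_v (h : Compat S S' σ ψ) (p q : ℕ → ℤ) :
    ψ (S.u p S.n * S.v q S.n) = S'.u p S.n * S'.v q S.n := by
  rw [map_mul, h.map_u p le_rfl, h.map_v q le_rfl]

end

/-- If the generators generate the algebra, then the cell elements span. -/
theorem top_le_span_cell {R : Type*} [CommRing R] {A : Type u} [Ring A] [Algebra R A]
    (S : BlobSystem R A) {D : ℤ → Prop} (hD0 : D 0) (hD : ∀ m h, 1 ≤ m → ¬ D h → S.f m h = 0)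
    (htop : S.level S.n = ⊤) : ⊤ ≤ Submodule.span R (Set.range (S.cell D)) := by
  have h := J_le_cellSpan hD0 S.n S le_rfl hD 0
  rw [J_zero_right, cellSpan_zero, htop, Algebra.top_toSubmodule] at h
  exact h

lemma f_eq_zero_of_not_dom {R A : Type*} [CommRing R] [Ring A] [Algebra R A]
    (S : BlobSystem R A) {b : Prop} (he : ¬ b → S.e = S.δ • 1) (m : ℕ) (h : ℤ) (hD : ¬ Dom b h) :
    S.f m h = 0 := by
  rw [Dom, not_or] at hD
  rw [f, s, if_neg (by omega), if_pos (by omega), he hD.1, smul_smul, S.δ'_mul, one_smul, sub_self,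
    mul_zero, smul_zero]

section Path

variable {b : Prop} {n : ℕ} {K : Type u} [Field K] {g : ℤ → K}

lemma pathE_of_not (hb : ¬ b) (δ : K) : pathE b n δ = δ • 1 := by
  refine LinearMap.ext fun φ => funext fun p => ?_
  simp [pathE, hb]

lemma linearIndependent_matUnit :
    LinearIndependent K fun x : Cell (Dom b) n => matUnit (K := K) b n n x.1.1 x.1.2 := by
  classical
  have := Fintype.ofFinite (Cell (Dom b) n)
  rw [Fintype.linearIndependent_iff]
  intro a ha x
  obtain ⟨⟨p, q⟩, hp, hq, hpq⟩ := x
  have h := congrFun (LinearMap.congr_fun ha fun l => if l = q then 1 else 0) p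
  rw [LinearMap.sum_apply, Finset.sum_apply, Finset.sum_eq_single ⟨(p, q), hp, hq, hpq⟩] at h
  · rw [LinearMap.smul_apply, Pi.smul_apply, matUnit_of hp fun _ _ => rfl, if_pos] at h
    · simpa using h
    · funext i
      rw [splice]
      split_ifs with hi
      · rfl
      · exact (hp.2.2.2 i (by omega)).trans (hq.2.2.2 i (by omega)).symm
  · rintro ⟨⟨p', q'⟩, hp', hq', hpq'⟩ - hne
    rw [LinearMap.smul_apply, Pi.smul_apply]
    by_cases hag : ∀ i ≤ n, p i = p' i
    · obtain rfl := hp.ext hp' hag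
      rw [matUnit_of hp fun _ _ => rfl, if_neg, smul_zero]
      intro h'
      refine hne (Subtype.ext (Prod.ext rfl ?_))
      refine hq'.ext hq fun i hi => ?_
      have := congrFun h' i
      rwa [splice, if_pos hi] at this
    · rw [matUnit_of_not fun h' => hag h'.2, smul_zero]
  · simp

/-- A dimension count: there are as many cell elements as matrix units of full length, and the
independent matrix units lie in the span of the cell elements restricted to walks. -/
lemma linearIndependent_cell_field {d d' γ δ δ' : K} (hd : d * d' = 1)
    (hδ : δ * δ' = 1) (hg : Harmonic b g (algebraMap K K d))
    (hγ : algebraMap K K γ = algebraMap K K δ * g 1) :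
    LinearIndependent K ((pathSystem b n g K d d' γ δ δ' hd hδ hg hγ).cell (Dom b)) := by
  classical
  set S := pathSystem b n g K d d' γ δ δ' hd hδ hg hγ with hS
  let : Fintype (Cell (Dom b) n) := Fintype.ofFinite _
  let : Fintype (Cell (Dom b) S.n) := Fintype.ofFinite (Cell (Dom b) n)
  -- Operators are compared only after projecting to functions supported on walks, since for
  -- instance 1 is the sum of the diagonal matrix units only there.
  let ρ := LinearMap.mulRight K (walkProj (K := K) b n)
  have hspan := J_le_cellSpan (dom_zero b) S.n S le_rfl (fun m h _ hD =>
    S.f_eq_zero_of_not_dom (b := b) (fun hb => pathE_of_not hb _) m h hD) 0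
  rw [J_zero_right, cellSpan_zero] at hspan
  have hE : Submodule.span K (Set.range fun x : Cell (Dom b) n =>
      matUnit (K := K) b n n x.1.1 x.1.2) ≤
      Submodule.span K (Set.range (ρ ∘ S.cell (Dom b))) := by
    rw [Submodule.span_le]
    rintro _ ⟨x, rfl⟩
    obtain ⟨-, y, hy, hxy⟩ := realized_matUnit hd hδ hg hγ le_rfl x.2.1 x.2.2.1 x.2.2.2
    rw [Set.range_comp, Submodule.span_image]
    exact ⟨y, hspan hy, hxy.symm⟩
  have hcard := linearIndependent_iff_card_le_finrank_span.1
    (linearIndependent_matUnit (K := K) (b := b) (n := n))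
  have hfin : FiniteDimensional K (Submodule.span K (Set.range (ρ ∘ S.cell (Dom b)))) :=
    FiniteDimensional.span_of_finite K (Set.finite_range _)
  have : LinearIndependent K (ρ ∘ S.cell (Dom b)) :=
    linearIndependent_iff_card_le_finrank_span.2 (hcard.trans (Submodule.finrank_mono hE))
  exact this.of_comp ρ

lemma linearIndependent_cell_path {R : Type*} [CommRing R] [Algebra R K]
    (hinj : Function.Injective (algebraMap R K)) {d d' γ δ δ' : R} (hd : d * d' = 1)
    (hδ : δ * δ' = 1) (hg : Harmonic b g (algebraMap R K d))
    (hγ : algebraMap R K γ = algebraMap R K δ * g 1) :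
    LinearIndependent R ((pathSystem b n g R d d' γ δ δ' hd hδ hg hγ).cell (Dom b)) := by
  have hK := linearIndependent_cell_field (n := n)
    (d := algebraMap R K d) (d' := algebraMap R K d') (γ := algebraMap R K γ)
    (δ := algebraMap R K δ) (δ' := algebraMap R K δ') (by rw [← map_mul, hd, map_one])
    (by rw [← map_mul, hδ, map_one]) hg hγ
  have hcompat : Compat (pathSystem b n g R d d' γ δ δ' hd hδ hg hγ)
      (pathSystem b n g K (algebraMap R K d) (algebraMap R K d') (algebraMap R K γ)
        (algebraMap R K δ) (algebraMap R K δ') (by rw [← map_mul, hd, map_one])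
        (by rw [← map_mul, hδ, map_one]) hg hγ) (algebraMap R K) (RingHom.id _) :=
    ⟨fun r a => (algebraMap_smul K r a).symm, rfl, rfl, fun _ _ => rfl, fun _ => rfl⟩
  have heq : (pathSystem b n g R d d' γ δ δ' hd hδ hg hγ).cell (Dom b) =
      (pathSystem b n g K (algebraMap R K d) (algebraMap R K d') (algebraMap R K γ)
        (algebraMap R K δ) (algebraMap R K δ') (by rw [← map_mul, hd, map_one])
        (by rw [← map_mul, hδ, map_one]) hg hγ).cell (Dom b) :=
    funext fun x => hcompat.map_u_mul_v x.1.1 x.1.2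
  rw [heq]
  refine hK.restrict_scalars (R := R) ?_
  intro x y hxy
  simpa [Algebra.smul_def, hinj.eq_iff] using hxy

/-- Specialisation of the path representation: over any commutative ring `k` over `R` there is a
system of generators whose cell elements are linearly independent. -/
lemma exists_specialisation {R k : Type u} [CommRing R] [CommRing k] [Algebra R k] [Algebra R K]
    (hinj : Function.Injective (algebraMap R K)) {d d' γ δ δ' : R} (hd : d * d' = 1)
    (hδ : δ * δ' = 1) (hg : Harmonic b g (algebraMap R K d))
    (hγ : algebraMap R K γ = algebraMap R K δ * g 1) :
    ∃ (Q : Type u) (_ : Ring Q) (_ : Algebra k Q) (S : BlobSystem k Q), S.n = n ∧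
      S.d = algebraMap R k d ∧ S.d' = algebraMap R k d' ∧ S.γ = algebraMap R k γ ∧
      S.δ = algebraMap R k δ ∧ S.δ' = algebraMap R k δ' ∧ (b → n = 0 → S.e = 0) ∧
      (¬ b → S.e = S.δ • 1) ∧ LinearIndependent k (S.cell (Dom b)) := by
  set P := pathSystem b n g R d d' γ δ δ' hd hδ hg hγ with hP
  have hb0 : b → n = 0 → P.e = 0 := fun hb hn => by
    refine LinearMap.ext fun φ => funext fun p => ?_
    simp [P, pathSystem, pathE, hb, hn]
  have hnb : ¬ b → P.e = δ • 1 := fun hb => by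
    rw [← algebraMap_smul K δ]
    exact pathE_of_not hb _
  have he : P.e ∈ P.level P.n := by
    by_cases hb : b
    · by_cases hn : n = 0
      · rw [hb0 hb hn]; exact zero_mem _
      · exact P.e_mem (Nat.one_le_iff_ne_zero.2 hn)
    · rw [hnb hb]; exact Subalgebra.smul_mem _ (one_mem _) _
  let O := P.restrict he
  have hcO := P.compat_restrict he
  have hO : LinearIndependent R (O.cell (Dom b)) := by
    refine LinearIndependent.of_comp (P.level P.n).val.toLinearMap ?_
    have : (P.level P.n).val.toLinearMap ∘ O.cell (Dom b) = P.cell (Dom b) :=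
      funext fun x => hcO.map_u_mul_v x.1.1 x.1.2
    rw [this]
    exact linearIndependent_cell_path hinj hd hδ hg hγ
  have hOe : ¬ b → O.e = O.δ • 1 := fun hb => Subtype.ext (hnb hb)
  -- Spanning holds over any commutative ring, so the R-algebra generated by the path operators is
  -- free over R on the cell elements. Base change to `k` therefore keeps them a basis.
  have hspan := O.top_le_span_cell (dom_zero b)
    (fun m h _ hD => O.f_eq_zero_of_not_dom hOe m h hD) (P.restrict_level he)
  let B := Module.Basis.mk hO hspan
  let ι : P.level P.n →+* k ⊗[R] P.level P.n := Algebra.TensorProduct.includeRight.toRingHom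
  have hι : ∀ r a, ι (r • a) = algebraMap R k r • ι a := fun r a => by
    change (1 : k) ⊗ₜ[R] (r • a) = algebraMap R k r • ((1 : k) ⊗ₜ[R] a)
    rw [algebraMap_smul, TensorProduct.tmul_smul]
  refine ⟨k ⊗[R] P.level P.n, inferInstance, inferInstance, O.map (algebraMap R k) ι hι, rfl, rfl,
    rfl, rfl, rfl, rfl, fun hb hn => ?_, fun hb => ?_, ?_⟩
  · change ι O.e = 0
    rw [show O.e = 0 from Subtype.ext (hb0 hb hn), map_zero]
  · change ι O.e = algebraMap R k O.δ • 1
    rw [hOe hb, hι, map_one]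
  · have key : ∀ x : Cell (Dom b) O.n, Algebra.TensorProduct.basis k B x = ι (O.cell (Dom b) x) :=
      fun x => by rw [Algebra.TensorProduct.basis_apply, Module.Basis.mk_apply]; rfl
    have : (O.map (algebraMap R k) ι hι).cell (Dom b) = Algebra.TensorProduct.basis k B :=
      funext fun x => ((O.compat_map _ ι hι).map_u_mul_v x.1.1 x.1.2).symm.trans (key x).symm
    rw [this]
    exact (Algebra.TensorProduct.basis k B).linearIndependent

end Path

end BlobSystem

/-! ## A system with linearly independent cell elements -/

namespace BlobSystem

section

open Polynomial

/-- The solution of `x (n + 2) = d * x (n + 1) - x n` with `x 0 = 1` and `x 1 = a`. -/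
def chain {R : Type*} [CommRing R] (d a : R) : ℕ → R
  | 0 => 1
  | 1 => a
  | n + 2 => d * chain d a (n + 1) - chain d a n

/-- The degrees strictly increase, since multiplication by d raises the degree and the subtracted
term has smaller degree. -/
lemma chain_ne_zero {k : Type*} [Field k] {d a : k[X]} (hd : 0 < d.natDegree)
    (ha : 0 < a.natDegree) (n : ℕ) : chain d a n ≠ 0 := by
  have key : ∀ n, (chain d a n).natDegree < (chain d a (n + 1)).natDegree := by
    intro n
    induction n with
    | zero => simpa [chain] using ha
    | succ n ih =>
      have h0 : chain d a (n + 1) ≠ 0 := by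
        intro h; rw [h] at ih; simp at ih
      have hd0 : d ≠ 0 := by rintro rfl; simp at hd
      have h1 : (d * chain d a (n + 1)).natDegree = d.natDegree + (chain d a (n + 1)).natDegree :=
        natDegree_mul hd0 h0
      rw [show chain d a (n + 1 + 1) = d * chain d a (n + 1) - chain d a n from rfl,
        natDegree_sub_eq_left_of_natDegree_lt (by omega)]
      omega
  rcases n with _ | n
  · exact one_ne_zero
  · intro h
    have := key n
    rw [h] at this
    simp at this

/-- The two-sided continuation of `chain`. -/
def bichain {R : Type*} [CommRing R] (d a : R) (h : ℤ) : R :=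
  if 0 ≤ h then chain d a h.toNat else chain d (d - a) (-h).toNat

/-- The two half-lines match at 0 because their values at 1 and -1, namely a and d - a, add up to d.
-/
lemma bichain_add {R : Type*} [CommRing R] (d a : R) (h : ℤ) :
    bichain d a (h + 1) + bichain d a (h - 1) = d * bichain d a h := by
  rcases lt_trichotomy h 0 with hh | rfl | hh
  · obtain ⟨n, rfl⟩ : ∃ n : ℕ, h = -(n + 1 : ℤ) := ⟨(-h - 1).toNat, by omega⟩
    have h1 : bichain d a (-(n + 1 : ℤ)) = chain d (d - a) (n + 1) := by
      rw [bichain, if_neg (by omega)]; congr 1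
    have h2 : bichain d a (-(n + 1 : ℤ) - 1) = chain d (d - a) (n + 2) := by
      rw [bichain, if_neg (by omega)]; rfl
    have h3 : bichain d a (-(n + 1 : ℤ) + 1) = chain d (d - a) n := by
      rcases n with _ | n
      · simp [bichain, chain]
      · rw [bichain, if_neg (by push_cast; omega)]; rfl
    rw [h1, h2, h3, show chain d (d - a) (n + 2) = d * chain d (d - a) (n + 1)
      - chain d (d - a) n from rfl]
    ring
  · simp [bichain, chain]
  · obtain ⟨n, rfl⟩ : ∃ n : ℕ, h = (n + 1 : ℤ) := ⟨(h - 1).toNat, by omega⟩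
    have h1 : bichain d a (n + 1 : ℤ) = chain d a (n + 1) := by
      rw [bichain, if_pos (by omega)]; congr 1
    have h2 : bichain d a (n + 1 - 1 : ℤ) = chain d a n := by
      rw [bichain, if_pos (by omega)]; congr 1; omega
    have h3 : bichain d a (n + 1 + 1 : ℤ) = chain d a (n + 2) := by
      rw [bichain, if_pos (by omega)]; congr 1
    rw [h1, h2, h3, show chain d a (n + 2) = d * chain d a (n + 1) - chain d a n from rfl]
    ring

open Classical in
/-- Over a field there is a system with given parameters whose cell elements are linearly
independent. -/
theorem exists_linearIndependent {k : Type u} [Field k] (b : Prop) (n : ℕ) (d γ δ : k)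
    (hd : d ≠ 0) (hδ : δ ≠ 0) (hγ : ¬ b → γ = δ * d) :
    ∃ (Q : Type u) (_ : Ring Q) (_ : Algebra k Q) (S : BlobSystem k Q), S.n = n ∧
      S.d = d ∧ S.γ = γ ∧ S.δ = δ ∧ (b → n = 0 → S.e = 0) ∧
      (¬ b → S.e = S.δ • 1) ∧ LinearIndependent k (S.cell (Dom b)) := by
  -- The deformation: over k[[X]] the loop parameter d becomes d + X, still a unit since its
  -- constant term is nonzero, and the constant coefficient specialises back to k.
  let : Algebra (PowerSeries k) k := (PowerSeries.constantCoeff (R := k)).toAlgebra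
  have halg : ∀ p : k[X], algebraMap (PowerSeries k) k (p : PowerSeries k) = p.coeff 0 :=
    fun p => Polynomial.constantCoeff_coe p
  let dP : k[X] := X + C d
  -- The weight at height 1 must have constant term γ/δ. In the blob case its degree 2 exceeds that
  -- of the deformed d, so a and d - a both have positive degree and the weight vanishes nowhere on
  -- ℤ. In the Temperley–Lieb case a = d, which makes the weight at height -1 equal to 0.
  let a : k[X] := if b then X ^ 2 + C (γ / δ) else dP
  have hdP : dP.natDegree = 1 := natDegree_X_add_C d
  have ha : 0 < a.natDegree := by
    by_cases hb : b
    · simp [a, hb]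
    · simp [a, hb, hdP]
  have hda : b → 0 < (dP - a).natDegree := by
    intro hb
    rw [natDegree_sub_eq_right_of_natDegree_lt]
    · exact ha
    · simp [a, hb, hdP]
  have hd0 : dP.coeff 0 = d := by simp [dP]
  have hunit : ∀ p : k[X], p.coeff 0 ≠ 0 → ∃ y : PowerSeries k, (p : PowerSeries k) * y = 1 := by
    intro p hp
    have : IsUnit (p : PowerSeries k) := by
      rw [PowerSeries.isUnit_iff_constantCoeff, Polynomial.constantCoeff_coe]
      exact hp.isUnit
    exact this.exists_right_inv
  obtain ⟨d', hd'⟩ := hunit dP (by rwa [hd0])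
  obtain ⟨δ', hδ'⟩ := hunit (C δ) (by simpa using hδ)
  let K := FractionRing (PowerSeries k)
  have hinj : Function.Injective (algebraMap (PowerSeries k) K) :=
    IsFractionRing.injective _ _
  let j : k[X] →+* K := (algebraMap (PowerSeries k) K).comp Polynomial.coeToPowerSeries.ringHom
  have hj : Function.Injective j := hinj.comp (Polynomial.coe_injective k)
  have hjdef : ∀ p : k[X], j p = algebraMap (PowerSeries k) K (p : PowerSeries k) := fun p => rfl
  have hg : Harmonic b (fun h => j (bichain dP a h)) (algebraMap (PowerSeries k) K dP) := by
    refine ⟨?_, fun h hh => ?_, fun h _ => ?_, fun hb => ?_⟩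
    · simp [bichain, chain]
    · rw [Ne, map_eq_zero_iff j hj, bichain]
      split_ifs with h0
      · exact chain_ne_zero (by omega) ha _
      · exact chain_ne_zero (by omega) (hda (hh.resolve_right h0)) _
    · rw [← map_add, bichain_add, map_mul, hjdef dP]
    · simp [bichain, chain, a, hb]
  have hg1 : bichain dP a 1 = a := by simp [bichain, chain]
  obtain ⟨Q, i1, i2, S, h1, h2, -, h3, h4, -, h5, h6, h7⟩ :=
    exists_specialisation (n := n) (k := k) hinj hd' hδ'
      (γ := ((C δ * a : k[X]) : PowerSeries k)) hg (by
        rw [← hjdef, ← hjdef, ← map_mul, hg1])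
  refine ⟨Q, i1, i2, S, h1, ?_, ?_, ?_, h5, h6, h7⟩
  · rw [h2, halg, hd0]
  · rw [h3, halg, coeff_C_mul]
    by_cases hb : b
    · simp [a, hb, mul_div_cancel₀ _ hδ]
    · simp [a, hb, hd0, hγ hb]
  · rw [h4, halg, coeff_C_zero]

end

end BlobSystem

/-! ## The Temperley–Lieb and blob algebras -/

namespace BlobSystem

/-- The generators generate, the cell elements are independent, and the blob generator is trivial
unless `b` holds. -/
structure Good {k : Type u} [Field k] {A : Type u} [Ring A] [Algebra k A] (S : BlobSystem k A)
    (b : Prop) : Prop where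
  top : S.level S.n = ⊤
  e_eq : ¬ b → S.e = S.δ • 1
  indep : LinearIndependent k (S.cell (Dom b))

variable {k : Type u} [Field k] {A Q : Type u} [Ring A] [Algebra k A] [Ring Q] [Algebra k Q]

lemma compat_algHom {S : BlobSystem k A} {S' : BlobSystem k Q} (φ : A →ₐ[k] Q)
    (hd : S'.d = S.d) (hδ : S'.δ = S.δ) (hU : ∀ i < S.n, φ (S.U i) = S'.U i)
    (he : 1 ≤ S.n → φ S.e = S'.e) : Compat S S' (RingHom.id k) φ.toRingHom where
  smul r a := map_smul φ r a
  d' := by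
    change S.d' = S'.d'
    rw [← one_mul S.d', ← S'.d'_mul, hd, mul_assoc, S.d_mul, mul_one]
  δ' := by
    change S.δ' = S'.δ'
    rw [← one_mul S.δ', ← S'.δ'_mul, hδ, mul_assoc, S.δ_mul, mul_one]
  U := hU
  e := he

/-- A homomorphism matching generators maps cell elements to cell elements, so a relation among them
upstairs would give one in the target. -/
lemma Good.of_compat {S : BlobSystem k A} {S' : BlobSystem k Q} {b : Prop} (φ : A →ₐ[k] Q)
    (h : Compat S S' (RingHom.id k) φ.toRingHom) (hn : S'.n = S.n) (htop : S.level S.n = ⊤)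
    (he : ¬ b → S.e = S.δ • 1) (hli : LinearIndependent k (S'.cell (Dom b))) : S.Good b := by
  refine ⟨htop, he, LinearIndependent.of_comp φ.toLinearMap ?_⟩
  have h1 : ∀ x : Cell (Dom b) S.n, φ (S.cell (Dom b) x) = S'.u x.1.1 S.n * S'.v x.1.2 S.n :=
    fun x => (map_mul φ _ _).trans (congrArg₂ _ (h.map_u _ le_rfl) (h.map_v _ le_rfl))
  have h2 := hli.comp (fun x : Cell (Dom b) S.n => (⟨x.1, by rw [hn]; exact x.2⟩ :
    Cell (Dom b) S'.n)) fun x y hxy => Subtype.ext (congrArg (fun z => z.1) hxy)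
  convert h2 using 1
  funext x
  refine (h1 x).trans ?_
  exact congrArg (fun m => S'.u x.1.1 m * S'.v x.1.2 m) hn.symm

end BlobSystem

section

variable {k : Type u} [Field k] {Q : Type u} [Ring Q] [Algebra k Q]

namespace TL

variable (n : ℕ) (q : k)

lemma U_of_lt {i : ℕ} (h : 1 ≤ i ∧ i < n) : U n q i =
    RingQuot.mkAlgHom k (TLRel n q) (FreeAlgebra.ι k ⟨i - 1, by omega⟩) := dif_pos h

lemma U_of_not {i : ℕ} (h : ¬ (1 ≤ i ∧ i < n)) : U n q i = 0 := dif_neg h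

lemma mk_ι (i : Fin (n - 1)) :
    RingQuot.mkAlgHom k (TLRel n q) (FreeAlgebra.ι k i) = U n q (i + 1) := by
  rw [U_of_lt n q (by omega)]; rfl

/-- The Temperley–Lieb generators as a blob system with trivial blob generator. -/
def sys (h2 : q + q⁻¹ ≠ 0) : BlobSystem k (TL n q) where
  d := q + q⁻¹
  d' := (q + q⁻¹)⁻¹
  γ := q + q⁻¹
  δ := 1
  δ' := 1
  n := n
  e := 1
  U := U n q
  d_mul := mul_inv_cancel₀ h2
  δ_mul := one_mul 1
  U_zero := U_of_not n q (by omega)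
  U_of_le i hi := U_of_not n q (by omega)
  U_sq i := by
    by_cases h : 1 ≤ i ∧ i < n
    · simpa [U_of_lt n q h] using RingQuot.mkAlgHom_rel k
        (TLRel.sq (n := n) (q := q) ⟨i - 1, by omega⟩)
    · simp [U_of_not n q h]
  U_braid i h1 h2 := by
    have := RingQuot.mkAlgHom_rel k
      (TLRel.braid (n := n) (q := q) ⟨i - 1, by omega⟩ ⟨i, by omega⟩ (by simp only; omega))
    rw [U_of_lt n q (i := i) (by omega), U_of_lt n q (i := i + 1) (by omega)]
    simpa using this
  U_braid' i h1 := by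
    by_cases h : i + 1 < n
    · have := RingQuot.mkAlgHom_rel k
        (TLRel.braid (n := n) (q := q) ⟨i, by omega⟩ ⟨i - 1, by omega⟩ (by simp only; omega))
      rw [U_of_lt n q (i := i) (by omega), U_of_lt n q (i := i + 1) (by omega)]
      simpa using this
    · simp [U_of_not n q (i := i + 1) (by omega)]
  U_comm i j h := by
    by_cases hi : 1 ≤ i ∧ i < n
    · by_cases hj : 1 ≤ j ∧ j < n
      · have := RingQuot.mkAlgHom_rel k
          (TLRel.comm (n := n) (q := q) ⟨i - 1, by omega⟩ ⟨j - 1, by omega⟩ (by simp only; omega))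
        rw [U_of_lt n q hi, U_of_lt n q hj]
        simpa using this
      · simp [U_of_not n q hj]
    · simp [U_of_not n q hi]
  e_sq := by simp
  e_blob := by
    by_cases h : 1 ≤ 1 ∧ 1 < n
    · simpa [U_of_lt n q h] using RingQuot.mkAlgHom_rel k
        (TLRel.sq (n := n) (q := q) ⟨1 - 1, by omega⟩)
    · simp [U_of_not n q h]
  e_comm i _ := by simp

variable {n q}

/-- The homomorphism to an algebra with Temperley–Lieb generators. -/
def hom (S : BlobSystem k Q) (hn : n = S.n) (hd : S.d = q + q⁻¹) : TL n q →ₐ[k] Q :=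
  RingQuot.liftAlgHom k ⟨FreeAlgebra.lift k fun i : Fin (n - 1) => S.U (i + 1), by
    subst hn
    intro x y h
    cases h with
    | sq i => simpa [hd] using S.U_sq (i + 1)
    | braid i j h =>
      simp only [map_mul, FreeAlgebra.lift_ι_apply]
      rcases h with h | h
      · rw [← h]; exact S.U_braid _ (by omega) (by omega)
      · rw [← h]; exact S.U_braid' _ (by omega)
    | comm i j h =>
      simp only [map_mul, FreeAlgebra.lift_ι_apply]
      by_cases hij : i = j
      · rw [hij]
      · exact S.commute_U (by omega)⟩

lemma hom_U (S : BlobSystem k Q) (hn : n = S.n) (hd : S.d = q + q⁻¹) (i : ℕ) :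
    hom S hn hd (U n q i) = S.U i := by
  by_cases h : 1 ≤ i ∧ i < n
  · rw [U_of_lt n q h, hom, RingQuot.liftAlgHom_mkAlgHom_apply, FreeAlgebra.lift_ι_apply]
    exact congrArg S.U (by simp only; omega)
  · rw [U_of_not n q h, map_zero]
    by_cases h1 : 1 ≤ i
    · rw [S.U_of_le i (by omega)]
    · rw [show i = 0 by omega, S.U_zero]

lemma sys_good (h2 : q + q⁻¹ ≠ 0) : (sys n q h2).Good False := by
  obtain ⟨Q, _, _, S', h1, h3, -, h4, -, h5, h6⟩ := BlobSystem.exists_linearIndependent (k := k)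
    False n (q + q⁻¹) (q + q⁻¹) 1 h2 one_ne_zero (by simp)
  refine BlobSystem.Good.of_compat (hom S' h1.symm h3)
    (BlobSystem.compat_algHom _ h3 h4 (fun i _ => hom_U S' _ _ i) fun _ => ?_) h1 ?_ ?_ h6
  · rw [h5 (by simp), h4, one_smul]; exact map_one _
  · refine eq_top_iff.2 fun x _ => ?_
    obtain ⟨a, rfl⟩ := RingQuot.mkAlgHom_surjective k (TLRel n q) x
    induction a using FreeAlgebra.induction with
    | grade0 r => rw [AlgHom.commutes]; exact algebraMap_mem _ r
    | grade1 i => rw [mk_ι]; exact (sys n q h2).U_mem_level _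
    | mul a b ha hb => rw [map_mul]; exact mul_mem (ha trivial) (hb trivial)
    | add a b ha hb => rw [map_add]; exact add_mem (ha trivial) (hb trivial)
  · intro _; exact (one_smul k _).symm

lemma cup_eq (h2 : q + q⁻¹ ≠ 0) (r : ℕ) : cup n q r = (sys n q h2).c n r := by
  induction r with
  | zero => simp [cup]
  | succ r ih =>
    rw [(sys n q h2).c_succ', ← ih, cup, cup, List.range_succ, List.map_append, List.prod_append]
    simp [sys]

lemma incl_U {i : ℕ} (hi : i < n) : incl n q (U n q i) = U (n + 2) q i := by
  by_cases h : 1 ≤ i ∧ i < n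
  · rw [U_of_lt n q h, incl, RingQuot.liftAlgHom_mkAlgHom_apply, FreeAlgebra.lift_ι_apply,
      U_of_lt (n + 2) q (by omega)]
  · rw [U_of_not n q h, U_of_not (n + 2) q (by omega), map_zero]

end TL

namespace Blob

variable (n : ℕ) (q γ δ : k)

lemma U_of_lt {i : ℕ} (h : 1 ≤ i ∧ i < n) : U n q γ δ i =
    RingQuot.mkAlgHom k (BlobRel n q γ δ) (FreeAlgebra.ι k ⟨i, h.2⟩) := dif_pos h

lemma U_of_not {i : ℕ} (h : ¬ (1 ≤ i ∧ i < n)) : U n q γ δ i = 0 := dif_neg h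

lemma e_of_pos (h : 0 < n) : e n q γ δ =
    RingQuot.mkAlgHom k (BlobRel n q γ δ) (FreeAlgebra.ι k ⟨0, h⟩) := dif_pos h

lemma e_of_not (h : ¬ 0 < n) : e n q γ δ = 0 := dif_neg h

/-- The generators of the blob algebra. -/
def sys (h2 : q + q⁻¹ ≠ 0) (hδ : δ ≠ 0) : BlobSystem k (Blob n q γ δ) where
  d := q + q⁻¹
  d' := (q + q⁻¹)⁻¹
  γ := γ
  δ := δ
  δ' := δ⁻¹
  n := n
  e := e n q γ δ
  U := U n q γ δ
  d_mul := mul_inv_cancel₀ h2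
  δ_mul := mul_inv_cancel₀ hδ
  U_zero := U_of_not n q γ δ (by omega)
  U_of_le i hi := U_of_not n q γ δ (by omega)
  U_sq i := by
    by_cases h : 1 ≤ i ∧ i < n
    · simpa [U_of_lt n q γ δ h] using RingQuot.mkAlgHom_rel k
        (BlobRel.sq (n := n) (q := q) (γ := γ) (δ := δ) ⟨i, h.2⟩ (by simp only; omega))
    · simp [U_of_not n q γ δ h]
  U_braid i h1 h2 := by
    have := RingQuot.mkAlgHom_rel k
      (BlobRel.braid (n := n) (q := q) (γ := γ) (δ := δ) ⟨i, by omega⟩ ⟨i + 1, by omega⟩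
        (by simp only; omega) (by simp) (by simp))
    rw [U_of_lt n q γ δ (i := i) (by omega), U_of_lt n q γ δ (i := i + 1) (by omega)]
    simpa using this
  U_braid' i h1 := by
    by_cases h : i + 1 < n
    · have := RingQuot.mkAlgHom_rel k
        (BlobRel.braid (n := n) (q := q) (γ := γ) (δ := δ) ⟨i + 1, by omega⟩ ⟨i, by omega⟩
          (by simp) (by simp only; omega) (by simp))
      rw [U_of_lt n q γ δ (i := i) (by omega), U_of_lt n q γ δ (i := i + 1) (by omega)]
      simpa using this
    · simp [U_of_not n q γ δ (i := i + 1) (by omega)]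
  U_comm i j h := by
    by_cases hi : 1 ≤ i ∧ i < n
    · by_cases hj : 1 ≤ j ∧ j < n
      · have := RingQuot.mkAlgHom_rel k
          (BlobRel.comm (n := n) (q := q) (γ := γ) (δ := δ) ⟨i, by omega⟩ ⟨j, by omega⟩
            (by simp only; omega))
        rw [U_of_lt n q γ δ hi, U_of_lt n q γ δ hj]
        simpa using this
      · simp [U_of_not n q γ δ hj]
    · simp [U_of_not n q γ δ hi]
  e_sq := by
    by_cases h : 0 < n
    · simpa [e_of_pos n q γ δ h] using RingQuot.mkAlgHom_rel k
        (BlobRel.blob_sq (n := n) (q := q) (γ := γ) (δ := δ) ⟨0, h⟩ rfl)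
    · simp [e_of_not n q γ δ h]
  e_blob := by
    by_cases h : 1 ≤ 1 ∧ 1 < n
    · rw [U_of_lt n q γ δ h, e_of_pos n q γ δ (by omega)]
      simpa using RingQuot.mkAlgHom_rel k
        (BlobRel.blob (n := n) (q := q) (γ := γ) (δ := δ) ⟨1, h.2⟩ ⟨0, by omega⟩ rfl rfl)
    · simp [U_of_not n q γ δ h]
  e_comm i h1 := by
    by_cases h : 1 ≤ i ∧ i < n
    · rw [U_of_lt n q γ δ h, e_of_pos n q γ δ (by omega)]
      simpa using RingQuot.mkAlgHom_rel k
        (BlobRel.comm (n := n) (q := q) (γ := γ) (δ := δ) ⟨0, by omega⟩ ⟨i, by omega⟩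
            (by simp only; omega))
    · simp [U_of_not n q γ δ h]

variable {n q γ δ}

/-- The homomorphism to an algebra with blob generators. -/
def hom (S : BlobSystem k Q) (hn : n = S.n) (hd : S.d = q + q⁻¹) (hγ : S.γ = γ)
    (hδ : S.δ = δ) : Blob n q γ δ →ₐ[k] Q :=
  RingQuot.liftAlgHom k ⟨FreeAlgebra.lift k fun i : Fin n =>
      if i.val = 0 then S.e else S.U i, by
    subst hn
    intro x y h
    cases h with
    | sq i hi => simpa [hd, hi] using S.U_sq i
    | braid i j hi hj h =>
      simp only [map_mul, FreeAlgebra.lift_ι_apply, if_neg hi, if_neg hj]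
      rcases h with h | h
      · rw [← h]; exact S.U_braid _ (by omega) (by omega)
      · rw [← h]; exact S.U_braid' _ (by omega)
    | comm i j h =>
      simp only [map_mul, FreeAlgebra.lift_ι_apply]
      by_cases hij : i = j
      · rw [hij]
      · split_ifs with hi hj hj
        · rfl
        · exact S.e_comm _ (by omega)
        · exact (S.e_comm _ (by omega)).symm
        · exact S.commute_U (by omega)
    | blob_sq i hi => simpa [hδ, hi] using S.e_sq
    | blob i j hi hj => simpa [hγ, hi, hj] using S.e_blob⟩

lemma hom_U (S : BlobSystem k Q) (hn : n = S.n) (hd : S.d = q + q⁻¹) (hγ : S.γ = γ)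
    (hδ : S.δ = δ) (i : ℕ) : hom S hn hd hγ hδ (U n q γ δ i) = S.U i := by
  by_cases h : 1 ≤ i ∧ i < n
  · rw [U_of_lt n q γ δ h, hom, RingQuot.liftAlgHom_mkAlgHom_apply, FreeAlgebra.lift_ι_apply,
      if_neg (by simp only; omega)]
  · rw [U_of_not n q γ δ h, map_zero]
    by_cases h1 : 1 ≤ i
    · rw [S.U_of_le i (by omega)]
    · rw [show i = 0 by omega, S.U_zero]

lemma sys_good (h2 : q + q⁻¹ ≠ 0) (hδ : δ ≠ 0) : (sys n q γ δ h2 hδ).Good True := by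
  obtain ⟨Q, _, _, S', h1, h3, hγ', h4, -, -, h6⟩ := BlobSystem.exists_linearIndependent (k := k)
    True n (q + q⁻¹) γ δ h2 hδ (by simp)
  refine BlobSystem.Good.of_compat (hom S' h1.symm h3 hγ' h4)
    (BlobSystem.compat_algHom _ h3 h4 (fun i _ => hom_U S' _ _ _ _ i) fun hn => ?_) h1 ?_
    (by simp) h6
  · change hom S' h1.symm h3 hγ' h4 (e n q γ δ) = S'.e
    rw [e_of_pos n q γ δ hn, hom, RingQuot.liftAlgHom_mkAlgHom_apply, FreeAlgebra.lift_ι_apply,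
      if_pos rfl]
  · refine eq_top_iff.2 fun x _ => ?_
    obtain ⟨a, rfl⟩ := RingQuot.mkAlgHom_surjective k (BlobRel n q γ δ) x
    induction a using FreeAlgebra.induction with
    | grade0 r => rw [AlgHom.commutes]; exact algebraMap_mem _ r
    | grade1 i =>
      have hi := i.2
      by_cases h0 : i.val = 0
      · have := (sys n q γ δ h2 hδ).e_mem (m := n) (by omega)
        rw [show (sys n q γ δ h2 hδ).e = _ from e_of_pos n q γ δ (by omega)] at this
        rw [show i = ⟨0, by omega⟩ from Fin.ext h0]
        exact this
      · have := (sys n q γ δ h2 hδ).U_mem hi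
        rwa [show (sys n q γ δ h2 hδ).U i = _ from U_of_lt n q γ δ (by omega)] at this
    | mul a b ha hb => rw [map_mul]; exact mul_mem (ha trivial) (hb trivial)
    | add a b ha hb => rw [map_add]; exact add_mem (ha trivial) (hb trivial)

lemma cup_eq (h2 : q + q⁻¹ ≠ 0) (hδ : δ ≠ 0) (r : ℕ) :
    cup n q γ δ r = (sys n q γ δ h2 hδ).c n r := by
  induction r with
  | zero => simp [cup]
  | succ r ih =>
    rw [(sys n q γ δ h2 hδ).c_succ', ← ih, cup, cup, List.range_succ, List.map_append,
      List.prod_append]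
    simp [sys]

lemma incl_U {i : ℕ} (hi : i < n) : incl n q γ δ (U n q γ δ i) = U (n + 2) q γ δ i := by
  by_cases h : 1 ≤ i ∧ i < n
  · rw [U_of_lt n q γ δ h, incl, RingQuot.liftAlgHom_mkAlgHom_apply, FreeAlgebra.lift_ι_apply,
      U_of_lt (n + 2) q γ δ (by omega)]
  · rw [U_of_not n q γ δ h, U_of_not (n + 2) q γ δ (by omega), map_zero]

lemma incl_e (hn : 1 ≤ n) : incl n q γ δ (e n q γ δ) = e (n + 2) q γ δ := by
  rw [e_of_pos n q γ δ hn, incl, RingQuot.liftAlgHom_mkAlgHom_apply, FreeAlgebra.lift_ι_apply,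
    e_of_pos (n + 2) q γ δ (by omega)]

end Blob

/-! ## Consequences of the independence of the cell elements -/

namespace BlobSystem

variable {k : Type u} [Field k] {A : Type u} [Ring A] [Algebra k A] {S : BlobSystem k A} {b : Prop}

lemma Good.f_eq_zero (hS : S.Good b) {m : ℕ} {h : ℤ} (hD : ¬ Dom b h) : S.f m h = 0 :=
  S.f_eq_zero_of_not_dom hS.e_eq m h hD

lemma Good.mem_level (hS : S.Good b) (x : A) : x ∈ S.level S.n := by
  rw [hS.top]; trivial

lemma Good.J_le_cellSpan (hS : S.Good b) {m : ℕ} (hm : m ≤ S.n) (r : ℕ) :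
    S.J m r ≤ S.cellSpan (Dom b) m r :=
  BlobSystem.J_le_cellSpan (dom_zero b) m S hm (fun _ _ _ hD => hS.f_eq_zero hD) r

/-- The hypothesis lets x be replaced by x f, to which the left half of the spanning theorem
applies. Zero strands are separate because that result concerns m + 1 strands. -/
lemma Good.mem_span_u_sup (hS : S.Good b) {r : ℕ} {h : ℤ} (hr : h.natAbs + 2 * r = S.n) {x : A}
    (hx : x * S.f S.n h = x) :
    x ∈ Submodule.span k {y | ∃ p, IsWalk (Dom b) S.n p ∧ p S.n = h ∧ y = S.u p S.n} ⊔
      S.J S.n (r + 1) := by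
  have hxl := hS.mem_level x
  rcases hn : S.n with _ | m
  · rw [hn] at hxl hr
    obtain ⟨a, rfl⟩ := S.level_zero hxl
    refine Submodule.mem_sup_left ?_
    rw [Algebra.algebraMap_eq_smul_one]
    exact Submodule.smul_mem _ _ (Submodule.subset_span
      ⟨fun _ => 0, ⟨rfl, by simp, fun _ _ => dom_zero b, by simp⟩,
        show (0 : ℤ) = h by omega, rfl⟩)
  · rw [hn] at hxl hr hx
    have := S.level_mul_f_mem_leftSpan (D := Dom b) hn.ge hr hS.f_eq_zero
      (hS.J_le_cellSpan (by omega)) hxl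
    rwa [hx] at this

/-- The ideal with r cups lies in the span of the cell elements with at least r cups, and these are
independent of those with fewer. -/
lemma Good.disjoint_span_cell (hS : S.Good b) {s : Set (Cell (Dom b) S.n)} {r : ℕ}
    (hs : ∀ x ∈ s, S.n < (x.1.1 S.n).natAbs + 2 * r) :
    Disjoint (Submodule.span k (S.cell (Dom b) '' s)) (S.J S.n r) := by
  refine (hS.indep.disjoint_span_image (t := {x | (x.1.1 S.n).natAbs + 2 * r ≤ S.n}) ?_).mono_right
    ((hS.J_le_cellSpan le_rfl r).trans (Submodule.span_mono ?_))
  · exact Set.disjoint_left.2 fun x hx hx' => absurd (hs x hx) (not_lt.2 hx')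
  · rintro _ ⟨p, q, hp, hq, hpq, hr, rfl⟩
    exact ⟨⟨(p, q), hp, hq, hpq⟩, hr, rfl⟩

/-- The elements `v w S.n` for walks `w` whose ends have absolute value `S.n - 2 * r` are left
independent modulo `J S.n (r + 1)`. -/
theorem Good.mem_J_of_sum_mem (hS : S.Good b) {r : ℕ} {ι : Type} [Fintype ι] {w : ι → ℕ → ℤ}
    (hw : ∀ i, IsWalk (Dom b) S.n (w i)) (hinj : Function.Injective w)
    (hr : ∀ i, (w i S.n).natAbs + 2 * r = S.n) {x : ι → A}
    (hx : ∀ i, x i * S.f S.n (w i S.n) = x i)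
    (hsum : ∑ i, x i * S.v (w i) S.n ∈ S.J S.n (r + 1)) (i : ι) : x i ∈ S.J S.n (r + 1) := by
  classical
  let W : ι → Type := fun i => {p : ℕ → ℤ // IsWalk (Dom b) S.n p ∧ p S.n = w i S.n}
  have hfin : ∀ i, Finite (W i) := fun i => Set.Finite.to_subtype
    ((finite_isWalk (Dom b) S.n).subset fun p hp => hp.1)
  have := fun i => Fintype.ofFinite (W i)
  have key : ∀ i, ∃ κ : W i → k, x i - ∑ p, κ p • S.u p.1 S.n ∈ S.J S.n (r + 1) := by
    intro i
    obtain ⟨y, hy, j, hj, hyj⟩ := Submodule.mem_sup.1 (hS.mem_span_u_sup (hr i) (hx i))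
    have : {y | ∃ p, IsWalk (Dom b) S.n p ∧ p S.n = w i S.n ∧ y = S.u p S.n} =
        Set.range fun p : W i => S.u p.1 S.n := by
      ext z
      exact ⟨fun ⟨p, h1, h2, h3⟩ => ⟨⟨p, h1, h2⟩, h3.symm⟩, fun ⟨p, hp⟩ => ⟨p.1, p.2.1, p.2.2, hp.symm⟩⟩
    rw [this, Submodule.mem_span_range_iff_exists_fun] at hy
    obtain ⟨κ, rfl⟩ := hy
    exact ⟨κ, by rw [← hyj, add_sub_cancel_left]; exact hj⟩
  choose κ hκ using key
  -- Expanding each `x i` in the elements `u p` modulo the ideal turns the sum into a combination of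
  -- the pairwise distinct cells (p, w i), all with exactly r cups; its coefficients must vanish.
  let c : (Σ i, W i) → Cell (Dom b) S.n := fun z => ⟨(z.2.1, w z.1), z.2.2.1, hw _, z.2.2.2⟩
  have hc : Function.Injective c := by
    rintro ⟨i, p, hp⟩ ⟨j, q, hq⟩ hpq
    have h2 := congrArg (fun z => z.1.2) hpq
    obtain rfl : i = j := hinj h2
    have h1 : p = q := congrArg (fun z => z.1.1) hpq
    subst h1
    rfl
  have hcell : ∑ z : (Σ i, W i), κ z.1 z.2 • S.cell (Dom b) (c z) =
      ∑ i, (∑ p, κ i p • S.u p.1 S.n) * S.v (w i) S.n := by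
    rw [Fintype.sum_sigma]
    refine Finset.sum_congr rfl fun i _ => ?_
    rw [Finset.sum_mul]
    exact Finset.sum_congr rfl fun p _ => (smul_mul_assoc _ _ _).symm
  have hJ : ∑ z : (Σ i, W i), κ z.1 z.2 • S.cell (Dom b) (c z) ∈ S.J S.n (r + 1) := by
    have h1 : ∑ i, (x i - ∑ p, κ i p • S.u p.1 S.n) * S.v (w i) S.n ∈ S.J S.n (r + 1) :=
      sum_mem fun i _ => S.mul_mem_J_right (hS.mem_level _) (hκ i)
    have h2 := sub_mem hsum h1
    rw [← Finset.sum_sub_distrib] at h2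
    rw [hcell]
    convert h2 using 2 with i
    rw [sub_mul, sub_sub_cancel]
  have h0 := (hS.disjoint_span_cell (s := Set.range c) (r := r + 1) (by
    rintro _ ⟨z, rfl⟩
    have h1 := hr z.1
    have h2 : (c z).1.1 S.n = w z.1 S.n := z.2.2.2
    rw [h2]
    omega)).le_bot ⟨sum_mem fun z _ => Submodule.smul_mem _ _
      (Submodule.subset_span ⟨c z, ⟨z, rfl⟩, rfl⟩), hJ⟩
  have hκ0 := Fintype.linearIndependent_iff.1 (hS.indep.comp c hc) (fun z => κ z.1 z.2) h0
  have := hκ i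
  rwa [Finset.sum_eq_zero fun p _ => by rw [hκ0 ⟨i, p⟩, zero_smul], sub_zero] at this

/-- Otherwise u(p) v(p) = u(p) f v(p), for any walk p ending at h, would be a basis element with r
cups inside the ideal with r + 1 cups. -/
lemma Good.f_not_mem_J (hS : S.Good b) {r : ℕ} {h : ℤ} (hr : h.natAbs + 2 * r = S.n)
    (hD : Dom b h) : S.f S.n h ∉ S.J S.n (r + 1) := by
  intro hf
  obtain ⟨p, hp, rfl⟩ := exists_isWalk b hr hD
  let x : Cell (Dom b) S.n := ⟨(p, p), hp, hp, rfl⟩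
  have hx : S.cell (Dom b) x ∈ S.J S.n (r + 1) := by
    change S.u p S.n * S.v p S.n ∈ _
    rw [← S.u_mul_f hp]
    exact S.mul_mem_J_right (hS.mem_level _) (S.mul_mem_J_left (hS.mem_level _) hf)
  refine hS.indep.ne_zero x ((hS.disjoint_span_cell (s := {x}) (r := r + 1) ?_).le_bot
    ⟨Submodule.subset_span ⟨x, rfl, rfl⟩, hx⟩)
  rintro _ rfl
  change S.n < (p S.n).natAbs + _
  omega

/-- The left ideal `J S.n r`. -/
def Good.idl (hS : S.Good b) (r : ℕ) : Submodule A A where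
  carrier := S.J S.n r
  add_mem' := add_mem
  zero_mem' := zero_mem _
  smul_mem' a _ hx := S.mul_mem_J_left (hS.mem_level a) hx

lemma Good.mem_idl {hS : S.Good b} {r : ℕ} {x : A} : x ∈ hS.idl r ↔ x ∈ S.J S.n r := Iff.rfl

lemma Good.isArtinian (hS : S.Good b) : IsArtinianRing A := by
  have : Module.Finite k A := by
    refine ⟨(Set.finite_range (S.cell (Dom b))).toFinset, ?_⟩
    rw [Set.Finite.coe_toFinset]
    exact top_le_iff.1 (S.top_le_span_cell (dom_zero b) (fun _ _ _ hD => hS.f_eq_zero hD) hS.top)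
  exact IsArtinianRing.of_finite k A

end BlobSystem

/-! ## Projective covers and standard modules -/

/-- Over an Artinian ring simple modules have projective covers. -/
theorem exists_isProjectiveCover {A : Type u} [Ring A] [IsArtinianRing A] (L : ModuleCat.{u} A)
    [IsSimpleModule A L] : ∃ (P : ModuleCat.{u} A) (f : P →ₗ[A] L), IsProjectiveCover f := by
  have : Nontrivial L := IsSimpleModule.nontrivial A L
  obtain ⟨y, hy⟩ := exists_ne (0 : L)
  let T : Set (Submodule A A) :=
    {Q | Module.Projective A Q ∧ ∃ f : Q →ₗ[A] L, Function.Surjective f}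
  have hT : (⊤ : Submodule A A) ∈ T :=
    ⟨Module.Projective.of_equiv (Submodule.topEquiv (R := A) (M := A)).symm,
      (LinearMap.toSpanSingleton A L y) ∘ₗ (Submodule.topEquiv (R := A) (M := A)).toLinearMap,
      (IsSimpleModule.toSpanSingleton_surjective A hy).comp
        (Submodule.topEquiv (R := A) (M := A)).surjective⟩
  -- A minimal left ideal among the projective ones mapping onto L. If N + ker f = Q, then f lifts
  -- to an endomorphism φ of Q with image in N and f φ = f; Fitting's lemma splits off the image of
  -- a power of φ, and minimality makes this image all of Q.
  obtain ⟨Q, ⟨hQ, f, hf⟩, hmin⟩ := wellFounded_lt.has_min T ⟨_, hT⟩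
  refine ⟨ModuleCat.of A Q, f, hQ, hf, fun N hN => ?_⟩
  have hNf : Function.Surjective (f ∘ₗ N.subtype) := by
    intro z
    obtain ⟨q, rfl⟩ := hf z
    obtain ⟨x, hx, y, hy, rfl⟩ := Submodule.mem_sup.1 (hN.symm ▸ Submodule.mem_top (x := q))
    exact ⟨⟨x, hx⟩, by rw [map_add, LinearMap.mem_ker.1 hy, add_zero]; rfl⟩
  obtain ⟨h, hh⟩ := Module.projective_lifting_property (f ∘ₗ N.subtype) f hNf
  let φ : Module.End A Q := N.subtype ∘ₗ h
  have hφ : ∀ x, f (φ x) = f x := fun x => LinearMap.congr_fun hh x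
  have hφm : ∀ m x, f ((φ ^ m) x) = f x := by
    intro m
    induction m with
    | zero => intro x; rfl
    | succ m ih => intro x; rw [pow_succ', Module.End.mul_apply, hφ, ih]
  obtain ⟨m, hm⟩ := Filter.eventually_atTop.1 (φ.eventually_isCompl_ker_pow_range_pow)
  -- The exponent is positive so that at least one factor φ places the image in N.
  have hc := hm (m + 1) (by omega)
  have hrN : LinearMap.range (φ ^ (m + 1)) ≤ N := by
    rintro _ ⟨x, rfl⟩
    rw [pow_succ', Module.End.mul_apply]
    exact (h _).2
  let R := LinearMap.range (φ ^ (m + 1))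
  have hR : Module.Projective A R :=
    Module.Projective.of_split R.subtype (R.projectionOnto _ hc.symm) (LinearMap.ext fun x =>
      Submodule.projectionOnto_apply_left hc.symm x)
  let e : R ≃ₗ[A] R.map Q.subtype := Submodule.equivMapOfInjective _ Q.injective_subtype R
  have hRT : R.map Q.subtype ∈ T := by
    refine ⟨Module.Projective.of_equiv e, (f ∘ₗ R.subtype) ∘ₗ e.symm.toLinearMap, ?_⟩
    have hs : Function.Surjective (f ∘ₗ R.subtype) := fun z => by
      obtain ⟨q, rfl⟩ := hf z
      exact ⟨⟨(φ ^ (m + 1)) q, LinearMap.mem_range_self _ q⟩, hφm (m + 1) q⟩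
    exact hs.comp e.symm.surjective
  have hle : R.map Q.subtype ≤ Q := Submodule.map_subtype_le Q R
  have heq : R.map Q.subtype = Q := by
    by_contra hne
    exact hmin _ hRT (lt_of_le_of_ne hle hne)
  refine eq_top_iff.2 fun x _ => hrN ?_
  have hx : (x : A) ∈ R.map Q.subtype := heq.symm ▸ x.2
  obtain ⟨y, hy, hyx⟩ := hx
  rwa [← Subtype.ext hyx]

lemma exists_isScalarTower (k A M : Type*) [CommRing k] [Ring A] [Algebra k A] [AddCommGroup M]
    [Module A M] : ∃ _ : Module k M, IsScalarTower k A M := by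
  let _ : Module k M := Module.compHom M (algebraMap k A)
  exact ⟨inferInstance, ⟨fun a y m => by rw [Algebra.smul_def, mul_smul]; rfl⟩⟩

/-! ### Simple modules and annihilation conditions -/

namespace BlobSystem

variable {k : Type u} [Field k] {A : Type u} [Ring A] [Algebra k A] (S : BlobSystem k A) {b : Prop}

/-- `M` is the simple module of weight `l`. -/
def IsL (l : ℤ) (M : ModuleCat.{u} A) : Prop :=
  IsSimpleModule A M ∧ ∃ r, S.n = l.natAbs + 2 * r ∧
    (∃ x : M, S.c S.n r • x ≠ 0) ∧ (∀ x : M, S.c S.n (r + 1) • x = 0) ∧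
    (0 < l → ∀ x : M, (S.e * S.c S.n r) • x = (S.δ • S.c S.n r) • x) ∧
    (l < 0 → ∀ x : M, (S.e * S.c S.n r) • x = 0)

/-- `M` is killed by the elements which act as zero on all simple modules of weights
up to `l = ±(S.n - 2 * r)`. -/
def Killed (l : ℤ) (r : ℕ) (M : Type*) [AddCommGroup M] [Module A M] : Prop :=
  (∀ x : M, S.c S.n (r + 1) • x = 0) ∧ (l ≠ 0 → ∀ x : M, S.f S.n (-l) • x = 0)

variable {S} {l : ℤ} {r : ℕ} {M N : Type*} [AddCommGroup M] [Module A M]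
  [AddCommGroup N] [Module A N]

lemma Killed.of_surjective (h : S.Killed l r M) (φ : M →ₗ[A] N) (hφ : Function.Surjective φ) :
    S.Killed l r N := by
  refine ⟨fun x => ?_, fun hl x => ?_⟩
  · obtain ⟨y, rfl⟩ := hφ x
    rw [← map_smul, h.1, map_zero]
  · obtain ⟨y, rfl⟩ := hφ x
    rw [← map_smul, h.2 hl, map_zero]

lemma Killed.of_injective (h : S.Killed l r N) (φ : M →ₗ[A] N) (hφ : Function.Injective φ) :
    S.Killed l r M := by
  refine ⟨fun x => hφ ?_, fun hl x => hφ ?_⟩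
  · rw [map_smul, h.1, map_zero]
  · rw [map_smul, h.2 hl, map_zero]

lemma c_smul_eq_zero_of_le {r s : ℕ} (hrs : r ≤ s) (h : ∀ x : M, S.c S.n r • x = 0) (x : M) :
    S.c S.n s • x = 0 := by
  induction s, hrs using Nat.le_induction generalizing x with
  | base => exact h x
  | succ s _ ih => rw [c_succ', mul_smul, ih]

lemma J_smul_eq_zero {r : ℕ} (h : ∀ x : M, S.c S.n r • x = 0) {j : A}
    (hj : j ∈ S.J S.n r) (x : M) : j • x = 0 := by
  refine mul_span_mul_induction (p := fun z => z • x = 0) (fun a _ b _ => ?_)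
    (fun y z hy hz => by rw [add_smul, hy, hz, add_zero]) hj
  rw [mul_smul, mul_smul, h, smul_zero]

/-- The prescribed action of `e` on the image of `c` says that the idempotent of the opposite weight
acts by zero. -/
lemma IsL.killed {M : ModuleCat.{u} A} (h : S.IsL l M) (hr : l.natAbs + 2 * r = S.n) :
    S.Killed l r M := by
  obtain ⟨_, _⟩ := exists_isScalarTower k A M
  obtain ⟨-, r', hr', -, h1, h2, h3⟩ := h
  obtain rfl : r' = r := by omega
  refine ⟨h1, fun hl x => ?_⟩
  rw [S.f_eq' (r := r') (by omega), smul_assoc, s]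
  split_ifs with h4 h5
  · rw [smul_mul_assoc, smul_assoc, h3 (by omega), smul_zero, smul_zero]
  · rw [sub_mul, one_mul, sub_smul, smul_mul_assoc, smul_assoc, h2 (by omega), smul_assoc,
      ← smul_assoc S.δ', smul_eq_mul, S.δ'_mul, one_smul, sub_self, smul_zero]
  · omega

/-- Up to a power of d, `c` is f(l) + f(-l), and the second summand acts by zero; in weight 0 it is
a multiple of f(0) outright. -/
lemma c_smul_eq_f_smul [Module k M] [IsScalarTower k A M] (h : S.Killed l r M)
    (hr : l.natAbs + 2 * r = S.n) (x : M) :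
    S.c S.n r • x = S.d ^ r • S.f S.n l • x := by
  by_cases hl : l = 0
  · subst hl
    rw [S.f_zero_right (r := r) (by simpa using hr), smul_assoc, ← smul_assoc (S.d ^ r), smul_eq_mul,
      ← mul_pow, S.d_mul, one_pow, one_smul]
  · have h1 := S.f_add_f_neg hr hl
    have h2 : (S.f S.n l + S.f S.n (-l)) • x = S.f S.n l • x := by
      rw [add_smul, h.2 hl, add_zero]
    rw [← h2, h1, smul_assoc, ← smul_assoc (S.d ^ r), smul_eq_mul,
      ← mul_pow, S.d_mul, one_pow, one_smul]

lemma IsL.exists_f_smul_ne_zero {M : ModuleCat.{u} A} (h : S.IsL l M)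
    (hr : l.natAbs + 2 * r = S.n) : ∃ x : M, S.f S.n l • x ≠ 0 := by
  have hk := h.killed hr
  obtain ⟨-, r', hr', ⟨x, hx⟩, -⟩ := h
  obtain rfl : r' = r := by omega
  obtain ⟨_, _⟩ := exists_isScalarTower k A M
  refine ⟨x, fun h0 => hx ?_⟩
  rw [c_smul_eq_f_smul hk hr, h0, smul_zero]

lemma isL_of {M : ModuleCat.{u} A} (hM : IsSimpleModule A M) (hr : l.natAbs + 2 * r = S.n)
    (hk : S.Killed l r M) {x : M} (hx : S.f S.n l • x ≠ 0) : S.IsL l M := by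
  obtain ⟨_, _⟩ := exists_isScalarTower k A M
  have he : ∀ y : M, (S.e * S.c S.n r) • y = S.d ^ r • (S.e * (S.s l * S.f S.n l)) • y := by
    intro y
    rw [S.s_mul_f hr, mul_smul, c_smul_eq_f_smul hk hr, mul_smul, smul_comm]
  refine ⟨hM, r, hr.symm, ⟨x, fun h0 => hx ?_⟩, hk.1, fun hl y => ?_, fun hl y => ?_⟩
  · rw [S.f_eq' hr, smul_assoc, mul_smul, h0, smul_zero,
      smul_zero]
  · rw [he, ← mul_assoc, S.e_mul_s_of_pos hl, smul_mul_assoc, S.s_mul_f hr, smul_assoc, smul_assoc,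
      c_smul_eq_f_smul hk hr, smul_comm]
  · rw [he, ← mul_assoc, S.e_mul_s_of_neg hl, zero_mul, zero_smul, smul_zero]

end BlobSystem

namespace BlobSystem

variable {k : Type u} [Field k] {A : Type u} [Ring A] [Algebra k A] {S : BlobSystem k A} {b : Prop}
  {l : ℤ} {r : ℕ}

/-- Let s be the largest number of cups acting nontrivially. If s = r, the weight is l by the
annihilation condition. If s < r, one of the two idempotents with s cups, say f(μ), acts
nontrivially; since f(-μ) A f(μ) lies in the next ideal, which acts by zero, f(-μ) kills the simple
module, and the weight is μ. -/
lemma Good.exists_isL (hS : S.Good b) {M : ModuleCat.{u} A} [IsSimpleModule A M]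
    (hr : l.natAbs + 2 * r = S.n) (hk : S.Killed l r M) :
    ∃ m : ℤ, (m = l ∨ l.natAbs < m.natAbs) ∧ S.IsL m M := by
  classical
  have : Nontrivial M := IsSimpleModule.nontrivial A M
  obtain ⟨_, _⟩ := exists_isScalarTower k A M
  have hex : ∃ t, ∀ x : M, S.c S.n t • x = 0 := ⟨r + 1, hk.1⟩
  obtain ⟨s, hs⟩ : ∃ s, Nat.find hex = s + 1 := by
    refine Nat.exists_eq_succ_of_ne_zero fun h0 => ?_
    obtain ⟨x, hx⟩ := exists_ne (0 : M)
    have := Nat.find_spec hex x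
    rw [h0, c_zero, one_smul] at this
    exact hx this
  have hs1 : ∀ x : M, S.c S.n (s + 1) • x = 0 := hs ▸ Nat.find_spec hex
  have hsr : s ≤ r := by
    have := Nat.find_min' hex hk.1
    omega
  obtain ⟨x, hx⟩ : ∃ x : M, S.c S.n s • x ≠ 0 := by
    have := Nat.find_min hex (m := s) (by omega)
    push Not at this
    exact this
  rcases hsr.eq_or_lt with rfl | hlt
  · refine ⟨l, Or.inl rfl, isL_of inferInstance hr hk (x := x) fun h0 => hx ?_⟩
    rw [c_smul_eq_f_smul hk hr, h0, smul_zero]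
  · have key : ∀ μ : ℤ, μ.natAbs + 2 * s = S.n → S.f S.n μ • x ≠ 0 → S.IsL μ M := by
      intro μ hμ hfx
      refine isL_of inferInstance hμ ⟨hs1, fun h0 y => ?_⟩ hfx
      obtain ⟨a, rfl⟩ := IsSimpleModule.toSpanSingleton_surjective A hfx y
      rw [LinearMap.toSpanSingleton_apply, ← mul_smul, ← mul_smul]
      exact J_smul_eq_zero hs1 (S.f_neg_mul_level_mul_f le_rfl hμ h0 (hS.mem_level a)) x
    -- This integer is n - 2s, positive because s < r.
    have hμ : ((l.natAbs + 2 * (r - s) : ℕ) : ℤ).natAbs + 2 * s = S.n := by omega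
    have h1 := S.f_add_f_neg hμ (by omega)
    by_cases h2 : S.f S.n ((l.natAbs + 2 * (r - s) : ℕ) : ℤ) • x = 0
    · refine ⟨-((l.natAbs + 2 * (r - s) : ℕ) : ℤ), Or.inr (by omega), key _ (by omega) ?_⟩
      intro h3
      refine hx ?_
      have h4 := congrArg (· • x) h1
      simp only [add_smul] at h4
      rw [h2, h3, add_zero, smul_assoc] at h4
      rw [← one_smul k (S.c S.n s • x), ← one_pow s, ← S.d_mul, mul_pow, mul_smul, ← h4, smul_zero]
    · exact ⟨_, Or.inr (by omega), key _ hμ h2⟩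

/-- A cyclic module is finitely generated, so it has a maximal submodule if it is nonzero. -/
lemma exists_covBy_of_smul_ne_zero {M : Type*} [AddCommGroup M] [Module A M] {x : M} (hx : x ≠ 0) :
    ∃ N : Submodule A M, N ⋖ Submodule.span A {x} := by
  have hfin : Module.Finite A (Submodule.span A {x}) := inferInstance
  have : Nontrivial (Submodule.span A {x}) :=
    ⟨⟨⟨x, Submodule.mem_span_singleton_self x⟩, 0, fun h => hx (congrArg Subtype.val h)⟩⟩
  obtain ⟨N, hN, -⟩ := (eq_top_or_exists_le_coatom (⊥ : Submodule A (Submodule.span A {x}))).resolve_left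
    bot_ne_top
  refine ⟨N.map (Submodule.span A {x}).subtype, ?_⟩
  rw [covBy_iff_quot_is_simple (Submodule.map_subtype_le _ N)]
  change IsSimpleModule A (_ ⧸ (N.map (Submodule.span A {x}).subtype).comap _)
  rw [Submodule.comap_map_eq_of_injective (Submodule.injective_subtype _)]
  exact isSimpleModule_iff_isCoatom.2 hN

/-- The elements involved satisfy f² = κ f with κ nonzero. If f x were nonzero, the simple quotient
of A f x would not be killed by f, because f (f x) = κ f x generates it; so if all simple
subquotients are killed, the module is. Conversely the annihilation passes to subquotients, and
`Good.exists_isL` identifies the simple ones. No composition series is needed. -/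
theorem Good.allFactors_iff (hS : S.Good b) (hr : l.natAbs + 2 * r = S.n) (M : ModuleCat.{u} A) :
    AllFactors (fun T => ∃ m, (m = l ∨ l.natAbs < m.natAbs) ∧ S.IsL m T) M ↔ S.Killed l r M := by
  constructor
  · intro h
    have key : ∀ (f : A) (κ : k), κ ≠ 0 → f * f = κ • f →
        (∀ T : ModuleCat.{u} A, (∃ m, (m = l ∨ l.natAbs < m.natAbs) ∧ S.IsL m T) →
          ∀ y : T, f • y = 0) → ∀ x : M, f • x = 0 := by
      intro f κ hκ hf hT x
      by_contra hx
      obtain ⟨N, hN⟩ := exists_covBy_of_smul_ne_zero (A := A) hx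
      have h1 := hT _ (h _ _ hN) (Submodule.Quotient.mk
        ⟨f • x, Submodule.mem_span_singleton_self _⟩)
      have h2 : f • f • x ∈ N := (Submodule.Quotient.mk_eq_zero (N.submoduleOf _)).1 h1
      obtain ⟨_, _⟩ := exists_isScalarTower k A M
      rw [← mul_smul, hf, smul_assoc] at h2
      have h3 := N.smul_mem (algebraMap k A κ⁻¹) h2
      rw [algebraMap_smul, ← mul_smul, inv_mul_cancel₀ hκ, one_smul] at h3
      exact hN.lt.not_ge ((Submodule.span_singleton_le_iff_mem _ _).2 h3)
    have hd : S.d ^ (r + 1) ≠ 0 := pow_ne_zero _ (left_ne_zero_of_mul_eq_one S.d_mul)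
    have hT1 : ∀ T : ModuleCat.{u} A, ∀ m, l.natAbs ≤ m.natAbs → S.IsL m T →
        ∃ s ≤ r, m.natAbs + 2 * s = S.n ∧ ∀ y : T, S.c S.n (s + 1) • y = 0 := by
      rintro T m hm ⟨-, s, hs, -, hc, -⟩
      exact ⟨s, by omega, hs.symm, hc⟩
    refine ⟨key _ _ hd (S.c_sq _ _) ?_, fun hl => key _ 1 one_ne_zero ?_ ?_⟩
    · rintro T ⟨m, hm, hL⟩
      obtain ⟨s, hs, -, hc⟩ := hT1 T m (by omega) hL
      exact c_smul_eq_zero_of_le (by omega) hc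
    · rw [S.f_sq (r := r) (by omega), one_smul]
    · rintro T ⟨m, rfl | hm, hL⟩ y
      · exact (hL.killed hr).2 hl y
      · obtain ⟨_, _⟩ := exists_isScalarTower k A T
        obtain ⟨s, hs, hms, hc⟩ := hT1 T m hm.le hL
        rw [S.f_eq' (r := r) (by omega), smul_assoc, mul_smul,
          c_smul_eq_zero_of_le (r := s + 1) (by omega) hc, smul_zero, smul_zero]
  · intro hk N₁ N₂ h
    have : IsSimpleModule A (N₂ ⧸ N₁.submoduleOf N₂) := (covBy_iff_quot_is_simple h.le).1 h
    exact hS.exists_isL hr ((hk.of_injective N₂.subtype N₂.injective_subtype).of_surjective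
      (Submodule.mkQ _) (Submodule.mkQ_surjective _))

/-! ### Cell modules are the standard modules -/

variable (S) in
/-- `D` is the standard module of weight `l`. -/
def IsStd (l : ℤ) (D : ModuleCat.{u} A) : Prop :=
  IsStandard S.IsL (fun m l => m = l ∨ l.natAbs < m.natAbs) l D

/-- The kernel of the projection from the regular module to the cell module of weight `l`. -/
def Good.deltaKer (hS : S.Good b) (l : ℤ) (r : ℕ) : Submodule A A :=
  (hS.idl (r + 1)).comap (LinearMap.toSpanSingleton A A (S.f S.n l))

lemma Good.mem_deltaKer {hS : S.Good b} {x : A} :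
    x ∈ hS.deltaKer l r ↔ x * S.f S.n l ∈ S.J S.n (r + 1) := Iff.rfl

/-- The cell module of weight `l`. -/
abbrev Good.Delta (hS : S.Good b) (l : ℤ) (r : ℕ) : Type u := A ⧸ hS.deltaKer l r

/-- The generator of the cell module. -/
def Good.gen (hS : S.Good b) (l : ℤ) (r : ℕ) : hS.Delta l r := Submodule.Quotient.mk 1

lemma Good.smul_gen {hS : S.Good b} (x : A) :
    x • hS.gen l r = Submodule.Quotient.mk x := by
  rw [Good.gen, ← Submodule.Quotient.mk_smul, smul_eq_mul, mul_one]

lemma Good.smul_gen_eq_zero_iff {hS : S.Good b} {x : A} :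
    x • hS.gen l r = 0 ↔ x * S.f S.n l ∈ S.J S.n (r + 1) := by
  rw [Good.smul_gen, Submodule.Quotient.mk_eq_zero, Good.mem_deltaKer]

lemma Good.exists_smul_gen {hS : S.Good b} (y : hS.Delta l r) : ∃ x : A, y = x • hS.gen l r := by
  obtain ⟨x, rfl⟩ := Submodule.Quotient.mk_surjective _ y
  exact ⟨x, (Good.smul_gen x).symm⟩

lemma Good.f_smul_gen {hS : S.Good b} (hr : l.natAbs + 2 * r = S.n) :
    S.f S.n l • hS.gen l r = hS.gen l r := by
  rw [← sub_eq_zero, ← one_smul A (hS.gen l r), ← mul_smul, ← sub_smul,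
    Good.smul_gen_eq_zero_iff, mul_one, sub_mul, S.f_sq hr, one_mul, sub_self]
  exact zero_mem _

lemma Good.killed_delta (hS : S.Good b) (hr : l.natAbs + 2 * r = S.n) :
    S.Killed l r (hS.Delta l r) := by
  refine ⟨fun y => ?_, fun hl y => ?_⟩
  · obtain ⟨x, rfl⟩ := Good.exists_smul_gen y
    rw [← mul_smul, Good.smul_gen_eq_zero_iff]
    exact S.mul_mem_J_right (hS.mem_level _) (S.mul_mem_J_right (hS.mem_level _) (S.c_mem_J _ _))
  · obtain ⟨x, rfl⟩ := Good.exists_smul_gen y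
    rw [← mul_smul, Good.smul_gen_eq_zero_iff]
    exact S.f_neg_mul_level_mul_f le_rfl hr hl (hS.mem_level x)

lemma Good.gen_ne_zero {hS : S.Good b} (hr : l.natAbs + 2 * r = S.n) (hD : Dom b l) :
    hS.gen l r ≠ 0 := by
  rw [← one_smul A (hS.gen l r), Ne, Good.smul_gen_eq_zero_iff, one_mul]
  exact hS.f_not_mem_J hr hD

/-- The map from the cell module given by an element fixed by the idempotent. -/
def Good.deltaLift {hS : S.Good b} {M : Type*} [AddCommGroup M] [Module A M]
    (x : M) (hx : S.f S.n l • x = x) (hc : ∀ y : M, S.c S.n (r + 1) • y = 0) :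
    hS.Delta l r →ₗ[A] M :=
  Submodule.liftQ _ (LinearMap.toSpanSingleton A M x) fun a ha => by
    rw [LinearMap.mem_ker, LinearMap.toSpanSingleton_apply, ← hx, ← mul_smul]
    exact J_smul_eq_zero hc (Good.mem_deltaKer.1 ha) x

lemma Good.deltaLift_smul_gen {hS : S.Good b} {M : Type*} [AddCommGroup M] [Module A M]
    {x : M} (hx : S.f S.n l • x = x) (hc : ∀ y : M, S.c S.n (r + 1) • y = 0) (a : A) :
    Good.deltaLift (hS := hS) x hx hc (a • hS.gen l r) = a • x := by
  rw [Good.smul_gen]; rfl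

/-- The submodule which has to be divided out to satisfy `Killed`. -/
def killing (S : BlobSystem k A) (l : ℤ) (r : ℕ) (M : Type*) [AddCommGroup M] [Module A M] :
    Submodule A M :=
  Submodule.span A {y | ∃ x : M, y = S.c S.n (r + 1) • x ∨ (l ≠ 0 ∧ y = S.f S.n (-l) • x)}

lemma killed_quotient {M : Type*} [AddCommGroup M] [Module A M] :
    S.Killed l r (M ⧸ S.killing l r M) := by
  refine ⟨fun y => ?_, fun hl y => ?_⟩
  · obtain ⟨x, rfl⟩ := Submodule.Quotient.mk_surjective _ y
    exact (Submodule.Quotient.mk_eq_zero _).2 (Submodule.subset_span ⟨x, Or.inl rfl⟩)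
  · obtain ⟨x, rfl⟩ := Submodule.Quotient.mk_surjective _ y
    exact (Submodule.Quotient.mk_eq_zero _).2 (Submodule.subset_span ⟨x, Or.inr ⟨hl, rfl⟩⟩)

lemma killing_le_ker {M N : Type*} [AddCommGroup M] [Module A M] [AddCommGroup N] [Module A N]
    (hk : S.Killed l r N) (φ : M →ₗ[A] N) : S.killing l r M ≤ LinearMap.ker φ := by
  refine Submodule.span_le.2 ?_
  rintro _ ⟨x, rfl | ⟨hl, rfl⟩⟩
  · exact LinearMap.mem_ker.2 (by rw [map_smul, hk.1])
  · exact LinearMap.mem_ker.2 (by rw [map_smul, hk.2 hl])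

/-- Standard modules exist. -/
theorem Good.exists_isStd (hS : S.Good b) (hr : l.natAbs + 2 * r = S.n) (hD : Dom b l) :
    ∃ D, S.IsStd l D := by
  have := hS.isArtinian
  have hne := Good.gen_ne_zero (hS := hS) hr hD
  have : Nontrivial (hS.Delta l r) := ⟨_, _, hne⟩
  obtain ⟨N, hN, -⟩ := (eq_top_or_exists_le_coatom (⊥ : Submodule A (hS.Delta l r))).resolve_left
    bot_ne_top
  let L := ModuleCat.of A (hS.Delta l r ⧸ N)
  have hsimple : IsSimpleModule A L := isSimpleModule_iff_isCoatom.2 hN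
  have hL : S.IsL l L := by
    refine isL_of hsimple hr ((hS.killed_delta hr).of_surjective N.mkQ N.mkQ_surjective)
      (x := N.mkQ (hS.gen l r)) fun h0 => hN.1 ?_
    rw [← map_smul, Good.f_smul_gen hr, Submodule.mkQ_apply, Submodule.Quotient.mk_eq_zero] at h0
    refine eq_top_iff.2 fun y _ => ?_
    obtain ⟨x, rfl⟩ := Good.exists_smul_gen y
    exact N.smul_mem x h0
  obtain ⟨P, f, hf⟩ := exists_isProjectiveCover L
  refine ⟨ModuleCat.of A (P ⧸ S.killing l r P), L, P, f, (S.killing l r P).mkQ, hL, hf,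
    Submodule.mkQ_surjective _, (hS.allFactors_iff hr _).2 killed_quotient, fun N hN => ?_⟩
  rw [Submodule.ker_mkQ, ← Submodule.ker_mkQ N]
  exact killing_le_ker ((hS.allFactors_iff hr _).1 hN) _

/-- A standard module is isomorphic to the cell module. -/
theorem Good.nonempty_equiv (hS : S.Good b) (hr : l.natAbs + 2 * r = S.n)
    {D : ModuleCat.{u} A} (h : S.IsStd l D) : Nonempty (hS.Delta l r ≃ₗ[A] D) := by
  obtain ⟨L, P, f, g, hL, ⟨hP, hf, hsup⟩, hg, hgD, hmax⟩ := h
  have hkD := (hS.allFactors_iff hr _).1 hgD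
  have hsimple := hL.1
  obtain ⟨x, hx⟩ := hL.exists_f_smul_ne_zero hr
  obtain ⟨p, rfl⟩ := hf x
  rw [← map_smul] at hx
  -- The idempotent lifts a generator of L to an element of f P; it generates P because the kernel
  -- of the projective cover is superfluous.
  have hspan : Submodule.span A {S.f S.n l • p} = ⊤ := by
    refine hsup _ (eq_top_iff.2 fun y _ => ?_)
    obtain ⟨a, ha⟩ := IsSimpleModule.toSpanSingleton_surjective A hx (f y)
    rw [LinearMap.toSpanSingleton_apply, ← map_smul] at ha
    refine Submodule.mem_sup.2 ⟨_, Submodule.smul_mem _ a (Submodule.mem_span_singleton_self _),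
      y - a • S.f S.n l • p, ?_, add_sub_cancel _ _⟩
    rw [LinearMap.mem_ker, map_sub, ha, sub_self]
  set p0 := S.f S.n l • p with hp0
  have hfp0 : S.f S.n l • p0 = p0 := by rw [hp0, ← mul_smul, S.f_sq hr]
  have hgen : ∀ y : P, ∃ a : A, y = a • p0 := fun y => by
    obtain ⟨a, ha⟩ := Submodule.mem_span_singleton.1 (hspan.symm ▸ Submodule.mem_top (x := y))
    exact ⟨a, ha.symm⟩
  let φ : hS.Delta l r →ₗ[A] D := Good.deltaLift (g p0) (by rw [← map_smul, hfp0]) hkD.1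
  have hφg : ∀ a : A, φ (a • hS.gen l r) = g (a • p0) := fun a =>
    (Good.deltaLift_smul_gen _ _ a).trans (g.map_smul a p0).symm
  have hφ : Function.Surjective φ := by
    intro y
    obtain ⟨q, rfl⟩ := hg y
    obtain ⟨a, rfl⟩ := hgen q
    exact ⟨_, hφg a⟩
  -- Otherwise the standard module would be zero, although L itself is an admissible quotient of P
  -- and must factor through it.
  have hgp0 : g p0 ≠ 0 := by
    intro h0
    have hker : LinearMap.ker g = ⊤ := by
      refine eq_top_iff.2 fun y _ => ?_
      obtain ⟨a, rfl⟩ := hgen y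
      rw [LinearMap.mem_ker, map_smul, h0, smul_zero]
    let ψ := LinearMap.quotKerEquivOfSurjective f hf
    have := hmax (LinearMap.ker f) ((hS.allFactors_iff hr _).2 ((hL.killed hr).of_injective
      ψ.toLinearMap ψ.injective))
    rw [hker] at this
    exact hx (this trivial)
  obtain ⟨h, hh⟩ := Module.projective_lifting_property φ g hφ
  have hφh : ∀ y, φ (h y) = g y := fun y => LinearMap.congr_fun hh y
  have hkerh : LinearMap.ker g ≤ LinearMap.ker h :=
    (hmax _ ((hS.allFactors_iff hr _).2 killed_quotient)).trans
      (killing_le_ker (hS.killed_delta hr) h)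
  obtain ⟨_, _⟩ := exists_isScalarTower k A D
  -- The lift sends `p0` into the part of the cell module fixed by f, which is spanned by the
  -- generator; compatibility with `g` forces the scalar to be 1. Since the lift kills ker g,
  -- injectivity of φ follows.
  have hhp0 : h p0 = hS.gen l r := by
    obtain ⟨a, ha⟩ := Good.exists_smul_gen (h p0)
    obtain ⟨κ, j, hj, hκ⟩ := S.f_mul_level_mul_f le_rfl hr (hS.mem_level a)
    have h1 : h p0 = (algebraMap k A κ) • hS.gen l r := by
      rw [← hfp0, map_smul, ha, ← mul_smul, ← Good.f_smul_gen (hS := hS) hr, ← mul_smul, hκ,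
        add_smul, add_eq_left.2, Algebra.smul_def, mul_smul, Good.f_smul_gen hr]
      rw [Good.smul_gen_eq_zero_iff]
      exact S.mul_mem_J_right (hS.mem_level _) hj
    have h2 : κ • g p0 = g p0 := by
      refine Eq.trans ?_ (hφh p0)
      rw [h1, hφg]
      exact (algebraMap_smul A κ (g p0)).symm.trans (g.map_smul _ _).symm
    have h3 : κ = 1 := by
      rw [← sub_eq_zero]
      refine (smul_eq_zero.1 (?_ : (κ - 1) • g p0 = 0)).resolve_right hgp0
      rw [sub_smul, h2, one_smul, sub_self]
    rw [h1, h3, map_one, one_smul]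
  refine ⟨LinearEquiv.ofBijective φ ⟨?_, hφ⟩⟩
  rw [← LinearMap.ker_eq_bot, eq_bot_iff]
  intro y hy
  obtain ⟨a, rfl⟩ := Good.exists_smul_gen y
  rw [LinearMap.mem_ker, hφg] at hy
  have := hkerh (LinearMap.mem_ker.2 hy)
  rw [LinearMap.mem_ker, map_smul, hhp0] at this
  exact this

end BlobSystem

/-! ## Dimension shifting for left derived functors -/

section Derived

variable {A B : Type u} [Ring A] [Ring B] (F : ModuleCat.{u} B ⥤ ModuleCat.{u} A) [F.Additive]

lemma isZero_leftDerived_iff {X : ModuleCat.{u} B} (P : ProjectiveResolution X) (n : ℕ) :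
    Limits.IsZero ((F.leftDerived (n + 1)).obj X) ↔
      ∀ x : F.obj (P.complex.X (n + 1)), (F.map (P.complex.d (n + 1) n)).hom x = 0 →
        ∃ y : F.obj (P.complex.X (n + 2)), (F.map (P.complex.d (n + 2) (n + 1))).hom y = x := by
  rw [(P.isoLeftDerivedObj F (n + 1)).isZero_iff]
  change Limits.IsZero (((F.mapHomologicalComplex _).obj P.complex).homology (n + 1)) ↔ _
  rw [← HomologicalComplex.exactAt_iff_isZero_homology,
    HomologicalComplex.exactAt_iff' _ (n + 2) (n + 1) n (by simp) (by simp),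
    ShortComplex.moduleCat_exact_iff]
  rfl

/-- The augmentation of a projective resolution. -/
def augmentation {X : ModuleCat.{u} B} (Q : ProjectiveResolution X) : Q.complex.X 0 ⟶ X :=
  Q.π.f 0

lemma d_augmentation {X : ModuleCat.{u} B} (Q : ProjectiveResolution X) :
    Q.complex.d 1 0 ≫ augmentation Q = 0 := Q.complex_d_comp_π_f_zero

lemma exact_augmentation {X : ModuleCat.{u} B} (Q : ProjectiveResolution X) :
    (ShortComplex.mk _ _ (d_augmentation Q)).Exact := Q.exact₀

instance {X : ModuleCat.{u} B} (Q : ProjectiveResolution X) : Epi (augmentation Q) :=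
  inferInstanceAs (Epi (Q.π.f 0))

/-- Splicing a projective resolution of the kernel of a surjection from a projective object. -/
def splice {S : ShortComplex (ModuleCat.{u} B)} (hS : S.ShortExact)
    (hP : Projective S.X₂) (Q : ProjectiveResolution S.X₁) : ProjectiveResolution S.X₃ :=
  have w : Q.complex.d 1 0 ≫ augmentation Q ≫ S.f = 0 := by
    rw [← Category.assoc, d_augmentation, Limits.zero_comp]
  have w' : (ChainComplex.augment Q.complex (augmentation Q ≫ S.f) w).d 1 0 ≫ S.g = 0 := by
    rw [ChainComplex.augment_d_one_zero]
    exact (Category.assoc _ _ _).trans ((congrArg _ S.zero).trans Limits.comp_zero)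
  have hmono := hS.mono_f
  have hepi := hS.epi_g
  { complex := ChainComplex.augment Q.complex (augmentation Q ≫ S.f) w
    projective := fun n => by
      rcases n with _ | n
      · exact hP
      · exact Q.projective n
    π := (ChainComplex.toSingle₀Equiv _ _).symm ⟨S.g, w'⟩
    quasiIso := ⟨fun n => by
      cases n
      · rw [ChainComplex.quasiIsoAt₀_iff, ShortComplex.quasiIso_iff_of_zeros']
        · have h1 : (ShortComplex.mk (augmentation Q ≫ S.f) S.g
              (by rw [Category.assoc, S.zero, Limits.comp_zero])).Exact := by
            rw [ShortComplex.moduleCat_exact_iff]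
            intro x hx
            obtain ⟨y, hy⟩ := (ShortComplex.moduleCat_exact_iff _).1 hS.exact x hx
            obtain ⟨z, hz⟩ := (ModuleCat.epi_iff_surjective (augmentation Q)).1 inferInstance y
            refine ⟨z, ?_⟩
            rw [← hy, ← hz]; rfl
          refine (ShortComplex.exact_and_epi_g_iff_of_iso ?_).2 ⟨h1, hepi⟩
          exact ShortComplex.isoMk (Iso.refl _) (Iso.refl _) (Iso.refl _) rfl rfl
        all_goals rfl
      · rename_i n
        rw [quasiIsoAt_iff_exactAt']
        · rw [HomologicalComplex.exactAt_iff' _ (n + 2) (n + 1) n (by simp) (by simp)]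
          rcases n with _ | n
          · rw [ShortComplex.moduleCat_exact_iff]
            intro x hx
            refine (ShortComplex.moduleCat_exact_iff _).1 (exact_augmentation Q) x ?_
            exact (ModuleCat.mono_iff_injective S.f).1 hmono (hx.trans (map_zero S.f.hom).symm)
          · exact Q.exact_succ n
        · apply ChainComplex.exactAt_succ_single_obj⟩ }

end Derived

/-! ## Acyclic modules -/

section Acyclic

variable {A B : Type u} [Ring A] [Ring B] (F : ModuleCat.{u} B ⥤ ModuleCat.{u} A)
variable {X Y Z : Type u} [AddCommGroup X] [Module B X] [AddCommGroup Y] [Module B Y]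
  [AddCommGroup Z] [Module B Z]

/-- The linear map induced by a functor. -/
def mapHom (f : X →ₗ[B] Y) : F.obj (ModuleCat.of B X) →ₗ[A] F.obj (ModuleCat.of B Y) :=
  (F.map (ModuleCat.ofHom f)).hom

lemma mapHom_comp (g : Y →ₗ[B] Z) (f : X →ₗ[B] Y) :
    mapHom F (g ∘ₗ f) = mapHom F g ∘ₗ mapHom F f := by
  rw [mapHom, ModuleCat.ofHom_comp, F.map_comp]; rfl

lemma mapHom_apply_apply (g : Y →ₗ[B] Z) (f : X →ₗ[B] Y) (h : X →ₗ[B] Z) (hgf : g ∘ₗ f = h)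
    (x : F.obj (ModuleCat.of B X)) : mapHom F g (mapHom F f x) = mapHom F h x := by
  rw [← hgf, mapHom_comp]; rfl

variable [F.Additive]

/-- All higher left derived functors vanish on `X`. -/
def Acyclic (X : Type u) [AddCommGroup X] [Module B X] : Prop :=
  ∀ i, Limits.IsZero ((F.leftDerived (i + 1)).obj (ModuleCat.of B X))

lemma acyclic_of_projective [Module.Projective B X] : Acyclic F X := fun i =>
  have : Projective (ModuleCat.of B X) :=
    (IsProjective.iff_projective (R := B) X).1 inferInstance
  F.isZero_leftDerived_obj_projective_succ i _

lemma Acyclic.retract (h : Acyclic F Y) (s : X →ₗ[B] Y) (p : Y →ₗ[B] X)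
    (hps : p ∘ₗ s = LinearMap.id) : Acyclic F X := by
  intro i
  rw [Limits.IsZero.iff_id_eq_zero, ← (F.leftDerived (i + 1)).map_id, ← ModuleCat.ofHom_id, ← hps,
    ModuleCat.ofHom_comp, Functor.map_comp, (h i).eq_of_tgt ((F.leftDerived (i + 1)).map
    (ModuleCat.ofHom s)) 0, Limits.zero_comp]

variable {F} {f : X →ₗ[B] Y} {g : Y →ₗ[B] Z}

lemma shortExact_of (hf : Function.Injective f) (hg : Function.Surjective g)
    (hfg : Function.Exact f g) : (ShortComplex.mk (ModuleCat.ofHom f) (ModuleCat.ofHom g)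
      (by rw [← ModuleCat.ofHom_comp, hfg.linearMap_comp_eq_zero]; rfl)).ShortExact where
  exact := (ShortComplex.moduleCat_exact_iff _).2 fun y hy => (hfg y).1 hy
  mono_f := (ModuleCat.mono_iff_injective _).2 hf
  epi_g := (ModuleCat.epi_iff_surjective _).2 hg

variable (F) in
lemma mapHom_exact [Limits.PreservesFiniteColimits F] (hf : Function.Injective f)
    (hg : Function.Surjective g) (hfg : Function.Exact f g) {y : F.obj (ModuleCat.of B Y)}
    (hy : mapHom F g y = 0) : ∃ x, mapHom F f x = y :=
  (ShortComplex.moduleCat_exact_iff _).1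
    ((F.preservesFiniteColimits_iff_forall_exact_map_and_epi.1 inferInstance _
      (shortExact_of hf hg hfg)).1) y hy

lemma projective_of [Module.Projective B Y] : Projective (ModuleCat.of B Y) :=
  (IsProjective.iff_projective (R := B) Y).1 inferInstance

/-- The spliced resolution of Z is the resolution of X shifted by one place, so beyond the splice
both sides are the same exactness condition. -/
lemma isZero_leftDerived_succ_iff [Module.Projective B Y] (hf : Function.Injective f)
    (hg : Function.Surjective g) (hfg : Function.Exact f g) (i : ℕ) :
    Limits.IsZero ((F.leftDerived (i + 2)).obj (ModuleCat.of B Z)) ↔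
      Limits.IsZero ((F.leftDerived (i + 1)).obj (ModuleCat.of B X)) := by
  have Q := projectiveResolution (ModuleCat.of B X)
  rw [isZero_leftDerived_iff F Q, isZero_leftDerived_iff F
    (splice (shortExact_of hf hg hfg) projective_of Q) (i + 1)]
  rfl

/-- L_1F(Z) is the kernel of F(X) → F(Y): at the splice the differential factors through the
augmentation of the resolution of X, and right exactness identifies F(X) with the cokernel of the
preceding map. -/
lemma isZero_leftDerived_one_iff [Limits.PreservesFiniteColimits F] [Module.Projective B Y]
    (hf : Function.Injective f) (hg : Function.Surjective g) (hfg : Function.Exact f g) :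
    Limits.IsZero ((F.leftDerived 1).obj (ModuleCat.of B Z)) ↔
      Function.Injective (mapHom F f) := by
  have Q := projectiveResolution (ModuleCat.of B X)
  have hall : Limits.PreservesFiniteColimits F ↔ ∀ S : ShortComplex (ModuleCat.{u} B),
      S.Exact ∧ Epi S.g → (S.map F).Exact ∧ Epi (F.map S.g) :=
    F.preservesFiniteColimits_tfae.out 3 1
  have hQ := hall.1 inferInstance (ShortComplex.mk _ _ (d_augmentation Q)) ⟨exact_augmentation Q, inferInstance⟩
  have hex := (ShortComplex.moduleCat_exact_iff _).1 hQ.1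
  have hsur := (ModuleCat.epi_iff_surjective _).1 hQ.2
  have hcomp : ∀ x, (F.map (augmentation Q ≫ ModuleCat.ofHom f)).hom x =
      mapHom F f ((F.map (augmentation Q)).hom x) := fun x => by
    rw [F.map_comp]; rfl
  have hzero : ∀ x, (F.map (augmentation Q)).hom ((F.map (Q.complex.d 1 0)).hom x) = 0 := fun x => by
    rw [← LinearMap.comp_apply, ← ModuleCat.hom_comp, ← F.map_comp, d_augmentation, F.map_zero]; rfl
  rw [isZero_leftDerived_iff F (splice (shortExact_of hf hg hfg) projective_of Q) 0]
  change (∀ x : F.obj (Q.complex.X 0), (F.map (augmentation Q ≫ ModuleCat.ofHom f)).hom x = 0 →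
    ∃ y : F.obj (Q.complex.X 1), (F.map (Q.complex.d 1 0)).hom y = x) ↔ _
  constructor
  · intro h
    rw [injective_iff_map_eq_zero]
    intro x hx
    obtain ⟨y, rfl⟩ := hsur x
    obtain ⟨z, rfl⟩ := h y ((hcomp y).trans hx)
    exact hzero z
  · intro h x hx
    rw [hcomp] at hx
    exact hex x (h (hx.trans (map_zero _).symm))

variable (B) in
lemma exists_projective_cover (X : Type u) [AddCommGroup X] [Module B X] :
    ∃ p : (X →₀ B) →ₗ[B] X, Function.Surjective p :=
  ⟨Finsupp.linearCombination B id, fun x => ⟨Finsupp.single x 1, by simp⟩⟩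

variable [Limits.PreservesFiniteColimits F]

lemma acyclic_iff_ker [Module.Projective B Y] (hg : Function.Surjective g) :
    Acyclic F Z ↔ Acyclic F (LinearMap.ker g) ∧
      Function.Injective (mapHom F (LinearMap.ker g).subtype) := by
  have hf := (LinearMap.ker g).injective_subtype
  have hfg : Function.Exact (LinearMap.ker g).subtype g := LinearMap.exact_subtype_ker_map g
  constructor
  · exact fun h => ⟨fun i => (isZero_leftDerived_succ_iff hf hg hfg i).1 (h (i + 1)),
      (isZero_leftDerived_one_iff hf hg hfg).1 (h 0)⟩
  · rintro ⟨h1, h2⟩ (_ | i)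
    · exact (isZero_leftDerived_one_iff hf hg hfg).2 h2
    · exact (isZero_leftDerived_succ_iff hf hg hfg i).2 (h1 i)

/-- The degree-zero part of the horseshoe lemma: lifting `q` through `g` produces a surjection from
P × Q, and its kernel is an extension of ker q by ker p. -/
lemma exists_horseshoe (hf : Function.Injective f) (hg : Function.Surjective g)
    (hfg : Function.Exact f g) {P Q : Type u} [AddCommGroup P] [Module B P] [AddCommGroup Q]
    [Module B Q] [Module.Projective B Q] {p : P →ₗ[B] X} {q : Q →ₗ[B] Z}
    (hp : Function.Surjective p) (hq : Function.Surjective q) :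
    ∃ (π : P × Q →ₗ[B] Y) (i : LinearMap.ker p →ₗ[B] LinearMap.ker π)
      (j : LinearMap.ker π →ₗ[B] LinearMap.ker q), Function.Surjective π ∧
      Function.Injective i ∧ Function.Surjective j ∧ Function.Exact i j ∧
      (∀ x, ((i x : P × Q)) = (x.1, 0)) ∧ ∀ x, (j x : Q) = x.1.2 := by
  obtain ⟨s, hs⟩ := Module.projective_lifting_property g q hg
  have hs' : ∀ x, g (s x) = q x := fun x => LinearMap.congr_fun hs x
  have hgf : ∀ x, g (f x) = 0 := fun x => (hfg _).2 ⟨x, rfl⟩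
  let π : P × Q →ₗ[B] Y := (f ∘ₗ p).coprod s
  have hπ : ∀ a b, π (a, b) = f (p a) + s b := fun a b => rfl
  let i : LinearMap.ker p →ₗ[B] LinearMap.ker π :=
    ((LinearMap.inl B P Q) ∘ₗ (LinearMap.ker p).subtype).codRestrict _ fun x => by
      have hx : p x = 0 := x.2
      rw [LinearMap.mem_ker]
      change f (p x) + s 0 = 0
      rw [hx, map_zero, map_zero, add_zero]
  let j : LinearMap.ker π →ₗ[B] LinearMap.ker q :=
    ((LinearMap.snd B P Q) ∘ₗ (LinearMap.ker π).subtype).codRestrict _ fun x => by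
      have hx : f (p x.1.1) + s x.1.2 = 0 := x.2
      rw [LinearMap.mem_ker]
      change q x.1.2 = 0
      have := congrArg g hx
      rwa [map_add, hgf, zero_add, map_zero, hs'] at this
  have hi : ∀ x, ((i x : P × Q)) = (x.1, 0) := fun x => rfl
  have hj : ∀ x, (j x : Q) = x.1.2 := fun x => rfl
  refine ⟨π, i, j, fun y => ?_, fun x x' h => ?_, fun x => ?_, fun x => ⟨fun h => ?_, ?_⟩, hi, hj⟩
  · obtain ⟨b, hb⟩ := hq (g y)
    obtain ⟨a', ha'⟩ := (hfg (y - s b)).1 (by rw [map_sub, hs', hb, sub_self])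
    obtain ⟨a, rfl⟩ := hp a'
    exact ⟨(a, b), by rw [hπ, ha', sub_add_cancel]⟩
  · have := congrArg (fun z => z.1.1) h
    exact Subtype.ext this
  · have hx : q x = 0 := x.2
    obtain ⟨a', ha'⟩ := (hfg (s x)).1 (by rw [hs', hx])
    obtain ⟨a, rfl⟩ := hp a'
    exact ⟨⟨(-a, x), by rw [LinearMap.mem_ker, hπ, map_neg, map_neg, ha', neg_add_cancel]⟩, rfl⟩
  · have h2 : x.1.2 = 0 := congrArg Subtype.val h
    have hx : f (p x.1.1) + s x.1.2 = 0 := x.2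
    rw [h2, map_zero, add_zero] at hx
    refine ⟨⟨x.1.1, hf (hx.trans (map_zero f).symm)⟩, Subtype.ext ?_⟩
    rw [hi]
    exact Prod.ext rfl h2.symm
  · rintro ⟨y, rfl⟩
    exact Subtype.ext rfl

/-- A diagram chase using exactness only at F(Y). Injectivity is asked of the composite through Y',
not of the first vertical map alone, because F need not preserve the injectivity of f'. -/
lemma injective_of_extension {X' Y' Z' : Type u} [AddCommGroup X'] [Module B X'] [AddCommGroup Y']
    [Module B Y'] [AddCommGroup Z'] [Module B Z'] (hf : Function.Injective f)
    (hg : Function.Surjective g) (hfg : Function.Exact f g) {a : X →ₗ[B] X'} {c : Y →ₗ[B] Y'}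
    {e : Z →ₗ[B] Z'} {f' : X' →ₗ[B] Y'} {g' : Y' →ₗ[B] Z'} (h1 : c ∘ₗ f = f' ∘ₗ a)
    (h2 : e ∘ₗ g = g' ∘ₗ c) (ha : Function.Injective (mapHom F (f' ∘ₗ a)))
    (he : Function.Injective (mapHom F e)) : Function.Injective (mapHom F c) := by
  rw [injective_iff_map_eq_zero]
  intro y hy
  obtain ⟨x, rfl⟩ := mapHom_exact F hf hg hfg (y := y) (he (by
    rw [mapHom_apply_apply F e g _ rfl, h2, ← mapHom_apply_apply F g' c _ rfl, hy, map_zero,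
      map_zero]))
  rw [mapHom_apply_apply F c f _ h1] at hy
  rw [ha (hy.trans (map_zero _).symm), map_zero]

/-- Dimension shifting along the horseshoe plays the role of the long exact sequence. The modules
are quantified inside the induction because each step replaces them by kernels. -/
lemma isZero_of_extension (i : ℕ) : ∀ {X Y Z : Type u} [AddCommGroup X] [Module B X]
    [AddCommGroup Y] [Module B Y] [AddCommGroup Z] [Module B Z] {f : X →ₗ[B] Y} {g : Y →ₗ[B] Z},
    Function.Injective f → Function.Surjective g → Function.Exact f g → Acyclic F X → Acyclic F Z →
      Limits.IsZero ((F.leftDerived (i + 1)).obj (ModuleCat.of B Y)) := by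
  induction i with
  | zero =>
    intro X Y Z _ _ _ _ _ _ f g hf hg hfg hX hZ
    obtain ⟨p, hp⟩ := exists_projective_cover B X
    obtain ⟨q, hq⟩ := exists_projective_cover B Z
    obtain ⟨π, i, j, hπ, hi, hj, hij, hi', hj'⟩ := exists_horseshoe hf hg hfg hp hq
    rw [acyclic_iff_ker hp] at hX
    rw [acyclic_iff_ker hq] at hZ
    refine (isZero_leftDerived_one_iff (X := LinearMap.ker π) (f := (LinearMap.ker π).subtype)
      (LinearMap.ker π).injective_subtype hπ
      (LinearMap.exact_subtype_ker_map π)).2 ?_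
    refine injective_of_extension (X := LinearMap.ker p) (Y := LinearMap.ker π)
      (Z := LinearMap.ker q) hi hj hij (a := (LinearMap.ker p).subtype)
      (e := (LinearMap.ker q).subtype) (f' := LinearMap.inl B _ _) (g' := LinearMap.snd B _ _)
      ?_ ?_ ?_ hZ.2
    · exact LinearMap.ext fun x => hi' x
    · exact LinearMap.ext fun x => (hj' x)
    intro x x' h
    have h' := congrArg (mapHom F (LinearMap.fst B _ _)) h
    rw [mapHom_apply_apply F _ _ (LinearMap.ker p).subtype rfl,
      mapHom_apply_apply F _ _ (LinearMap.ker p).subtype rfl] at h'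
    exact hX.2 h'
  | succ i ih =>
    intro X Y Z _ _ _ _ _ _ f g hf hg hfg hX hZ
    obtain ⟨p, hp⟩ := exists_projective_cover B X
    obtain ⟨q, hq⟩ := exists_projective_cover B Z
    obtain ⟨π, i', j, hπ, hi, hj, hij, hi', hj'⟩ := exists_horseshoe hf hg hfg hp hq
    rw [acyclic_iff_ker hp] at hX
    rw [acyclic_iff_ker hq] at hZ
    exact (isZero_leftDerived_succ_iff (X := LinearMap.ker π) (f := (LinearMap.ker π).subtype)
      (LinearMap.ker π).injective_subtype hπ
      (LinearMap.exact_subtype_ker_map π) i).2 (ih (X := LinearMap.ker p)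
        (Y := LinearMap.ker π) (Z := LinearMap.ker q) hi hj hij hX.1 hZ.1)

/-- Extensions of acyclic modules are acyclic. -/
lemma Acyclic.extension (hX : Acyclic F X) (hZ : Acyclic F Z) (hf : Function.Injective f)
    (hg : Function.Surjective g) (hfg : Function.Exact f g) : Acyclic F Y :=
  fun i => isZero_of_extension i hf hg hfg hX hZ

/-- A quotient of an acyclic module by an acyclic submodule is acyclic if the functor preserves the
injectivity of the inclusion. -/
lemma Acyclic.quotient (hX : Acyclic F X) (hY : Acyclic F Y) (hf : Function.Injective f)
    (hg : Function.Surjective g) (hfg : Function.Exact f g)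
    (hF : Function.Injective (mapHom F f)) : Acyclic F Z := by
  obtain ⟨p, hp⟩ := exists_projective_cover B Y
  have hgf : ∀ x, g (f x) = 0 := fun x => (hfg _).2 ⟨x, rfl⟩
  let e := LinearEquiv.ofInjective f hf
  have he : ∀ y, f (e.symm y) = y := fun y => congrArg Subtype.val (e.apply_symm_apply y)
  -- The kernel of the composite Q → Y → Z, with Q free, is an extension of X by ker p, hence
  -- acyclic.
  let i : LinearMap.ker p →ₗ[B] LinearMap.ker (g ∘ₗ p) := Submodule.inclusion fun x hx => by
    rw [LinearMap.mem_ker] at hx ⊢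
    rw [LinearMap.comp_apply, hx, map_zero]
  let j : LinearMap.ker (g ∘ₗ p) →ₗ[B] X := e.symm.toLinearMap ∘ₗ
    ((p ∘ₗ (LinearMap.ker (g ∘ₗ p)).subtype).codRestrict (LinearMap.range f)
      fun x => (hfg _).1 x.2)
  have hj : ∀ x, f (j x) = p x := fun x => he _
  have hi : Function.Injective i := Submodule.inclusion_injective _
  have hjs : Function.Surjective j := by
    intro x
    obtain ⟨y, hy⟩ := hp (f x)
    exact ⟨⟨y, by rw [LinearMap.mem_ker, LinearMap.comp_apply, hy, hgf]⟩, hf (by rw [hj, hy])⟩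
  have hij : Function.Exact i j := by
    intro x
    constructor
    · intro hx
      refine ⟨⟨x, ?_⟩, rfl⟩
      rw [LinearMap.mem_ker, ← hj, hx, map_zero]
    · rintro ⟨y, rfl⟩
      refine hf ?_
      rw [hj, map_zero]
      exact y.2
  rw [acyclic_iff_ker hp] at hY
  refine (acyclic_iff_ker (g := g ∘ₗ p) (hg.comp hp)).2 ⟨hY.1.extension hX hi hjs hij, ?_⟩
  refine injective_of_extension (X := LinearMap.ker p) (Y := LinearMap.ker (g ∘ₗ p)) hi hjs hij
    (a := (LinearMap.ker p).subtype) (e := f) (f' := LinearMap.id) (g' := p) rfl (LinearMap.ext hj) ?_ hF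
  exact hY.2

lemma acyclic_pi : ∀ (m : ℕ) (M : Fin m → Type u) [∀ i, AddCommGroup (M i)] [∀ i, Module B (M i)],
    (∀ i, Acyclic F (M i)) → Acyclic F (∀ i, M i) := by
  intro m
  induction m with
  | zero =>
    intro M _ _ _
    have : Module.Projective B (∀ i, M i) :=
      Module.Projective.of_free (R := B)
    exact acyclic_of_projective F
  | succ m ih =>
    intro M _ _ hM
    refine (hM 0).extension (ih (fun i => M i.succ) fun i => hM _)
      (f := LinearMap.single B M 0)
      (g := LinearMap.pi fun i : Fin m => LinearMap.proj i.succ) ?_ ?_ ?_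
    · exact Pi.single_injective 0
    · intro x
      exact ⟨Fin.cons 0 x, rfl⟩
    · intro x
      constructor
      · intro hx
        refine ⟨x 0, funext fun i => ?_⟩
        refine Fin.cases ?_ (fun i => ?_) i
        · simp
        · have := congrFun hx i
          rw [LinearMap.single_apply, Pi.single_eq_of_ne (Fin.succ_ne_zero i)]
          exact this.symm
      · rintro ⟨y, rfl⟩
        funext i
        exact Pi.single_eq_of_ne (Fin.succ_ne_zero i) y

end Acyclic

/-! ## Right exactness of the tensor product -/

section Tensor

variable {A B : Type u} [Ring A] [Ring B] {X : Type u} [AddCommGroup X] [Module A X]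
  (ρ : Bᵐᵒᵖ →+* Module.End A X)

lemma tensorMap_surjective {M N : Type u} [AddCommGroup M] [Module B M] [AddCommGroup N]
    [Module B N] {g : M →ₗ[B] N} (hg : Function.Surjective g) :
    Function.Surjective (tensorMap ρ g) := by
  intro z
  obtain ⟨z, rfl⟩ := Submodule.Quotient.mk_surjective _ z
  obtain ⟨w, rfl⟩ := LinearMap.lTensor_surjective X (g := g.toAddMonoidHom.toIntLinearMap) hg z
  exact ⟨Submodule.Quotient.mk w, rfl⟩

lemma balancedRelations_le_map {M N : Type u} [AddCommGroup M] [Module B M] [AddCommGroup N]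
    [Module B N] {g : M →ₗ[B] N} (hg : Function.Surjective g) :
    balancedRelations ρ N ≤ (balancedRelations ρ M).map
      (TensorProduct.AlgebraTensorModule.map (LinearMap.id : X →ₗ[A] X)
        g.toAddMonoidHom.toIntLinearMap) := by
  refine Submodule.span_le.2 ?_
  rintro _ ⟨x, b, y, rfl⟩
  obtain ⟨y, rfl⟩ := hg y
  refine ⟨_, Submodule.subset_span ⟨x, b, y, rfl⟩, ?_⟩
  simp

lemma tensorMap_exact {L M N : Type u} [AddCommGroup L] [Module B L] [AddCommGroup M] [Module B M]
    [AddCommGroup N] [Module B N] {f : L →ₗ[B] M} {g : M →ₗ[B] N} (hfg : Function.Exact f g)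
    (hg : Function.Surjective g) {z : (X ⊗[ℤ] M) ⧸ balancedRelations ρ M}
    (hz : tensorMap ρ g z = 0) : ∃ w, tensorMap ρ f w = z := by
  obtain ⟨z, rfl⟩ := Submodule.Quotient.mk_surjective _ z
  obtain ⟨w, hw, hwz⟩ := balancedRelations_le_map ρ hg ((Submodule.Quotient.mk_eq_zero _).1 hz)
  have h0 : LinearMap.lTensor X g.toAddMonoidHom.toIntLinearMap (z - w) = 0 := by
    rw [map_sub, sub_eq_zero]
    exact hwz.symm
  obtain ⟨v, hv⟩ := (lTensor_exact X (f := f.toAddMonoidHom.toIntLinearMap)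
    (g := g.toAddMonoidHom.toIntLinearMap) hfg hg _).1 h0
  refine ⟨Submodule.Quotient.mk v, (Submodule.Quotient.eq _).2 ?_⟩
  have : TensorProduct.AlgebraTensorModule.map (LinearMap.id : X →ₗ[A] X)
      f.toAddMonoidHom.toIntLinearMap v = z - w := hv
  rw [this, sub_sub_cancel_left]
  exact neg_mem hw

instance tensorFunctor_preservesFiniteColimits :
    Limits.PreservesFiniteColimits (tensorFunctor ρ) := by
  rw [Functor.preservesFiniteColimits_iff_forall_exact_map_and_epi]
  intro S hS
  have hg := hS.moduleCat_surjective_g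
  refine ⟨(ShortComplex.moduleCat_exact_iff _).2 fun z hz => ?_,
    (ModuleCat.epi_iff_surjective _).2 (tensorMap_surjective ρ hg)⟩
  exact tensorMap_exact ρ (f := S.f.hom) (g := S.g.hom)
    ((ShortComplex.ShortExact.moduleCat_exact_iff_function_exact S).1 hS.exact) hg hz

end Tensor

/-! ## Globalisation of cell modules -/

namespace BlobSystem

section

variable {k : Type u} [Field k] {A B : Type u} [Ring A] [Algebra k A] [Ring B] [Algebra k B]

/-- The situation in which the globalisation functor is defined. -/
structure Glob (SB : BlobSystem k B) (SA : BlobSystem k A) (ι : B →+* A) (ε : A) : Prop where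
  n_eq : SA.n = SB.n + 2
  compat : Compat SB SA (RingHom.id k) ι
  eps : ε = SA.d' • SA.U (SB.n + 1)
  comm : ∀ b, ε * ι b = ι b * ε

variable {SB : BlobSystem k B} {SA : BlobSystem k A} {ι : B →+* A} {ε : A}
  (h : Glob SB SA ι ε) {b : Prop} {l : ℤ} {r : ℕ}
include h

lemma Glob.eps_mul_eps : ε * ε = ε := by
  rw [h.eps, smul_mul_smul_comm, SA.U_sq, ← smul_assoc, smul_eq_mul, mul_assoc, SA.d'_mul, mul_one]

lemma Glob.map_smul (a : k) (x : B) : ι (a • x) = a • ι x := h.compat.smul a x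

lemma Glob.map_f (hr : l.natAbs + 2 * r = SB.n) : ι (SB.f SB.n l) = SA.f SB.n l :=
  h.compat.map_f le_rfl (by omega)

/-- Multiplication by ε adds one cup and two strands, which is why globalisation preserves the
weight. -/
lemma Glob.eps_mul_c (r : ℕ) : ε * ι (SB.c SB.n r) = SA.d' • SA.c SA.n (r + 1) := by
  rw [h.compat.map_c le_rfl, h.eps, h.n_eq, SA.c_succ, smul_mul_assoc]; rfl

lemma Glob.eps_mul_f (hr : l.natAbs + 2 * r = SB.n) :
    ε * ι (SB.f SB.n l) = SA.f SA.n l := by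
  rw [SA.f_eq (r := r + 1) (by rw [h.n_eq]; omega), SB.f_eq hr, h.map_smul, map_mul,
    mul_smul_comm, ← mul_assoc, h.eps_mul_c, smul_mul_assoc, ← smul_assoc, smul_eq_mul, pow_succ,
    h.compat.map_s (by omega)]
  congr 2
  exact congrArg (· ^ r) h.compat.d'

lemma Glob.eps_mul_J (hA : SA.Good b) {x : B} (hx : x ∈ SB.J SB.n r) :
    ε * ι x ∈ SA.J SA.n (r + 1) := by
  refine mul_span_mul_induction (p := fun z => ε * ι z ∈ SA.J SA.n (r + 1)) (fun a _ c _ => ?_)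
    (fun y z hy hz => by rw [map_add, mul_add]; exact add_mem hy hz) hx
  rw [map_mul, map_mul, mul_assoc, ← mul_assoc, h.comm, mul_assoc, ← mul_assoc ε, h.eps_mul_c]
  exact SA.mul_mem_J_left (hA.mem_level _) (SA.mul_mem_J_right (hA.mem_level _)
    (Submodule.smul_mem _ _ (SA.c_mem_J _ _)))

lemma Glob.exists_of_mem_level {x : A} (hx : x ∈ SA.level SB.n) : ∃ y, ι y = x := by
  induction hx using Algebra.adjoin_induction with
  | mem y hy =>
    rcases hy with ⟨i, hi, rfl⟩ | ⟨h1, rfl⟩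
    exacts [⟨_, h.compat.U i hi⟩, ⟨_, h.compat.e h1⟩]
  | algebraMap a =>
    exact ⟨algebraMap k B a, by rw [Algebra.algebraMap_eq_smul_one, h.map_smul, map_one,
      Algebra.algebraMap_eq_smul_one]⟩
  | add _ _ _ _ h1 h2 =>
    obtain ⟨a, rfl⟩ := h1
    obtain ⟨c, rfl⟩ := h2
    exact ⟨a + c, map_add _ _ _⟩
  | mul _ _ _ _ h1 h2 =>
    obtain ⟨a, rfl⟩ := h1
    obtain ⟨c, rfl⟩ := h2
    exact ⟨a * c, map_mul _ _ _⟩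

/-- The conditional expectation for U_{n+1}, together with the fact that the subalgebra on the first
n strands is in the image of B. -/
lemma Glob.exists_eps_mul_mul_eps (hA : SA.Good b) (x : A) : ∃ y, ε * x * ε = ι y * ε := by
  have hx := hA.mem_level x
  rw [h.n_eq] at hx
  obtain ⟨y, hy, hxy⟩ := SA.U_mul_level_succ_mul_U (m := SB.n + 1) (by omega) hx
  obtain ⟨z, rfl⟩ := h.exists_of_mem_level hy
  refine ⟨SA.d' • z, ?_⟩
  rw [h.eps, smul_mul_assoc, mul_smul_comm, smul_mul_assoc, hxy, h.map_smul, mul_smul_comm,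
    smul_mul_assoc]

/-- Here f_{n+2} = ε f_n, and `v` begins with f_n. Between two copies of f_n the zigzag reduces `c
(n + 1) r` to a power of d'. -/
lemma Glob.f_mul_c_mul_v {w : ℕ → ℤ} (hw : IsWalk (Dom b) SB.n w)
    (hr : (w SB.n).natAbs + 2 * r = SB.n) :
    SA.f SA.n (w SB.n) * (SA.c (SB.n + 1) r * SA.v w SB.n) =
      SA.d' ^ r • (SA.f SA.n (w SB.n) * SA.v w SB.n) := by
  have hf : SA.f SB.n (w SB.n) * SA.c (SB.n + 1) r * SA.f SB.n (w SB.n) =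
      SA.d' ^ r • SA.f SB.n (w SB.n) := by
    nth_rw 2 [SA.f_eq hr]
    rw [mul_smul_comm, ← mul_assoc, mul_assoc (SA.f _ _), SA.f_mul_c_mul_c (by rw [h.n_eq]; omega) hr,
      SA.f_mul_s hr]
  rw [← SA.f_mul_v hw, ← h.eps_mul_f hr, h.map_f hr]
  calc ε * SA.f SB.n (w SB.n) * (SA.c (SB.n + 1) r * (SA.f SB.n (w SB.n) * SA.v w SB.n))
      = ε * (SA.f SB.n (w SB.n) * SA.c (SB.n + 1) r * SA.f SB.n (w SB.n)) * SA.v w SB.n := by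
        simp only [mul_assoc]
    _ = SA.d' ^ r • (ε * SA.f SB.n (w SB.n) * (SA.f SB.n (w SB.n) * SA.v w SB.n)) := by
        have hff : SA.f SB.n (w SB.n) * (SA.f SB.n (w SB.n) * SA.v w SB.n) =
            SA.f SB.n (w SB.n) * SA.v w SB.n := by rw [← mul_assoc, SA.f_sq hr]
        rw [hf, mul_smul_comm, smul_mul_assoc, mul_assoc ε, mul_assoc ε, hff]

omit h in
open Classical in
/-- The neighbours of `l` of larger absolute value. -/
def outer (b : Prop) (l : ℤ) : Finset ℤ :=
  ({l + 1, l - 1} : Finset ℤ).filter fun μ => μ.natAbs = l.natAbs + 1 ∧ Dom b μ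

omit h in
lemma mem_outer {μ : ℤ} :
    μ ∈ outer b l ↔ (μ = l + 1 ∨ μ = l - 1) ∧ μ.natAbs = l.natAbs + 1 ∧ Dom b μ := by
  simp [outer]

omit h in
lemma outer_nonempty (hl : Dom b l) : (outer b l).Nonempty := by
  by_cases h0 : 0 ≤ l
  · exact ⟨l + 1, mem_outer.2 ⟨Or.inl rfl, by omega, Or.inr (by omega)⟩⟩
  · exact ⟨l - 1, mem_outer.2 ⟨Or.inr rfl, by omega, Or.inl (hl.resolve_right h0)⟩⟩

/-- On n + 1 strands f(μ) + f(-μ) is a multiple of `c`. For nonzero l only one of ±μ is adjacent to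
l, and the other idempotent is orthogonal to f(l) by sign. For l = 0 both neighbours ±1 occur,
except that f(-1) = 0 in the Temperley–Lieb case. -/
lemma Glob.f_mul_sum (hA : SA.Good b) (hr : l.natAbs + 2 * r = SB.n) (hl : Dom b l) :
    SA.f SA.n l * ∑ μ ∈ outer b l, SA.f (SB.n + 1) μ =
      SA.d' ^ r • (SA.f SA.n l * SA.c (SB.n + 1) r) := by
  classical
  have hrA : l.natAbs + 2 * (r + 1) = SA.n := by rw [h.n_eq]; omega
  rcases lt_trichotomy l 0 with h0 | rfl | h0
  · have : outer b l = {l - 1} := by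
      ext μ
      rw [mem_outer, Finset.mem_singleton]
      exact ⟨fun hμ => by omega, fun hμ => ⟨by omega, by omega, by
        rcases hl with hb | hl
        exacts [Or.inl hb, by omega]⟩⟩
    rw [this, Finset.sum_singleton, ← mul_smul_comm,
      ← SA.f_add_f_neg (h := l - 1) (r := r) (by omega) (by omega), mul_add,
      SA.f_mul_f_of_neg hrA (h' := -(l - 1)) (r' := r) (by omega) (by nlinarith), add_zero]
  · have h1 := SA.f_add_f_neg (h := 1) (m := SB.n + 1) (r := r) (by omega) (by omega)
    rw [← mul_smul_comm, ← h1]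
    by_cases hb : b
    · have : outer b 0 = {1, -1} := by
        ext μ
        rw [mem_outer, Finset.mem_insert, Finset.mem_singleton]
        exact ⟨fun hμ => by omega, fun hμ => ⟨by omega, by omega, Or.inl hb⟩⟩
      rw [this, Finset.sum_pair (by omega)]
    · have : outer b 0 = {1} := by
        ext μ
        rw [mem_outer, Finset.mem_singleton]
        refine ⟨fun hμ => ?_, fun hμ => ⟨by omega, by omega, Or.inr (by omega)⟩⟩
        have := hμ.2.2.resolve_left hb
        omega
      rw [this, Finset.sum_singleton, hA.f_eq_zero (h := -1), add_zero]
      rintro (hb' | hb')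
      exacts [hb hb', by omega]
  · have : outer b l = {l + 1} := by
      ext μ
      rw [mem_outer, Finset.mem_singleton]
      exact ⟨fun hμ => by omega, fun hμ => ⟨by omega, by omega, Or.inr (by omega)⟩⟩
    rw [this, Finset.sum_singleton, ← mul_smul_comm,
      ← SA.f_add_f_neg (h := l + 1) (r := r) (by omega) (by omega), mul_add,
      SA.f_mul_f_of_neg hrA (h' := -(l + 1)) (r' := r) (by omega) (by nlinarith), add_zero]

/-- The elements `v w SB.n` for walks `w` on `SB.n` strands are left independent modulo
`J SA.n (r + 2)`. -/
theorem Glob.mem_J_of_sum_mem (hA : SA.Good b) {m : ℕ} {w : Fin m → ℕ → ℤ}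
    (hw : ∀ i, IsWalk (Dom b) SB.n (w i)) (hinj : Function.Injective w)
    (hr : ∀ i, (w i SB.n).natAbs + 2 * r = SB.n) {a : Fin m → A}
    (hsum : ∑ i, a i * (SA.f SA.n (w i SB.n) * SA.v (w i) SB.n) ∈ SA.J SA.n (r + 2)) (i : Fin m) :
    a i * SA.f SA.n (w i SB.n) ∈ SA.J SA.n (r + 2) := by
  have hrA : ∀ i, (w i SB.n).natAbs + 2 * (r + 1) = SA.n := fun i => by
    rw [h.n_eq]; have := hr i; omega
  let I := Σ i : Fin m, {μ // μ ∈ outer b (w i SB.n)}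
  -- The walk `w` prolonged by one step away from zero and one step back, so that it again ends at
  -- the weight of `w`, now with r + 1 cups.
  let W : I → ℕ → ℤ := fun z => Function.update (Function.update (w z.1) (SB.n + 1) z.2.1)
    (SB.n + 2) (w z.1 SB.n)
  have hμ : ∀ z : I, _ := fun z => mem_outer.1 z.2.2
  have hWend : ∀ z, W z SA.n = w z.1 SB.n := fun z => by
    rw [h.n_eq]; exact Function.update_self _ _ _
  have hWle : ∀ z, ∀ j ≤ SB.n, W z j = w z.1 j := fun z j hj => by
    change Function.update (Function.update _ _ _) _ _ _ = _
    rw [Function.update_of_ne (by omega), Function.update_of_ne (by omega)]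
  have hWmid : ∀ z, W z (SB.n + 1) = z.2.1 := fun z => by
    change Function.update (Function.update _ _ _) _ _ _ = _
    rw [Function.update_of_ne (by omega), Function.update_self]
  have hWwalk : ∀ z, IsWalk (Dom b) SA.n (W z) := fun z => by
    rw [h.n_eq]
    refine ((hw z.1).update (hμ z).2.2 (hμ z).1).update ((hw z.1).2.2.1 _ le_rfl) ?_
    rw [Function.update_self]
    have := (hμ z).1
    omega
  have hWinj : Function.Injective W := by
    rintro ⟨i, μ⟩ ⟨j, ν⟩ hij
    obtain rfl : i = j := hinj ((hw i).ext (hw j) fun t ht => by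
      rw [← hWle ⟨i, μ⟩ t ht, hij, hWle ⟨j, ν⟩ t ht])
    obtain rfl : μ = ν := Subtype.ext (by rw [← hWmid ⟨i, μ⟩, hij, hWmid])
    rfl
  have hWv : ∀ z, SA.v (W z) SA.n =
      SA.f SA.n (w z.1 SB.n) * (SA.f (SB.n + 1) z.2.1 * SA.v (w z.1) SB.n) := fun z => by
    rw [← SA.v_update, h.n_eq, ← SA.v_update]
  have key := hA.mem_J_of_sum_mem (r := r + 1) hWwalk hWinj (fun z => by rw [hWend]; exact hrA _)
    (x := fun z => a z.1 * SA.f SA.n (w z.1 SB.n))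
    (fun z => by rw [hWend, mul_assoc, SA.f_sq (hrA _)]) ?_
  · obtain ⟨μ, hμ⟩ := outer_nonempty ((hw i).2.2.1 _ le_rfl)
    exact key ⟨i, μ, hμ⟩
  · rw [Fintype.sum_sigma]
    -- One factor d'^r arises from summing over the outer neighbours, the other from the zigzag
    -- collapse.
    have := Submodule.smul_mem _ (SA.d' ^ r * SA.d' ^ r) hsum
    rw [Finset.smul_sum] at this
    convert this using 1
    refine Finset.sum_congr rfl fun i _ => ?_
    have h1 := h.f_mul_sum hA (hr i) ((hw i).2.2.1 _ le_rfl)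
    have h2 : ∑ μ : {μ // μ ∈ outer b (w i SB.n)}, a i * SA.f SA.n (w i SB.n) *
        SA.v (W ⟨i, μ⟩) SA.n = a i * SA.f SA.n (w i SB.n) *
        ((∑ μ ∈ outer b (w i SB.n), SA.f (SB.n + 1) μ) * SA.v (w i) SB.n) := by
      rw [Finset.sum_mul, Finset.mul_sum, ← Finset.sum_coe_sort (outer b (w i SB.n))]
      refine Finset.sum_congr rfl fun μ _ => ?_
      rw [hWv, mul_assoc, ← mul_assoc (SA.f _ _) (SA.f _ _), SA.f_sq (hrA i), mul_assoc]
    rw [h2, mul_assoc, ← mul_assoc (SA.f _ _), h1, smul_mul_assoc, mul_assoc,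
      h.f_mul_c_mul_v (hw i) (hr i), smul_smul, mul_smul_comm]

end

end BlobSystem

/-! ### The globalisation of a cell module is a cell module -/

namespace BlobSystem

section

variable {k : Type u} [Field k] {A B : Type u} [Ring A] [Algebra k A] [Ring B] [Algebra k B]
variable {SB : BlobSystem k B} {SA : BlobSystem k A} {ι : B →+* A} {ε : A}
  (h : Glob SB SA ι ε) {b : Prop} {l : ℤ} {r : ℕ}
  {M N : Type u} [AddCommGroup M] [Module B M] [AddCommGroup N] [Module B N]

/-- The underlying module of the globalisation of `M`. -/
abbrev Glob.Obj (h : Glob SB SA ι ε) (M : Type u) [AddCommGroup M] [Module B M] : Type u :=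
  (Ideal.span {ε} ⊗[ℤ] M) ⧸ balancedRelations (rightAction ε ι h.comm) M

/-- The element `a ε ⊗ m`. -/
def Glob.tm (a : A) (m : M) : h.Obj M :=
  Submodule.Quotient.mk ((⟨a * ε, Ideal.mem_span_singleton'.2 ⟨a, rfl⟩⟩ : Ideal.span {ε}) ⊗ₜ[ℤ] m)

lemma Glob.tm_congr {a a' : A} (haa : a * ε = a' * ε) (m : M) : h.tm a m = h.tm a' m := by
  rw [Glob.tm, Glob.tm]
  simp only [haa]

lemma Glob.smul_tm (a a' : A) (m : M) : a • h.tm a' m = h.tm (a * a') m := by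
  rw [Glob.tm, Glob.tm, ← Submodule.Quotient.mk_smul, TensorProduct.smul_tmul']
  congr 2
  exact Subtype.ext (mul_assoc _ _ _).symm

lemma Glob.tm_smul (a : A) (x : B) (m : M) : h.tm a (x • m) = h.tm (a * ι x) m := by
  rw [Glob.tm, Glob.tm, eq_comm, Submodule.Quotient.eq]
  refine Submodule.subset_span ⟨⟨a * ε, Ideal.mem_span_singleton'.2 ⟨a, rfl⟩⟩, x, m, ?_⟩
  congr 2
  refine Subtype.ext ?_
  change a * ι x * ε = a * ε * ι x
  rw [mul_assoc, ← h.comm, mul_assoc]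

lemma Glob.tm_zero (a : A) : h.tm a (0 : M) = 0 := by
  rw [Glob.tm, TensorProduct.tmul_zero, Submodule.Quotient.mk_zero]

lemma Glob.obj_induction {p : h.Obj M → Prop} (h0 : p 0) (hadd : ∀ x y, p x → p y → p (x + y))
    (htm : ∀ a m, p (h.tm a m)) (z : h.Obj M) : p z := by
  obtain ⟨z, rfl⟩ := Submodule.Quotient.mk_surjective _ z
  induction z using TensorProduct.induction_on with
  | zero => exact h0
  | tmul x m =>
    obtain ⟨x, hx⟩ := x
    obtain ⟨a, rfl⟩ := Ideal.mem_span_singleton'.1 hx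
    exact htm a m
  | add x y hx hy => exact hadd _ _ hx hy

/-- The map `a ε ⊗ x ↦ a ε x` between quotients by left ideals. -/
def Glob.lift (I : Submodule B B) (K : Submodule A A) (hIK : ∀ x ∈ I, ε * ι x ∈ K) :
    h.Obj (B ⧸ I) →ₗ[A] A ⧸ K :=
  Submodule.liftQ _ (TensorProduct.AlgebraTensorModule.lift
    { toFun := fun x => ((I.restrictScalars ℤ).liftQ
          ((K.mkQ.toAddMonoidHom.comp ((AddMonoidHom.mulLeft (x : A)).comp
            ι.toAddMonoidHom)).toIntLinearMap) (by
          intro y hy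
          obtain ⟨a, ha⟩ := Ideal.mem_span_singleton'.1 x.2
          refine (Submodule.Quotient.mk_eq_zero K).2 ?_
          change (x : A) * ι y ∈ K
          rw [← ha, mul_assoc]
          exact K.smul_mem a (hIK y hy))) ∘ₗ
          (Submodule.Quotient.restrictScalarsEquiv ℤ I).symm.toLinearMap
      map_add' := fun x y => by
        refine LinearMap.ext fun z => ?_
        obtain ⟨z, rfl⟩ := Submodule.Quotient.mk_surjective _ z
        change (Submodule.Quotient.mk (((x + y : Ideal.span {ε}) : A) * ι z) : A ⧸ K) =
          Submodule.Quotient.mk ((x : A) * ι z) + Submodule.Quotient.mk ((y : A) * ι z)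
        rw [← Submodule.Quotient.mk_add, ← add_mul]; rfl
      map_smul' := fun a x => by
        refine LinearMap.ext fun z => ?_
        obtain ⟨z, rfl⟩ := Submodule.Quotient.mk_surjective _ z
        change (Submodule.Quotient.mk (((a • x : Ideal.span {ε}) : A) * ι z) : A ⧸ K) =
          a • Submodule.Quotient.mk ((x : A) * ι z)
        rw [← Submodule.Quotient.mk_smul, smul_eq_mul, ← mul_assoc]; rfl }) (by
    refine Submodule.span_le.2 ?_
    rintro _ ⟨x, c, y, rfl⟩
    obtain ⟨y, rfl⟩ := Submodule.Quotient.mk_surjective _ y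
    rw [SetLike.mem_coe, LinearMap.mem_ker, map_sub, sub_eq_zero]
    change (Submodule.Quotient.mk ((x : A) * ι c * ι y) : A ⧸ K) =
      Submodule.Quotient.mk ((x : A) * ι (c * y))
    rw [map_mul, mul_assoc])

lemma Glob.lift_tm (I : Submodule B B) (K : Submodule A A) (hIK : ∀ x ∈ I, ε * ι x ∈ K) (a : A)
    (x : B) : h.lift I K hIK (h.tm a (Submodule.Quotient.mk x)) =
      Submodule.Quotient.mk (a * ε * ι x) := rfl

/-- Up to a unit, `c` on n + 2 strands with r + 1 cups is ι(c) ε, and ε a ε lies in ι(B) ε; the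
resulting element of B moves across the tensor sign, where `c` kills it. -/
lemma Glob.c_smul_eq_zero (hA : SA.Good b) (hM : ∀ m : M, SB.c SB.n r • m = 0) (z : h.Obj M) :
    SA.c SA.n (r + 1) • z = 0 := by
  have hc : SA.c SA.n (r + 1) = SA.d • (ι (SB.c SB.n r) * ε) := by
    rw [← h.comm, h.eps_mul_c, ← smul_assoc, smul_eq_mul, SA.d_mul, one_smul]
  induction z using Glob.obj_induction with
  | h0 => exact smul_zero _
  | hadd x y hx hy => rw [smul_add, hx, hy, add_zero]
  | htm a m =>
    obtain ⟨y, hy⟩ := h.exists_eps_mul_mul_eps hA a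
    rw [h.smul_tm, h.tm_congr (a' := 1 * ι (SA.d • (SB.c SB.n r * y))), ← h.tm_smul,
      Algebra.smul_def, mul_smul, mul_smul, hM, smul_zero, h.tm_zero]
    rw [hc, h.map_smul, map_mul, one_mul, smul_mul_assoc, smul_mul_assoc, smul_mul_assoc, mul_assoc,
      mul_assoc, ← mul_assoc ε, hy, mul_assoc]

variable (hB : SB.Good b) (hA : SA.Good b)

/-- The map from the cell module to the globalisation of the cell module. -/
def Glob.deltaMap (hr : l.natAbs + 2 * r = SB.n) :
    hA.Delta l (r + 1) →ₗ[A] h.Obj (hB.Delta l r) :=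
  Good.deltaLift (h.tm 1 (hB.gen l r)) (by
    rw [h.smul_tm, mul_one, ← h.eps_mul_f hr, ← h.tm_smul, Good.f_smul_gen hr]
    exact h.tm_congr (by rw [h.eps_mul_eps, one_mul]) _)
    (h.c_smul_eq_zero hA (hB.killed_delta hr).1)

lemma Glob.deltaMap_smul_gen (hr : l.natAbs + 2 * r = SB.n) (a : A) :
    h.deltaMap hB hA hr (a • hA.gen l (r + 1)) = h.tm a (hB.gen l r) := by
  rw [Glob.deltaMap, Good.deltaLift_smul_gen, h.smul_tm, mul_one]

lemma Glob.deltaMap_surjective (hr : l.natAbs + 2 * r = SB.n) :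
    Function.Surjective (h.deltaMap hB hA hr) := by
  rw [← LinearMap.range_eq_top, eq_top_iff]
  intro z _
  induction z using Glob.obj_induction with
  | h0 => exact zero_mem _
  | hadd x y hx hy => exact add_mem (hx trivial) (hy trivial)
  | htm a m =>
    obtain ⟨x, rfl⟩ := Good.exists_smul_gen m
    rw [h.tm_smul]
    exact ⟨_, h.deltaMap_smul_gen hB hA hr _⟩

/-- Multiplication a ε ⊗ x ↦ a ε x is well defined into the cell module of A and inverts the map
from the left, because ε fixes the generator: f_{n+2} = ε f_n. -/
lemma Glob.deltaMap_injective (hr : l.natAbs + 2 * r = SB.n) :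
    Function.Injective (h.deltaMap hB hA hr) := by
  have hrA : l.natAbs + 2 * (r + 1) = SA.n := by rw [h.n_eq]; omega
  rw [injective_iff_map_eq_zero]
  intro y hy
  obtain ⟨a, rfl⟩ := Good.exists_smul_gen y
  rw [h.deltaMap_smul_gen hB hA hr] at hy
  have h1 := congrArg (h.lift (hB.deltaKer l r) (hA.deltaKer l (r + 1)) (fun x hx => by
    rw [Good.mem_deltaKer] at hx ⊢
    rw [← h.eps_mul_f hr, ← mul_assoc, mul_assoc ε, ← h.comm, ← mul_assoc, h.eps_mul_eps,
      mul_assoc, ← map_mul]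
    exact h.eps_mul_J hA hx)) hy
  rw [Good.gen, h.lift_tm, map_zero, map_one, mul_one, ← Good.smul_gen, mul_smul] at h1
  rw [← h1]
  congr 1
  rw [← Good.f_smul_gen hrA, ← mul_smul, ← h.eps_mul_f hr, ← mul_assoc, h.eps_mul_eps]

/-- Globalisation takes cell modules to cell modules. -/
def Glob.deltaEquiv (hr : l.natAbs + 2 * r = SB.n) :
    hA.Delta l (r + 1) ≃ₗ[A] h.Obj (hB.Delta l r) :=
  LinearEquiv.ofBijective _ ⟨h.deltaMap_injective hB hA hr, h.deltaMap_surjective hB hA hr⟩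

end

end BlobSystem

namespace BlobSystem

section

variable {k : Type u} [Field k] {B : Type u} [Ring B] [Algebra k B]
variable {SB : BlobSystem k B} {b : Prop} (hB : SB.Good b) {l : ℤ} {r : ℕ}

/-! ## The filtration by the ideals `J` -/

lemma Good.c_smul_quotient (y : B ⧸ hB.idl r) : SB.c SB.n r • y = 0 := by
  obtain ⟨x, rfl⟩ := Submodule.Quotient.mk_surjective _ y
  exact (Submodule.Quotient.mk_eq_zero _).2
    (SB.mul_mem_J_right (hB.mem_level x) (SB.c_mem_J _ _))

/-- Right multiplication by `x`, as a map from a cell module to a quotient of the algebra. -/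
def Good.mulRight (x : B) (hx : SB.f SB.n l * x = x) : hB.Delta l r →ₗ[B] B ⧸ hB.idl (r + 1) :=
  Good.deltaLift (Submodule.Quotient.mk x)
    (by rw [← Submodule.Quotient.mk_smul, smul_eq_mul, hx]) hB.c_smul_quotient

lemma Good.mulRight_smul_gen (x : B) (hx : SB.f SB.n l * x = x) (a : B) :
    hB.mulRight (r := r) x hx (a • hB.gen l r) = Submodule.Quotient.mk (a * x) := by
  rw [Good.mulRight, Good.deltaLift_smul_gen, ← Submodule.Quotient.mk_smul, smul_eq_mul]

/-- The cell module is the image of B f in B/J_{r+1}, a direct summand because f is idempotent. -/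
lemma Good.exists_retraction (hr : l.natAbs + 2 * r = SB.n) :
    ∃ (s : hB.Delta l r →ₗ[B] B ⧸ hB.idl (r + 1)) (p : B ⧸ hB.idl (r + 1) →ₗ[B] hB.Delta l r),
      p ∘ₗ s = LinearMap.id := by
  refine ⟨hB.mulRight (SB.f SB.n l) (SB.f_sq hr),
    Submodule.liftQ _ (LinearMap.toSpanSingleton B _ (hB.gen l r)) fun x hx => ?_,
    LinearMap.ext fun y => ?_⟩
  · rw [LinearMap.mem_ker, LinearMap.toSpanSingleton_apply, Good.smul_gen_eq_zero_iff]
    exact SB.mul_mem_J_right (hB.mem_level _) hx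
  · obtain ⟨a, rfl⟩ := Good.exists_smul_gen y
    rw [LinearMap.comp_apply, Good.mulRight_smul_gen, Submodule.liftQ_apply,
      LinearMap.toSpanSingleton_apply, mul_smul, Good.f_smul_gen hr]
    rfl

/-- The projection between successive quotients. -/
def Good.proj (r : ℕ) : B ⧸ hB.idl (r + 1) →ₗ[B] B ⧸ hB.idl r :=
  Submodule.factor (SB.J_anti SB.n (Nat.le_succ r))

variable {m : ℕ} {w : Fin m → ℕ → ℤ}

/-- The map from a sum of cell modules whose image is a layer of the filtration. -/
def Good.layer (r : ℕ) (hw : ∀ i, IsWalk (Dom b) SB.n (w i)) :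
    (∀ i : Fin m, hB.Delta (w i SB.n) r) →ₗ[B] B ⧸ hB.idl (r + 1) :=
  ∑ i, hB.mulRight (SB.v (w i) SB.n) (SB.f_mul_v (hw i)) ∘ₗ LinearMap.proj i

lemma Good.layer_apply (hw : ∀ i, IsWalk (Dom b) SB.n (w i)) (a : Fin m → B) :
    hB.layer r hw (fun i => a i • hB.gen _ r) =
      Submodule.Quotient.mk (∑ i, a i * SB.v (w i) SB.n) := by
  rw [Good.layer, LinearMap.sum_apply, ← Submodule.mkQ_apply, map_sum]
  exact Finset.sum_congr rfl fun i _ =>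
    hB.mulRight_smul_gen (l := w i SB.n) (SB.v (w i) SB.n) (SB.f_mul_v (hw i)) (a i)

lemma Good.exists_smul_gen_pi (y : ∀ i : Fin m, hB.Delta (w i SB.n) r) :
    ∃ a : Fin m → B, y = fun i => a i • hB.gen _ r := by
  choose a ha using fun i => Good.exists_smul_gen (y i)
  exact ⟨a, funext ha⟩

/-- This is the left independence of the elements `v (w i)` modulo J_{r+1}; the generators of the
cell modules absorb f. -/
lemma Good.layer_injective (hw : ∀ i, IsWalk (Dom b) SB.n (w i)) (hinj : Function.Injective w)
    (hr : ∀ i, (w i SB.n).natAbs + 2 * r = SB.n) : Function.Injective (hB.layer r hw) := by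
  rw [injective_iff_map_eq_zero]
  intro y hy
  obtain ⟨a, rfl⟩ := hB.exists_smul_gen_pi y
  rw [hB.layer_apply, Submodule.Quotient.mk_eq_zero] at hy
  funext i
  refine Good.smul_gen_eq_zero_iff.2 (hB.mem_J_of_sum_mem hw hinj hr
    (x := fun i => a i * SB.f SB.n (w i SB.n))
    (fun i => by rw [mul_assoc, SB.f_sq (hr i)]) ?_ i)
  have h1 : ∀ i, a i * SB.f SB.n (w i SB.n) * SB.v (w i) SB.n = a i * SB.v (w i) SB.n :=
    fun i => by rw [mul_assoc, SB.f_mul_v (hw i)]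
  simp only [h1]
  exact hy

lemma Good.mk_mem_range_layer (hw : ∀ i, IsWalk (Dom b) SB.n (w i))
    (hsurj : ∀ p, IsWalk (Dom b) SB.n p → (p SB.n).natAbs + 2 * r = SB.n → ∃ i, w i = p)
    {x : B} (hx : x ∈ SB.cellSpan (Dom b) SB.n r) :
    Submodule.Quotient.mk x ∈ LinearMap.range (hB.layer r hw) := by
  induction hx using Submodule.span_induction with
  | zero => exact zero_mem _
  | add x y _ _ h1 h2 => exact add_mem h1 h2
  | smul c x _ h1 =>
    rw [← algebraMap_smul B c x, Submodule.Quotient.mk_smul]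
    exact Submodule.smul_mem _ _ h1
  | mem x hx =>
    obtain ⟨p, q, hp, hq, hpq, hpr, rfl⟩ := hx
    by_cases hr : (p SB.n).natAbs + 2 * r = SB.n
    · obtain ⟨i, rfl⟩ := hsurj q hq (by rw [← hpq, hr])
      refine ⟨fun j => (Pi.single i (SB.u p SB.n) : Fin m → B) j • hB.gen _ r, ?_⟩
      rw [hB.layer_apply, Finset.sum_eq_single i, Pi.single_eq_same]
      · exact fun j _ hj => by rw [Pi.single_eq_of_ne hj, zero_mul]
      · exact fun hi => absurd (Finset.mem_univ i) hi
    · obtain ⟨t, ht⟩ := hp.exists_natAbs le_rfl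
      have h0 : (Submodule.Quotient.mk (SB.u p SB.n * SB.v q SB.n) : B ⧸ hB.idl (r + 1)) = 0 :=
        (Submodule.Quotient.mk_eq_zero _).2
          (SB.mul_mem_J_right (hB.mem_level _) (SB.u_mem_J hp (by omega)))
      rw [h0]
      exact zero_mem _

/-- Modulo J_{r+1} the layer J_r is spanned by the u(p) v(q) with exactly r cups, and such an
element is the image of u(p) times the generator in the summand of q. -/
lemma Good.layer_exact (hw : ∀ i, IsWalk (Dom b) SB.n (w i))
    (hsurj : ∀ p, IsWalk (Dom b) SB.n p → (p SB.n).natAbs + 2 * r = SB.n → ∃ i, w i = p)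
    (hr : ∀ i, (w i SB.n).natAbs + 2 * r = SB.n) :
    Function.Exact (hB.layer r hw) (hB.proj r) := by
  intro y
  constructor
  · intro hy
    obtain ⟨x, rfl⟩ := Submodule.Quotient.mk_surjective _ y
    have hx : x ∈ SB.J SB.n r := (Submodule.Quotient.mk_eq_zero _).1 hy
    exact hB.mk_mem_range_layer hw hsurj (hB.J_le_cellSpan le_rfl r hx)
  · rintro ⟨y, rfl⟩
    obtain ⟨a, rfl⟩ := hB.exists_smul_gen_pi y
    rw [hB.layer_apply]
    refine (Submodule.Quotient.mk_eq_zero _).2 ?_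
    change ∑ i, a i * SB.v (w i) SB.n ∈ hB.idl r
    refine Submodule.sum_mem (hB.idl r) fun i _ => ?_
    rw [← SB.f_mul_v (hw i)]
    exact SB.mul_mem_J_left (hB.mem_level _) (SB.mul_mem_J_right (hB.mem_level _)
      (SB.f_mem_J (hr i)))

end

end BlobSystem

namespace BlobSystem

section

variable {k : Type u} [Field k] {A B : Type u} [Ring A] [Algebra k A] [Ring B] [Algebra k B]
variable {SB : BlobSystem k B} {SA : BlobSystem k A} {ι : B →+* A} {ε : A}
  (h : Glob SB SA ι ε) {b : Prop} (hB : SB.Good b) (hA : SA.Good b) {l : ℤ} {r : ℕ}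
  {m : ℕ} {w : Fin m → ℕ → ℤ}

/-! ## Acyclicity of the cell modules for globalisation -/

lemma Glob.tm_add {M : Type u} [AddCommGroup M] [Module B M] (a : A) (x y : M) :
    h.tm a (x + y) = h.tm a x + h.tm a y := by
  rw [Glob.tm, TensorProduct.tmul_add, Submodule.Quotient.mk_add]; rfl

lemma Glob.tm_sum {M : Type u} [AddCommGroup M] [Module B M] (a : A) (x : Fin m → M) :
    h.tm a (∑ i, x i) = ∑ i, h.tm a (x i) :=
  map_sum (AddMonoidHom.mk' (h.tm a) (h.tm_add a)) x _

/-- The map between globalisations induced by a linear map. -/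
def Glob.map {M N : Type u} [AddCommGroup M] [Module B M] [AddCommGroup N] [Module B N]
    (g : M →ₗ[B] N) : h.Obj M →ₗ[A] h.Obj N :=
  mapHom (globalisation ε ι h.comm) g

lemma Glob.map_tm {M N : Type u} [AddCommGroup M] [Module B M] [AddCommGroup N] [Module B N]
    (g : M →ₗ[B] N) (a : A) (x : M) : h.map g (h.tm a x) = h.tm a (g x) := rfl

/-- An element of the globalisation of a sum of cell modules is determined by its components. -/
lemma Glob.exists_eq_sum (z : h.Obj (∀ i, hB.Delta (w i SB.n) r)) :
    ∃ a : Fin m → A, z = ∑ i, h.tm (a i) (Pi.single i (hB.gen (w i SB.n) r)) := by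
  induction z using Glob.obj_induction with
  | h0 =>
    refine ⟨0, (Finset.sum_eq_zero fun i _ => ?_).symm⟩
    rw [Pi.zero_apply, ← zero_smul A (h.tm 0 _), h.smul_tm, zero_mul]
  | hadd x y hx hy =>
    obtain ⟨a, rfl⟩ := hx
    obtain ⟨a', rfl⟩ := hy
    refine ⟨a + a', ?_⟩
    rw [← Finset.sum_add_distrib]
    refine Finset.sum_congr rfl fun i _ => ?_
    rw [Pi.add_apply, ← mul_one (a i), ← mul_one (a' i), ← add_mul, ← h.smul_tm, ← h.smul_tm,
      ← h.smul_tm, add_smul]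
  | htm a y =>
    obtain ⟨x, rfl⟩ := hB.exists_smul_gen_pi y
    refine ⟨fun i => a * ι (x i), ?_⟩
    have hx : (fun i => x i • hB.gen (w i SB.n) r) =
        ∑ i, x i • (Pi.single i (hB.gen (w i SB.n) r) : ∀ i, hB.Delta (w i SB.n) r) := by
      simp only [← Pi.single_smul]
      exact (Finset.univ_sum_single _).symm
    rw [hx, h.tm_sum]
    exact Finset.sum_congr rfl fun i _ => h.tm_smul _ _ _

include hA in
-- The Tor-vanishing step. A kernel element Σ a_i ε ⊗ gen_i is sent by multiplication into
-- A/J_{r+2}, where it gives a relation among the f_{n+2} v(w_i). Their left independence over A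
-- makes each a_i annihilate the generator of its cell module over A, and this cell module is the
-- globalisation of the one over B.
theorem Glob.layer_injective (hw : ∀ i, IsWalk (Dom b) SB.n (w i)) (hinj : Function.Injective w)
    (hr : ∀ i, (w i SB.n).natAbs + 2 * r = SB.n) :
    Function.Injective (h.map (hB.layer r hw)) := by
  rw [injective_iff_map_eq_zero]
  intro z hz
  obtain ⟨a, rfl⟩ := h.exists_eq_sum hB z
  have hlayer : ∀ i, hB.layer r hw (Pi.single i (hB.gen (w i SB.n) r)) =
      Submodule.Quotient.mk (SB.v (w i) SB.n) := fun i => by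
    have h1 : (Pi.single i (hB.gen (w i SB.n) r) : ∀ i, hB.Delta (w i SB.n) r) =
        fun j => (Pi.single i 1 : Fin m → B) j • hB.gen _ r := by
      funext j
      rcases eq_or_ne j i with rfl | hj
      · rw [Pi.single_eq_same, Pi.single_eq_same, one_smul]
      · rw [Pi.single_eq_of_ne hj, Pi.single_eq_of_ne hj, zero_smul]
    rw [h1, hB.layer_apply, Finset.sum_eq_single i, Pi.single_eq_same, one_mul]
    · exact fun j _ hj => by rw [Pi.single_eq_of_ne hj, zero_mul]
    · exact fun hi => absurd (Finset.mem_univ i) hi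
  rw [map_sum] at hz
  simp only [h.map_tm, hlayer] at hz
  have h1 := congrArg (h.lift (hB.idl (r + 1)) (hA.idl (r + 2)) fun x hx => h.eps_mul_J hA hx) hz
  rw [map_sum, map_zero] at h1
  have hv : ∀ i, a i * ε * ι (SB.v (w i) SB.n) =
      a i * (SA.f SA.n (w i SB.n) * SA.v (w i) SB.n) := fun i => by
    rw [← SB.f_mul_v (hw i), map_mul, mul_assoc, ← mul_assoc ε, h.eps_mul_f (hr i),
      h.compat.map_v _ le_rfl]
  replace h1 : ∑ i, (hA.idl (r + 2)).mkQ (a i * (SA.f SA.n (w i SB.n) * SA.v (w i) SB.n)) = 0 :=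
    (Finset.sum_congr rfl fun i _ => by rw [← hv i]; rfl).trans h1
  rw [← map_sum, Submodule.mkQ_apply, Submodule.Quotient.mk_eq_zero] at h1
  refine Finset.sum_eq_zero fun i _ => ?_
  have h2 : a i • hA.gen (w i SB.n) (r + 1) = 0 :=
    Good.smul_gen_eq_zero_iff.2 (h.mem_J_of_sum_mem hA hw hinj hr h1 i)
  have h3 : h.tm (a i) (hB.gen (w i SB.n) r) = 0 := by
    rw [← h.deltaMap_smul_gen hB hA (hr i), h2, map_zero]
  have h4 := h.map_tm (LinearMap.single B (fun i => hB.Delta (w i SB.n) r) i) (a i)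
    (hB.gen (w i SB.n) r)
  rw [h3, map_zero] at h4
  exact h4.symm

instance (hε : ∀ b, ε * ι b = ι b * ε) :
    Limits.PreservesFiniteColimits (globalisation ε ι hε) :=
  tensorFunctor_preservesFiniteColimits _

include hA in
-- Descending induction on r, with `j` bounding the layers still to be removed. Once 2r > n the
-- ideal is zero and the module is B. In the step, the layer is a finite sum of summands of the
-- acyclic module B/J_{r+1}, its inclusion stays injective under globalisation, and the quotient is
-- B/J_r.
theorem Glob.acyclic_quotient : ∀ (j r : ℕ), SB.n < 2 * r + j →
    Acyclic (globalisation ε ι h.comm) (B ⧸ hB.idl r) := by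
  intro j
  induction j with
  | zero =>
    intro r hr
    have e : (B ⧸ hB.idl r) ≃ₗ[B] B := Submodule.quotEquivOfEqBot _ (by
      refine eq_bot_iff.2 fun x hx => ?_
      rw [Good.mem_idl, SB.J_eq_bot (by omega)] at hx
      exact hx)
    have : Module.Projective B (B ⧸ hB.idl r) := Module.Projective.of_equiv e.symm
    exact acyclic_of_projective _
  | succ j ih =>
    intro r hr
    have hr1 := ih (r + 1) (by omega)
    have hfin : {p | IsWalk (Dom b) SB.n p ∧ (p SB.n).natAbs + 2 * r = SB.n}.Finite :=
      (finite_isWalk (Dom b) SB.n).subset fun p hp => hp.1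
    have := hfin.fintype
    let e := Fintype.equivFin {p | IsWalk (Dom b) SB.n p ∧ (p SB.n).natAbs + 2 * r = SB.n}
    let w : Fin _ → ℕ → ℤ := fun i => (e.symm i).1
    have hw : ∀ i, IsWalk (Dom b) SB.n (w i) := fun i => (e.symm i).2.1
    have hwr : ∀ i, (w i SB.n).natAbs + 2 * r = SB.n := fun i => (e.symm i).2.2
    have hinj : Function.Injective w := Subtype.val_injective.comp e.symm.injective
    refine Acyclic.quotient (F := globalisation ε ι h.comm) (f := hB.layer r hw) (g := hB.proj r) ?_ hr1
      (hB.layer_injective hw hinj hwr) (Submodule.factor_surjective (SB.J_anti SB.n (Nat.le_succ r)))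
      (hB.layer_exact hw (fun p hp hpr => ⟨e ⟨p, hp, hpr⟩, ?_⟩) hwr)
      (h.layer_injective hB hA hw hinj hwr)
    · refine acyclic_pi _ (fun i => hB.Delta (w i SB.n) r) fun i => ?_
      obtain ⟨s, p, hps⟩ := hB.exists_retraction (hwr i)
      exact hr1.retract _ s p hps
    · exact congrArg Subtype.val (e.symm_apply_apply _)

include hA in
theorem Glob.acyclic_delta (hr : l.natAbs + 2 * r = SB.n) :
    Acyclic (globalisation ε ι h.comm) (hB.Delta l r) := by
  obtain ⟨s, p, hps⟩ := hB.exists_retraction hr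
  exact (h.acyclic_quotient hB hA (SB.n + 1) (r + 1) (by omega)).retract _ s p hps

include hB hA in
theorem Glob.leftDerived (hr : l.natAbs + 2 * r = SB.n) (D : ModuleCat.{u} B) (D' : ModuleCat.{u} A)
    (hD : SB.IsStd l D) (hD' : SA.IsStd l D') :
    Nonempty (((globalisation ε ι h.comm).leftDerived 0).obj D ≅ D') ∧
      ∀ i : ℕ, 0 < i → Limits.IsZero (((globalisation ε ι h.comm).leftDerived i).obj D) := by
  obtain ⟨φ⟩ := hB.nonempty_equiv hr hD
  obtain ⟨ψ⟩ := hA.nonempty_equiv (r := r + 1) (by rw [h.n_eq]; omega) hD'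
  refine ⟨⟨(globalisation ε ι h.comm).leftDerivedZeroIsoSelf.app D ≪≫
    (globalisation ε ι h.comm).mapIso φ.symm.toModuleIso ≪≫
    ((h.deltaEquiv hB hA hr).symm.trans ψ).toModuleIso⟩, ?_⟩
  intro i hi
  obtain ⟨i, rfl⟩ := Nat.exists_eq_succ_of_ne_zero hi.ne'
  exact (h.acyclic_delta hB hA hr i).of_iso
    (((globalisation ε ι h.comm).leftDerived (i + 1)).mapIso φ.symm.toModuleIso)

include h hB hA in
theorem Glob.isStd_leftDerived (hr : l.natAbs + 2 * r = SB.n) (hl : Dom b l) :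
    (∃ D, SB.IsStd l D) ∧ (∃ D, SA.IsStd l D) ∧
      ∀ (D : ModuleCat.{u} B) (D' : ModuleCat.{u} A), SB.IsStd l D → SA.IsStd l D' →
        Nonempty (((globalisation ε ι h.comm).leftDerived 0).obj D ≅ D') ∧
          ∀ i : ℕ, 0 < i → Limits.IsZero (((globalisation ε ι h.comm).leftDerived i).obj D) :=
  ⟨hB.exists_isStd hr hl, hA.exists_isStd (r := r + 1) (by rw [h.n_eq]; omega) hl,
    h.leftDerived hB hA hr⟩

end

end BlobSystem

/-! ## Standard modules of the Temperley–Lieb and blob algebras -/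

section

variable {k : Type u} [Field k]

namespace TL

variable {n : ℕ} {q : k}

lemma isL_iff (h2 : q + q⁻¹ ≠ 0) (l : ℕ) (M : ModuleCat.{u} (TL n q)) :
    IsL n q l M ↔ (sys n q h2).IsL l M := by
  refine and_congr_right fun _ => exists_congr fun r => ?_
  rw [cup_eq h2, cup_eq h2, Int.natAbs_natCast]
  refine and_congr_right fun _ => and_congr_right fun _ => ?_
  refine (and_iff_left ⟨fun _ x => ?_, fun hl => absurd hl (by omega)⟩).symm
  change ((1 : TL n q) * _) • x = ((1 : k) • _) • x
  rw [one_mul, one_smul]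

/-- With `e = 1`, a negative weight would require `c` to act by zero. Labelling by ℤ thus adds no
Temperley–Lieb simple modules, and the order by absolute value is the order on ℕ. -/
lemma nonneg_of_isL (h2 : q + q⁻¹ ≠ 0) {l : ℤ} {M : ModuleCat.{u} (TL n q)}
    (h : (sys n q h2).IsL l M) : 0 ≤ l := by
  obtain ⟨-, r, -, ⟨x, hx⟩, -, -, h0⟩ := h
  by_contra! hl
  refine hx ?_
  rw [← h0 hl x]
  change _ = ((1 : TL n q) * _) • x
  rw [one_mul]

lemma isDelta_iff (h2 : q + q⁻¹ ≠ 0) (l : ℕ) (D : ModuleCat.{u} (TL n q)) :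
    IsDelta n q l D ↔ (sys n q h2).IsStd l D := by
  have hC : (fun M : ModuleCat.{u} (TL n q) => ∃ m : ℕ, l ≤ m ∧ IsL n q m M) =
      fun M => ∃ m : ℤ, (m = l ∨ (l : ℤ).natAbs < m.natAbs) ∧ (sys n q h2).IsL m M := by
    funext M
    refine propext ⟨fun ⟨m, hm, hM⟩ => ⟨m, by omega, (isL_iff h2 m M).1 hM⟩, ?_⟩
    rintro ⟨m, hm, hM⟩
    have := nonneg_of_isL h2 hM
    lift m to ℕ using this
    exact ⟨m, by omega, (isL_iff h2 m M).2 hM⟩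
  rw [IsDelta, BlobSystem.IsStd, IsStandard, IsStandard, hC]
  simp only [isL_iff h2]

lemma glob (h2 : q + q⁻¹ ≠ 0) : BlobSystem.Glob (sys n q h2) (sys (n + 2) q h2)
    (incl n q).toRingHom (eps n q) where
  n_eq := rfl
  compat := BlobSystem.compat_algHom _ rfl rfl (fun _ hi => incl_U hi) fun _ => map_one _
  eps := rfl
  comm := eps_comm n q

end TL

namespace Blob

variable {n : ℕ} {q γ δ : k}

lemma isL_iff (h2 : q + q⁻¹ ≠ 0) (hδ : δ ≠ 0) (l : ℤ) (M : ModuleCat.{u} (Blob n q γ δ)) :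
    IsL n q γ δ l M ↔ (sys n q γ δ h2 hδ).IsL l M := by
  refine and_congr_right fun _ => exists_congr fun r => ?_
  rw [cup_eq h2 hδ, cup_eq h2 hδ]
  rfl

lemma isDelta_iff (h2 : q + q⁻¹ ≠ 0) (hδ : δ ≠ 0) (l : ℤ) (D : ModuleCat.{u} (Blob n q γ δ)) :
    IsDelta n q γ δ l D ↔ (sys n q γ δ h2 hδ).IsStd l D := by
  rw [IsDelta, BlobSystem.IsStd, IsStandard, IsStandard]
  simp only [isL_iff h2 hδ]

lemma glob (h2 : q + q⁻¹ ≠ 0) (hδ : δ ≠ 0) :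
    BlobSystem.Glob (sys n q γ δ h2 hδ) (sys (n + 2) q γ δ h2 hδ)
      (incl n q γ δ).toRingHom (eps n q γ δ) where
  n_eq := rfl
  compat := BlobSystem.compat_algHom _ rfl rfl (fun _ hi => incl_U hi) fun hn => incl_e hn
  eps := rfl
  comm := eps_comm n q γ δ

end Blob

end

end

end

/-! ### The theorem for both families -/

theorem mainTheorem7 {k : Type u} [Field k] (q : k) (hq : q ≠ 0) (h2 : q + q⁻¹ ≠ 0) (n : ℕ) :
    (∀ l ∈ TL.weights n,
      (∃ D : ModuleCat.{u} (TL n q), TL.IsDelta n q l D) ∧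
      (∃ D : ModuleCat.{u} (TL (n + 2) q), TL.IsDelta (n + 2) q l D) ∧
      ∀ (D : ModuleCat.{u} (TL n q)) (D' : ModuleCat.{u} (TL (n + 2) q)),
        TL.IsDelta n q l D → TL.IsDelta (n + 2) q l D' →
          Nonempty (((TL.G n q).leftDerived 0).obj D ≅ D') ∧
          ∀ i : ℕ, 0 < i → Limits.IsZero (((TL.G n q).leftDerived i).obj D)) ∧
    (∀ γ δ : k, δ ≠ 0 → ∀ l ∈ Blob.weights n,
      (∃ D : ModuleCat.{u} (Blob n q γ δ), Blob.IsDelta n q γ δ l D) ∧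
      (∃ D : ModuleCat.{u} (Blob (n + 2) q γ δ), Blob.IsDelta (n + 2) q γ δ l D) ∧
      ∀ (D : ModuleCat.{u} (Blob n q γ δ)) (D' : ModuleCat.{u} (Blob (n + 2) q γ δ)),
        Blob.IsDelta n q γ δ l D → Blob.IsDelta (n + 2) q γ δ l D' →
          Nonempty (((Blob.G n q γ δ).leftDerived 0).obj D ≅ D') ∧
          ∀ i : ℕ, 0 < i → Limits.IsZero (((Blob.G n q γ δ).leftDerived i).obj D)) := by
  refine ⟨fun l hl => ?_, fun γ δ hδ l hl => ?_⟩
  · obtain ⟨r, hr⟩ := hl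
    simp only [TL.isDelta_iff h2]
    exact (TL.glob h2).isStd_leftDerived (TL.sys_good h2) (TL.sys_good h2) (l := l) (r := r) hr.symm
      (Or.inr (Int.natCast_nonneg l))
  · obtain ⟨r, hr⟩ := hl
    simp only [Blob.isDelta_iff h2 hδ]
    exact (Blob.glob h2 hδ).isStd_leftDerived (Blob.sys_good h2 hδ) (Blob.sys_good h2 hδ) (r := r) hr.symm
      (Or.inl trivial)
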